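/- **Theorem (presentation of $\mathcal{L}_{0,1}(\overline{U}_q)$).** Let $p\ge 2$, let $q\in\mathbb{C}$ be a primitive $2p$-th root of unity, fix a square root $q^{1/2}$ of $q$, and put $\hat q=q-q^{-1}$, $[n]=(q^n-q^{-n})/\hat q$. *Notation.* Let $\overline{U}_q$ be the restricted quantum group of $\mathfrak{sl}(2)$: the $\mathbb{C}$-algebra generated by $E,F,K$ with relations $$E^p=F^p=0,\quad K^{2p}=1,\quad KE=q^2EK,\quad KF=q^{-2}FK,\quad EF-FE=\frac{K-K^{-1}}{q-q^{-1}},$$ with coproduct $\Delta(E)=1\otimes E+E\otimes K$, $\Delta(F)=F\otimes 1+K^{-1}\otimes F$, $\Delta(K)=K\otimes K$ and counit $\varepsilon(E)=\varepsilon(F)=0$, $\varepsilon(K)=1$. Let $\overline{U}_q^{1/2}$ be its extension by a square root of $K$: it is generated by $E,F,K^{1/2}$ with $E^p=F^p=0$, $(K^{1/2})^{4p}=1$, $K^{1/2}E=qEK^{1/2}$, $K^{1/2}F=q^{-1}FK^{1/2}$ and the same relation for $EF-FE$. Let $$R=\Big(\frac1{4p}\sum_{n,j=0}^{4p-1}q^{-nj/2}K^{n/2}\otimes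 K^{j/2}\Big)\sum_{m=0}^{p-1}\frac{\hat q^m}{[m]!}q^{m(m-1)/2}E^m\otimes F^m\in\overline{U}_q^{1/2}\otimes\overline{U}_q^{1/2},$$ and let $R'$ be $R$ with its tensor factors exchanged. For a finite-dimensional $\overline{U}_q$-module $I$ with a chosen basis let $\overset{I}{T}$ be its matrix of matrix coefficients (elements of $\overline{U}_q^*$), and let $\overset{I}{M}$ be the image of $\overset{I}{T}$ under $\overline{U}_q^*\hookrightarrow \mathrm{T}(\overline{U}_q^*)$, where $\mathrm{T}$ denotes the tensor algebra. The loop algebra $\mathcal{L}_{0,1}(\overline{U}_q)$ is the quotient of $\mathrm{T}(\overline{U}_q^*)$ by the relation identifying $\varepsilon\in\overline{U}_q^*$ (the matrix coefficient of the trivial module) with the unit $1$, and by the fusion relations $$\overset{I\otimes J}{M}_{12}=\overset{I}{M}_1\,\overset{\widetilde I\widetilde J}{(R')}_{12}\,\overset{J}{M}_2\,\overset{\widetilde I\widetilde J}{(R'^{-1})}_{12},$$ for all $I,J$ that are simple or principal indecomposable (that is, indecomposable projective) finite-dimensional $\overline{U}_q$-modules, and all $\overline{U}_q^{1/2}$-modules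 $\widetilde I,\widetilde J$ whose restrictions to $\overline{U}_q$ are $I,J$. Here $M_1=M\otimes\mathbb{I}$, $N_2=\mathbb{I}\otimes N$. Let $\mathcal{X}^+(2)$ be the two-dimensional simple module with basis $v_0,v_1$ and $Kv_0=qv_0$, $Kv_1=q^{-1}v_1$, $Ev_0=0$, $Ev_1=v_0$, $Fv_0=v_1$, $Fv_1=0$; lift it to $\overline{U}_q^{1/2}$ by $K^{1/2}v_0=q^{1/2}v_0$, $K^{1/2}v_1=q^{-1/2}v_1$. Let $\widetilde R_{12}$ and $\widetilde R_{21}$ be the values of $R$ and $R'$ on two copies of this lifting, and write $$M=\overset{\mathcal{X}^+(2)}{M}=\begin{pmatrix}a&b\\c&d\end{pmatrix}$$ for its matrix with coefficients in $\mathcal{L}_{0,1}(\overline{U}_q)$. *Claim.* 1. $a,b,c,d$ generate the algebra $\mathcal{L}_{0,1}(\overline{U}_q)$. 2. $M$ satisfies the reflection equation $\widetilde R_{12}M_1\widetilde R_{21}M_2=M_2\widetilde R_{12}M_1\widetilde R_{21}$; for a $2\times 2$ matrix with entries $a,b,c,d$ in any $\mathbb{C}$-algebra, this equation is equivalent to the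 exchange relations $$da=ad,\quad db=q^2bd,\quad dc=q^{-2}cd,$$ $$ba=ab+q^{-1}\hat q\,bd,\quad cb=bc+q^{-1}\hat q\,(da-d^2),\quad ca=ac-q^{-1}\hat q\,dc.$$ 3. $\mathcal{L}_{0,1}(\overline{U}_q)$ is presented by the generators $a,b,c,d$ and the relations consisting of these six exchange relations together with $$ad-q^2bc=1,\qquad b^p=c^p=0,\qquad d^{2p}=1.$$ 4. The monomials $b^ic^jd^k$ with $0\le i,j\le p-1$, $0\le k\le 2p-1$ form a basis of $\mathcal{L}_{0,1}(\overline{U}_q)$. -/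

import Mathlib

open scoped TensorProduct Kronecker

noncomputable section

namespace LoopAlgebra

/-! ### The restricted quantum group and its extension by a square root of `K` -/

/-- The generators `E, F, K` of the restricted quantum group. -/
inductive UqGen
  | E | F | K

/-- Defining relations of the restricted quantum group, for `q` a primitive `2p`-th root of unity.
Since `K ^ (2p) = 1`, the inverse of `K` is `K ^ (2p - 1)`. -/
inductive UqRel (p : ℕ) (q : ℂ) : FreeAlgebra ℂ UqGen → FreeAlgebra ℂ UqGen → Prop
  | E_pow : UqRel p q (FreeAlgebra.ι ℂ UqGen.E ^ p) 0
  | F_pow : UqRel p q (FreeAlgebra.ι ℂ UqGen.F ^ p) 0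
  | K_pow : UqRel p q (FreeAlgebra.ι ℂ UqGen.K ^ (2 * p)) 1
  | K_E : UqRel p q (FreeAlgebra.ι ℂ UqGen.K * FreeAlgebra.ι ℂ UqGen.E)
      (q ^ 2 • (FreeAlgebra.ι ℂ UqGen.E * FreeAlgebra.ι ℂ UqGen.K))
  | K_F : UqRel p q (FreeAlgebra.ι ℂ UqGen.K * FreeAlgebra.ι ℂ UqGen.F)
      ((q⁻¹) ^ 2 • (FreeAlgebra.ι ℂ UqGen.F * FreeAlgebra.ι ℂ UqGen.K))
  | E_F : UqRel p q (FreeAlgebra.ι ℂ UqGen.E * FreeAlgebra.ι ℂ UqGen.F)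
      (FreeAlgebra.ι ℂ UqGen.F * FreeAlgebra.ι ℂ UqGen.E +
        (q - q⁻¹)⁻¹ • (FreeAlgebra.ι ℂ UqGen.K - FreeAlgebra.ι ℂ UqGen.K ^ (2 * p - 1)))

/-- The restricted quantum group `Ū_q(sl(2))`, as an algebra. -/
def Uq (p : ℕ) (q : ℂ) : Type := RingQuot (UqRel p q)

instance (p : ℕ) (q : ℂ) : Ring (Uq p q) := inferInstanceAs (Ring (RingQuot (UqRel p q)))
instance (p : ℕ) (q : ℂ) : Algebra ℂ (Uq p q) :=
  inferInstanceAs (Algebra ℂ (RingQuot (UqRel p q)))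

namespace Uq

/-- The quotient map from the free algebra. -/
def mk (p : ℕ) (q : ℂ) : FreeAlgebra ℂ UqGen →ₐ[ℂ] Uq p q := RingQuot.mkAlgHom ℂ (UqRel p q)

theorem mk_rel {p : ℕ} {q : ℂ} {x y : FreeAlgebra ℂ UqGen} (h : UqRel p q x y) :
    mk p q x = mk p q y :=
  RingQuot.mkAlgHom_rel ℂ h

/-- The class of a generator. -/
def gen (p : ℕ) (q : ℂ) (x : UqGen) : Uq p q := mk p q (FreeAlgebra.ι ℂ x)

/-- The generator `E`. -/
abbrev E (p : ℕ) (q : ℂ) : Uq p q := gen p q UqGen.E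
/-- The generator `F`. -/
abbrev F (p : ℕ) (q : ℂ) : Uq p q := gen p q UqGen.F
/-- The generator `K`. -/
abbrev K (p : ℕ) (q : ℂ) : Uq p q := gen p q UqGen.K

/-- The images of `E, F, K` under an algebra morphism to be constructed. -/
def genMap {A : Type*} (e f k : A) : UqGen → A
  | UqGen.E => e
  | UqGen.F => f
  | UqGen.K => k

/-- Algebra morphisms out of `Uq p q`, by the universal property of its presentation. -/
def lift {p : ℕ} {q : ℂ} {A : Type*} [Ring A] [Algebra ℂ A] (e f k : A)
    (he : e ^ p = 0) (hf : f ^ p = 0) (hk : k ^ (2 * p) = 1)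
    (hke : k * e = q ^ 2 • (e * k)) (hkf : k * f = (q⁻¹) ^ 2 • (f * k))
    (hef : e * f = f * e + (q - q⁻¹)⁻¹ • (k - k ^ (2 * p - 1))) : Uq p q →ₐ[ℂ] A :=
  RingQuot.liftAlgHom ℂ ⟨FreeAlgebra.lift ℂ (genMap e f k), by
    intro x y h
    induction h <;> simp [genMap, he, hf, hk, hke, hkf]
    simpa using hef⟩

theorem lift_gen {p : ℕ} {q : ℂ} {A : Type*} [Ring A] [Algebra ℂ A] (e f k : A)
    (he : e ^ p = 0) (hf : f ^ p = 0) (hk : k ^ (2 * p) = 1)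
    (hke : k * e = q ^ 2 • (e * k)) (hkf : k * f = (q⁻¹) ^ 2 • (f * k))
    (hef : e * f = f * e + (q - q⁻¹)⁻¹ • (k - k ^ (2 * p - 1))) (x : UqGen) :
    lift e f k he hf hk hke hkf hef (gen p q x) = genMap e f k x := by
  have h := RingQuot.liftAlgHom_mkAlgHom_apply ℂ (FreeAlgebra.lift ℂ (genMap e f k))
    (s := UqRel p q) (by
      intro x y h
      induction h <;> simp [genMap, he, hf, hk, hke, hkf]
      simpa using hef) (FreeAlgebra.ι ℂ x)
  exact h.trans (FreeAlgebra.lift_ι_apply _ _)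

theorem E_pow (p : ℕ) (q : ℂ) : E p q ^ p = 0 := by
  simpa [gen] using mk_rel (UqRel.E_pow (p := p) (q := q))

theorem F_pow (p : ℕ) (q : ℂ) : F p q ^ p = 0 := by
  simpa [gen] using mk_rel (UqRel.F_pow (p := p) (q := q))

theorem K_pow (p : ℕ) (q : ℂ) : K p q ^ (2 * p) = 1 := by
  simpa [gen] using mk_rel (UqRel.K_pow (p := p) (q := q))

theorem K_mul_E (p : ℕ) (q : ℂ) : K p q * E p q = q ^ 2 • (E p q * K p q) := by
  simpa [gen] using mk_rel (UqRel.K_E (p := p) (q := q))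

theorem K_mul_F (p : ℕ) (q : ℂ) : K p q * F p q = (q⁻¹) ^ 2 • (F p q * K p q) := by
  simpa [gen] using mk_rel (UqRel.K_F (p := p) (q := q))

theorem E_mul_F (p : ℕ) (q : ℂ) : E p q * F p q =
    F p q * E p q + (q - q⁻¹)⁻¹ • (K p q - K p q ^ (2 * p - 1)) := by
  simpa [gen] using mk_rel (UqRel.E_F (p := p) (q := q))

end Uq

/-- The generators `E, F` and `k = K^{1/2}` of the extended restricted quantum group. -/
inductive UqHalfGen
  | E | F | k

/-- Defining relations of the extension of the restricted quantum group by a square root `k`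
of `K`. Since `k ^ (4p) = 1`, the inverse of `K = k ^ 2` is `k ^ (4p - 2)`. -/
inductive UqHalfRel (p : ℕ) (q : ℂ) : FreeAlgebra ℂ UqHalfGen → FreeAlgebra ℂ UqHalfGen → Prop
  | E_pow : UqHalfRel p q (FreeAlgebra.ι ℂ UqHalfGen.E ^ p) 0
  | F_pow : UqHalfRel p q (FreeAlgebra.ι ℂ UqHalfGen.F ^ p) 0
  | k_pow : UqHalfRel p q (FreeAlgebra.ι ℂ UqHalfGen.k ^ (4 * p)) 1
  | k_E : UqHalfRel p q (FreeAlgebra.ι ℂ UqHalfGen.k * FreeAlgebra.ι ℂ UqHalfGen.E)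
      (q • (FreeAlgebra.ι ℂ UqHalfGen.E * FreeAlgebra.ι ℂ UqHalfGen.k))
  | k_F : UqHalfRel p q (FreeAlgebra.ι ℂ UqHalfGen.k * FreeAlgebra.ι ℂ UqHalfGen.F)
      (q⁻¹ • (FreeAlgebra.ι ℂ UqHalfGen.F * FreeAlgebra.ι ℂ UqHalfGen.k))
  | E_F : UqHalfRel p q (FreeAlgebra.ι ℂ UqHalfGen.E * FreeAlgebra.ι ℂ UqHalfGen.F)
      (FreeAlgebra.ι ℂ UqHalfGen.F * FreeAlgebra.ι ℂ UqHalfGen.E +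
        (q - q⁻¹)⁻¹ • (FreeAlgebra.ι ℂ UqHalfGen.k ^ 2 -
          FreeAlgebra.ι ℂ UqHalfGen.k ^ (4 * p - 2)))

/-- The extension of the restricted quantum group by a square root of `K`, as an algebra. -/
def UqHalf (p : ℕ) (q : ℂ) : Type := RingQuot (UqHalfRel p q)

instance (p : ℕ) (q : ℂ) : Ring (UqHalf p q) :=
  inferInstanceAs (Ring (RingQuot (UqHalfRel p q)))
instance (p : ℕ) (q : ℂ) : Algebra ℂ (UqHalf p q) :=
  inferInstanceAs (Algebra ℂ (RingQuot (UqHalfRel p q)))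

namespace UqHalf

/-- The quotient map from the free algebra. -/
def mk (p : ℕ) (q : ℂ) : FreeAlgebra ℂ UqHalfGen →ₐ[ℂ] UqHalf p q := RingQuot.mkAlgHom ℂ (UqHalfRel p q)

theorem mk_rel {p : ℕ} {q : ℂ} {x y : FreeAlgebra ℂ UqHalfGen} (h : UqHalfRel p q x y) :
    mk p q x = mk p q y :=
  RingQuot.mkAlgHom_rel ℂ h

/-- The class of a generator. -/
def gen (p : ℕ) (q : ℂ) (x : UqHalfGen) : UqHalf p q := mk p q (FreeAlgebra.ι ℂ x)

/-- The generator `E`. -/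
abbrev E (p : ℕ) (q : ℂ) : UqHalf p q := gen p q UqHalfGen.E
/-- The generator `F`. -/
abbrev F (p : ℕ) (q : ℂ) : UqHalf p q := gen p q UqHalfGen.F
/-- The generator `k = K^{1/2}`. -/
abbrev k (p : ℕ) (q : ℂ) : UqHalf p q := gen p q UqHalfGen.k

/-- The images of `E, F, k` under an algebra morphism to be constructed. -/
def genMap {A : Type*} (e f k : A) : UqHalfGen → A
  | UqHalfGen.E => e
  | UqHalfGen.F => f
  | UqHalfGen.k => k

/-- Algebra morphisms out of `UqHalf p q`, by the universal property of its presentation. -/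
def lift {p : ℕ} {q : ℂ} {A : Type*} [Ring A] [Algebra ℂ A] (e f k : A)
    (he : e ^ p = 0) (hf : f ^ p = 0) (hk : k ^ (4 * p) = 1)
    (hke : k * e = q • (e * k)) (hkf : k * f = q⁻¹ • (f * k))
    (hef : e * f = f * e + (q - q⁻¹)⁻¹ • (k ^ 2 - k ^ (4 * p - 2))) : UqHalf p q →ₐ[ℂ] A :=
  RingQuot.liftAlgHom ℂ ⟨FreeAlgebra.lift ℂ (genMap e f k), by
    intro x y h
    induction h <;> simp [genMap, he, hf, hk, hke, hkf]
    simpa using hef⟩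

theorem E_pow (p : ℕ) (q : ℂ) : E p q ^ p = 0 := by
  simpa [gen] using mk_rel (UqHalfRel.E_pow (p := p) (q := q))

theorem F_pow (p : ℕ) (q : ℂ) : F p q ^ p = 0 := by
  simpa [gen] using mk_rel (UqHalfRel.F_pow (p := p) (q := q))

theorem k_pow (p : ℕ) (q : ℂ) : k p q ^ (4 * p) = 1 := by
  simpa [gen] using mk_rel (UqHalfRel.k_pow (p := p) (q := q))

theorem k_mul_E (p : ℕ) (q : ℂ) : k p q * E p q = q • (E p q * k p q) := by
  simpa [gen] using mk_rel (UqHalfRel.k_E (p := p) (q := q))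

theorem k_mul_F (p : ℕ) (q : ℂ) : k p q * F p q = q⁻¹ • (F p q * k p q) := by
  simpa [gen] using mk_rel (UqHalfRel.k_F (p := p) (q := q))

theorem E_mul_F (p : ℕ) (q : ℂ) : E p q * F p q =
    F p q * E p q + (q - q⁻¹)⁻¹ • (k p q ^ 2 - k p q ^ (4 * p - 2)) := by
  simpa [gen] using mk_rel (UqHalfRel.E_F (p := p) (q := q))

end UqHalf

/-- The canonical map from the restricted quantum group to its extension, sending `K` to
the square of `K^{1/2}`. -/
def toHalf (p : ℕ) (q : ℂ) : Uq p q →ₐ[ℂ] UqHalf p q :=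
  Uq.lift (UqHalf.E p q) (UqHalf.F p q) (UqHalf.k p q ^ 2) (UqHalf.E_pow p q) (UqHalf.F_pow p q)
    (by rw [← pow_mul, ← mul_assoc]; exact UqHalf.k_pow p q)
    (by
      rw [pow_two, mul_assoc, UqHalf.k_mul_E, mul_smul_comm, ← mul_assoc, UqHalf.k_mul_E,
        smul_mul_assoc, smul_smul, mul_assoc, ← pow_two q])
    (by
      rw [pow_two, mul_assoc, UqHalf.k_mul_F, mul_smul_comm, ← mul_assoc, UqHalf.k_mul_F,
        smul_mul_assoc, smul_smul, mul_assoc, ← pow_two q⁻¹])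
    (by
      rw [UqHalf.E_mul_F, ← pow_mul]
      congr 4
      omega)

/-! ### The coproduct and the counit of the restricted quantum group -/

/-- Gaussian binomial coefficients at `z`. -/
def gaussBinom (z : ℂ) : ℕ → ℕ → ℂ
  | _, 0 => 1
  | 0, _ + 1 => 0
  | n + 1, k + 1 => gaussBinom z n k + z ^ (k + 1) * gaussBinom z n (k + 1)

theorem gaussBinom_eq_zero_of_lt (z : ℂ) : ∀ n k : ℕ, n < k → gaussBinom z n k = 0
  | _, 0, h => by omega
  | 0, _ + 1, _ => by simp [gaussBinom]
  | n + 1, k + 1, h => by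
    simp [gaussBinom, gaussBinom_eq_zero_of_lt z n k (by omega),
      gaussBinom_eq_zero_of_lt z n (k + 1) (by omega)]

theorem gaussBinom_mul (z : ℂ) : ∀ n k j : ℕ, k + j = n → gaussBinom z n k *
    ((∏ i ∈ Finset.range k, (1 - z ^ (i + 1))) * ∏ i ∈ Finset.range j, (1 - z ^ (i + 1))) =
      ∏ i ∈ Finset.range n, (1 - z ^ (i + 1)) := by
  intro n
  induction n with
  | zero =>
    intro k j h
    obtain ⟨rfl, rfl⟩ : k = 0 ∧ j = 0 := by omega
    simp [gaussBinom]
  | succ n ih =>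
    intro k j h
    rcases k with _ | k
    · obtain rfl : j = n + 1 := by omega
      simp [gaussBinom]
    rcases j with _ | j
    · obtain rfl : k = n := by omega
      have h1 := ih k 0 (by omega)
      simp only [gaussBinom, gaussBinom_eq_zero_of_lt z k (k + 1) (by omega),
        Finset.prod_range_succ _ k]
      linear_combination (1 - z ^ (k + 1)) * h1
    · have h1 := ih k (j + 1) (by omega)
      have h2 := ih (k + 1) j (by omega)
      have h3 : z ^ (n + 1) = z ^ (k + 1) * z ^ (j + 1) := by
        rw [← pow_add]; congr 1; omega
      simp only [gaussBinom, Finset.prod_range_succ _ k, Finset.prod_range_succ _ j,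
        Finset.prod_range_succ _ n, h3] at h1 h2 ⊢
      linear_combination (1 - z ^ (k + 1)) * h1 + z ^ (k + 1) * (1 - z ^ (j + 1)) * h2

theorem gaussBinom_expand {A : Type*} [Ring A] [Algebra ℂ A] (z : ℂ) (x y : A)
    (h : y * x = z • (x * y)) (n : ℕ) : (x + y) ^ n =
      ∑ k ∈ Finset.range (n + 1), gaussBinom z n k • (x ^ k * y ^ (n - k)) := by
  have hyx : ∀ k : ℕ, y * x ^ k = z ^ k • (x ^ k * y) := by
    intro k
    induction k with
    | zero => simp
    | succ k ih =>
      rw [pow_succ x, ← mul_assoc, ih, smul_mul_assoc, mul_assoc, h, mul_smul_comm, smul_smul,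
        ← mul_assoc, ← pow_succ z]
  induction n with
  | zero => simp [gaussBinom]
  | succ n ih =>
    have hx : x * (x + y) ^ n =
        ∑ k ∈ Finset.range (n + 1), gaussBinom z n k • (x ^ (k + 1) * y ^ (n - k)) := by
      rw [ih, Finset.mul_sum]
      refine Finset.sum_congr rfl fun k _ => ?_
      rw [mul_smul_comm, ← mul_assoc, ← pow_succ']
    have hy : y * (x + y) ^ n = y ^ (n + 1) + ∑ k ∈ Finset.range (n + 1),
        (z ^ (k + 1) * gaussBinom z n (k + 1)) • (x ^ (k + 1) * y ^ (n - k)) := by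
      rw [Finset.sum_range_succ _ n, gaussBinom_eq_zero_of_lt z n (n + 1) (by omega), ih,
        Finset.mul_sum, Finset.sum_range_succ' _ n]
      simp only [mul_zero, zero_smul, add_zero, pow_zero, one_mul, Nat.sub_zero]
      rw [add_comm]
      congr 1
      · simp [gaussBinom, pow_succ']
      · refine Finset.sum_congr rfl fun k hk => ?_
        have hk' : k < n := Finset.mem_range.mp hk
        rw [mul_smul_comm, ← mul_assoc, hyx, smul_mul_assoc, smul_smul, mul_assoc, ← pow_succ',
          mul_comm (gaussBinom z n (k + 1))]
        congr 4
        omega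
    rw [pow_succ', add_mul, hx, hy, Finset.sum_range_succ' _ (n + 1), add_left_comm,
      ← Finset.sum_add_distrib, add_comm]
    congr 1
    · refine Finset.sum_congr rfl fun k _ => ?_
      rw [gaussBinom, add_smul]
      congr 4 <;> omega
    · simp [gaussBinom]

theorem add_pow_eq_zero_of_skew {A : Type*} [Ring A] [Algebra ℂ A] {z : ℂ} {p : ℕ}
    (hp : 0 < p) (hz : IsPrimitiveRoot z p) (x y : A) (h : y * x = z • (x * y))
    (hx : x ^ p = 0) (hy : y ^ p = 0) : (x + y) ^ p = 0 := by
  rw [gaussBinom_expand z x y h]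
  refine Finset.sum_eq_zero fun k hk => ?_
  have hk' : k < p + 1 := Finset.mem_range.mp hk
  rcases Nat.eq_zero_or_pos k with rfl | hk0
  · simp [hy]
  rcases Nat.lt_or_ge k p with hkp | hkp
  · have hne : ∀ m : ℕ, m < p → ∏ i ∈ Finset.range m, (1 - z ^ (i + 1)) ≠ 0 := by
      intro m hm
      refine Finset.prod_ne_zero_iff.mpr fun i hi => ?_
      have hi' : i < m := Finset.mem_range.mp hi
      exact sub_ne_zero.mpr (hz.pow_ne_one_of_pos_of_lt (by omega) (by omega)).symm
    have h0 : ∏ i ∈ Finset.range p, (1 - z ^ (i + 1)) = 0 := by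
      refine Finset.prod_eq_zero (i := p - 1) (Finset.mem_range.mpr (by omega)) ?_
      rw [Nat.sub_add_cancel hp, hz.pow_eq_one, sub_self]
    have h1 := gaussBinom_mul z p k (p - k) (by omega)
    rw [h0] at h1
    rcases mul_eq_zero.mp h1 with h2 | h2
    · rw [h2, zero_smul]
    · exact absurd h2 (mul_ne_zero (hne k hkp) (hne (p - k) (by omega)))
  · obtain rfl : k = p := by omega
    simp [hx]

namespace Uq

variable {p : ℕ} {q : ℂ}

theorem q_ne_zero (hp : 2 ≤ p) (hq : IsPrimitiveRoot q (2 * p)) : q ≠ 0 :=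
  hq.ne_zero (by omega)

theorem q_sub_inv_ne_zero (hp : 2 ≤ p) (hq : IsPrimitiveRoot q (2 * p)) : q - q⁻¹ ≠ 0 := by
  intro h
  have h0 := q_ne_zero hp hq
  have h1 : q ^ 2 = 1 := by
    have h2 : q * (q - q⁻¹) = q ^ 2 - 1 := by
      rw [mul_sub, mul_inv_cancel₀ h0, pow_two]
    rw [h, mul_zero] at h2
    exact (sub_eq_zero.mp h2.symm)
  exact hq.pow_ne_one_of_pos_of_lt (by omega) (by omega) h1

theorem q_sq_primitive (hp : 2 ≤ p) (hq : IsPrimitiveRoot q (2 * p)) :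
    IsPrimitiveRoot (q ^ 2) p :=
  hq.pow (by omega) rfl

/-- The inverse of `K`. -/
abbrev Kinv (p : ℕ) (q : ℂ) : Uq p q := K p q ^ (2 * p - 1)

theorem K_mul_Kinv (hp : 2 ≤ p) : K p q * Kinv p q = 1 := by
  rw [← pow_succ', Nat.sub_add_cancel (by omega), K_pow]

theorem Kinv_mul_K (hp : 2 ≤ p) : Kinv p q * K p q = 1 := by
  rw [← pow_succ, Nat.sub_add_cancel (by omega), K_pow]

theorem Kinv_mul_F (hp : 2 ≤ p) (hq : IsPrimitiveRoot q (2 * p)) :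
    Kinv p q * F p q = q ^ 2 • (F p q * Kinv p q) := by
  have h0 := q_ne_zero hp hq
  have h1 : F p q * K p q = q ^ 2 • (K p q * F p q) := by
    rw [K_mul_F, smul_smul, ← mul_pow, mul_inv_cancel₀ h0, one_pow, one_smul]
  calc Kinv p q * F p q = Kinv p q * (F p q * K p q) * Kinv p q := by
        rw [mul_assoc, mul_assoc, K_mul_Kinv hp, mul_one]
    _ = q ^ 2 • (F p q * Kinv p q) := by
        rw [h1, mul_smul_comm, smul_mul_assoc, ← mul_assoc, Kinv_mul_K hp, one_mul]

theorem Kinv_mul_E (hp : 2 ≤ p) (hq : IsPrimitiveRoot q (2 * p)) :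
    Kinv p q * E p q = (q⁻¹) ^ 2 • (E p q * Kinv p q) := by
  have h0 := q_ne_zero hp hq
  have h1 : E p q * K p q = (q⁻¹) ^ 2 • (K p q * E p q) := by
    rw [K_mul_E, smul_smul, ← mul_pow, inv_mul_cancel₀ h0, one_pow, one_smul]
  calc Kinv p q * E p q = Kinv p q * (E p q * K p q) * Kinv p q := by
        rw [mul_assoc, mul_assoc, K_mul_Kinv hp, mul_one]
    _ = (q⁻¹) ^ 2 • (E p q * Kinv p q) := by
        rw [h1, mul_smul_comm, smul_mul_assoc, ← mul_assoc, Kinv_mul_K hp, one_mul]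

/-- The coproduct: `Δ(E) = 1 ⊗ E + E ⊗ K`, `Δ(F) = F ⊗ 1 + K⁻¹ ⊗ F`, `Δ(K) = K ⊗ K`. -/
def comul (hp : 2 ≤ p) (hq : IsPrimitiveRoot q (2 * p)) : Uq p q →ₐ[ℂ] Uq p q ⊗[ℂ] Uq p q :=
  lift (1 ⊗ₜ E p q + E p q ⊗ₜ K p q) (F p q ⊗ₜ 1 + Kinv p q ⊗ₜ F p q) (K p q ⊗ₜ K p q)
    (add_pow_eq_zero_of_skew (by omega) (q_sq_primitive hp hq) _ _
      (by
        rw [Algebra.TensorProduct.tmul_mul_tmul, Algebra.TensorProduct.tmul_mul_tmul, K_mul_E,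
          TensorProduct.tmul_smul, one_mul, mul_one])
      (by rw [Algebra.TensorProduct.tmul_pow, E_pow, TensorProduct.tmul_zero])
      (by rw [Algebra.TensorProduct.tmul_pow, E_pow, TensorProduct.zero_tmul]))
    (add_pow_eq_zero_of_skew (by omega) (q_sq_primitive hp hq) _ _
      (by
        rw [Algebra.TensorProduct.tmul_mul_tmul, Algebra.TensorProduct.tmul_mul_tmul,
          Kinv_mul_F hp hq, TensorProduct.smul_tmul', one_mul, mul_one])
      (by rw [Algebra.TensorProduct.tmul_pow, F_pow, TensorProduct.zero_tmul])
      (by rw [Algebra.TensorProduct.tmul_pow, F_pow, TensorProduct.tmul_zero]))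
    (by rw [Algebra.TensorProduct.tmul_pow, K_pow, Algebra.TensorProduct.one_def])
    (by
      simp only [mul_add, add_mul, Algebra.TensorProduct.tmul_mul_tmul, K_mul_E, mul_one, one_mul,
        TensorProduct.tmul_smul, ← TensorProduct.smul_tmul', smul_add])
    (by
      simp only [mul_add, add_mul, Algebra.TensorProduct.tmul_mul_tmul, K_mul_F, mul_one, one_mul,
        TensorProduct.tmul_smul, ← TensorProduct.smul_tmul', smul_add, ← pow_succ, ← pow_succ'])
    (by
      simp only [mul_add, add_mul, Algebra.TensorProduct.tmul_mul_tmul, mul_one, one_mul,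
        E_mul_F, K_mul_F, Kinv_mul_E hp hq, Algebra.TensorProduct.tmul_pow,
        TensorProduct.tmul_smul, ← TensorProduct.smul_tmul', TensorProduct.tmul_add,
        TensorProduct.add_tmul, TensorProduct.tmul_sub, TensorProduct.sub_tmul, smul_sub]
      abel)

/-- The counit: `ε(E) = ε(F) = 0`, `ε(K) = 1`. -/
def counit (hp : 2 ≤ p) : Uq p q →ₐ[ℂ] ℂ :=
  lift 0 0 1 (zero_pow (by omega)) (zero_pow (by omega)) (one_pow _) (by simp) (by simp) (by simp)

end Uq

/-! ### Representations -/

/-- A finite-dimensional module with a chosen basis, as a matrix representation: `ρ x` is the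
matrix of `x` in the basis. -/
abbrev MatRep (A : Type) [Ring A] [Algebra ℂ A] (n : ℕ) : Type :=
  A →ₐ[ℂ] Matrix (Fin n) (Fin n) ℂ

/-- The left module underlying a matrix representation: column vectors. -/
def RepModule {A : Type} [Ring A] [Algebra ℂ A] {n : ℕ} (_ρ : MatRep A n) : Type := Fin n → ℂ

instance {A : Type} [Ring A] [Algebra ℂ A] {n : ℕ} (ρ : MatRep A n) :
    AddCommGroup (RepModule ρ) := inferInstanceAs (AddCommGroup (Fin n → ℂ))

instance {A : Type} [Ring A] [Algebra ℂ A] {n : ℕ} (ρ : MatRep A n) :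
    Module A (RepModule ρ) :=
  Module.compHom (Fin n → ℂ) ((Matrix.toLinAlgEquiv'.toAlgHom.comp ρ).toRingHom)

/-- The module is a principal indecomposable module: projective, nonzero, and not the direct
sum of two nonzero submodules. -/
def IsPIM (A : Type) [Ring A] (V : Type) [AddCommGroup V] [Module A V] : Prop :=
  Module.Projective A V ∧ Nontrivial V ∧
    ∀ N N' : Submodule A V, IsCompl N N' → N = ⊥ ∨ N' = ⊥

/-- The representation is simple or principal indecomposable. -/
def IsSimpleOrPIM {A : Type} [Ring A] [Algebra ℂ A] {n : ℕ} (ρ : MatRep A n) : Prop :=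
  IsSimpleModule A (RepModule ρ) ∨ IsPIM A (RepModule ρ)

/-- `ρ'` is a lifting of `ρ` to the extended quantum group. -/
def IsLifting {p : ℕ} {q : ℂ} {n : ℕ} (ρ' : MatRep (UqHalf p q) n) (ρ : MatRep (Uq p q) n) :
    Prop :=
  ρ'.comp (toHalf p q) = ρ

/-- Evaluation of a two-tensor in a pair of representations: `x ⊗ y` is sent to the Kronecker
product of the matrices of `x` and of `y`. -/
def evalTensor {A : Type} [Ring A] [Algebra ℂ A] {m n : ℕ} (ρ : MatRep A m) (σ : MatRep A n) :
    A ⊗[ℂ] A →ₐ[ℂ] Matrix (Fin m × Fin n) (Fin m × Fin n) ℂ :=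
  (Matrix.kroneckerAlgEquiv (Fin m) (Fin n) ℂ).toAlgHom.comp (Algebra.TensorProduct.map ρ σ)

/-- The tensor product of two representations of the restricted quantum group. -/
def tensorRep {p : ℕ} {q : ℂ} (hp : 2 ≤ p) (hq : IsPrimitiveRoot q (2 * p)) {m n : ℕ}
    (ρ : MatRep (Uq p q) m) (σ : MatRep (Uq p q) n) :
    Uq p q →ₐ[ℂ] Matrix (Fin m × Fin n) (Fin m × Fin n) ℂ :=
  (evalTensor ρ σ).comp (Uq.comul hp hq)

theorem diag_two_pow (x y : ℂ) (n : ℕ) : !![x, 0; 0, y] ^ n = !![x ^ n, 0; 0, y ^ n] := by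
  induction n with
  | zero => simp [Matrix.one_fin_two]
  | succ n ih => rw [pow_succ, ih, Matrix.mul_fin_two]; simp [pow_succ]

/-- The two-dimensional simple module `X⁺(2)` in its canonical basis `v₀, v₁`:
`K v₀ = q v₀`, `K v₁ = q⁻¹ v₁`, `E v₀ = 0`, `E v₁ = v₀`, `F v₀ = v₁`, `F v₁ = 0`. -/
def X2 {p : ℕ} {q : ℂ} (hp : 2 ≤ p) (hq : IsPrimitiveRoot q (2 * p)) : MatRep (Uq p q) 2 :=
  Uq.lift !![0, 1; 0, 0] !![0, 0; 1, 0] !![q, 0; 0, q⁻¹]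
    (pow_eq_zero_of_le hp (by
      rw [pow_two, Matrix.mul_fin_two]
      ext i j
      fin_cases i <;> fin_cases j <;> simp))
    (pow_eq_zero_of_le hp (by
      rw [pow_two, Matrix.mul_fin_two]
      ext i j
      fin_cases i <;> fin_cases j <;> simp))
    (by
      rw [diag_two_pow, inv_pow, hq.pow_eq_one, inv_one, Matrix.one_fin_two])
    (by
      have h0 := Uq.q_ne_zero hp hq
      simp
      field_simp)
    (by
      have h0 := Uq.q_ne_zero hp hq
      simp
      field_simp)
    (by
      have h0 := Uq.q_ne_zero hp hq
      have h1 := Uq.q_sub_inv_ne_zero hp hq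
      have h2 : q ^ (2 * p - 1) = q⁻¹ := by
        apply mul_left_cancel₀ h0
        rw [← pow_succ', Nat.sub_add_cancel (by omega), hq.pow_eq_one, mul_inv_cancel₀ h0]
      have h3 : (q - q⁻¹)⁻¹ * (q⁻¹ - q) = -1 := by
        rw [← neg_sub q, mul_neg, inv_mul_cancel₀ h1]
      rw [diag_two_pow, inv_pow, h2, inv_inv]
      ext i j
      fin_cases i <;> fin_cases j <;> simp [h1, h3])

/-! ### The `R`-matrix -/

/-- The `q`-integer `[n] = (q^n - q^{-n}) / (q - q⁻¹)`. -/
def qInt (q : ℂ) (n : ℕ) : ℂ := (q ^ n - (q⁻¹) ^ n) / (q - q⁻¹)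

/-- The `q`-factorial `[n]! = [1] [2] ⋯ [n]`. -/
def qFact (q : ℂ) (n : ℕ) : ℂ := ∏ i ∈ Finset.range n, qInt q (i + 1)

/-- The element `q^{H ⊗ H / 2}`, where `r = q^{1/2}` is the fixed square root of `q`. -/
def cartanPart (p : ℕ) (q r : ℂ) : UqHalf p q ⊗[ℂ] UqHalf p q :=
  (1 / (4 * p : ℂ)) • ∑ n ∈ Finset.range (4 * p), ∑ j ∈ Finset.range (4 * p),
    (r⁻¹) ^ (n * j) • ((UqHalf.k p q ^ n) ⊗ₜ[ℂ] (UqHalf.k p q ^ j))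

/-- The universal `R`-matrix of the extended quantum group. The exponent `m (m - 1) / 2` is
an exact division. -/
def RMatrix (p : ℕ) (q r : ℂ) : UqHalf p q ⊗[ℂ] UqHalf p q :=
  cartanPart p q r * ∑ m ∈ Finset.range p,
    ((q - q⁻¹) ^ m / qFact q m * q ^ (m * (m - 1) / 2)) •
      ((UqHalf.E p q ^ m) ⊗ₜ[ℂ] (UqHalf.F p q ^ m))

/-- The flipped `R`-matrix `R' = ∑ bᵢ ⊗ aᵢ`, where `R = ∑ aᵢ ⊗ bᵢ`. -/
def RMatrix' (p : ℕ) (q r : ℂ) : UqHalf p q ⊗[ℂ] UqHalf p q :=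
  Algebra.TensorProduct.comm ℂ (UqHalf p q) (UqHalf p q) (RMatrix p q r)

/-! ### The loop algebra -/

/-- `M₁ = M ⊗ 𝕀ₙ`. -/
def leg1 {A : Type} [Ring A] {m n : ℕ} (M : Matrix (Fin m) (Fin m) A) :
    Matrix (Fin m × Fin n) (Fin m × Fin n) A :=
  M ⊗ₖ (1 : Matrix (Fin n) (Fin n) A)

/-- `N₂ = 𝕀ₘ ⊗ N`. -/
def leg2 {A : Type} [Ring A] {m n : ℕ} (N : Matrix (Fin n) (Fin n) A) :
    Matrix (Fin m × Fin n) (Fin m × Fin n) A :=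
  (1 : Matrix (Fin m) (Fin m) A) ⊗ₖ N

/-- A scalar matrix viewed with coefficients in an algebra. -/
def scalarMat {ι : Type} (A : Type) [Ring A] [Algebra ℂ A] (Q : Matrix ι ι ℂ) : Matrix ι ι A :=
  Q.map (algebraMap ℂ A)

/-- The matrix of matrix coefficients of a representation, as elements of degree one of the
tensor algebra of the dual. -/
def freeM {p : ℕ} {q : ℂ} {ι : Type} [Fintype ι] [DecidableEq ι]
    (ρ : Uq p q →ₐ[ℂ] Matrix ι ι ℂ) :
    Matrix ι ι (TensorAlgebra ℂ (Module.Dual ℂ (Uq p q))) :=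
  Matrix.of fun a b => TensorAlgebra.ι ℂ ((Matrix.entryLinearMap ℂ ℂ a b).comp ρ.toLinearMap)

/-- The right-hand side `M₁ R'₁₂ M₂ (R'⁻¹)₁₂` of the fusion relation, with `R'` evaluated on the
representations `I'`, `J'` of the extended quantum group. -/
def fusionRHS {p : ℕ} {q : ℂ} (r : ℂ) {m n : ℕ} (I : MatRep (Uq p q) m) (J : MatRep (Uq p q) n)
    (I' : MatRep (UqHalf p q) m) (J' : MatRep (UqHalf p q) n) :
    Matrix (Fin m × Fin n) (Fin m × Fin n) (TensorAlgebra ℂ (Module.Dual ℂ (Uq p q))) :=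
  let R' := evalTensor I' J' (RMatrix' p q r)
  leg1 (freeM I) * scalarMat _ R' * leg2 (freeM J) * scalarMat _ R'⁻¹

/-- The relations of the loop algebra: the fusion relations for all simple or principal
indecomposable modules `I`, `J` (in all bases) and all their liftings, together with the
normalization that the coefficient of the trivial module is the unit. -/
inductive LoopRel {p : ℕ} {q : ℂ} (hp : 2 ≤ p) (hq : IsPrimitiveRoot q (2 * p)) (r : ℂ) :
    TensorAlgebra ℂ (Module.Dual ℂ (Uq p q)) → TensorAlgebra ℂ (Module.Dual ℂ (Uq p q)) → Prop
  | unit : LoopRel hp hq r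
      (TensorAlgebra.ι ℂ (Uq.counit (p := p) (q := q) hp).toLinearMap) 1
  | fusion {m n : ℕ} (I : MatRep (Uq p q) m) (J : MatRep (Uq p q) n)
      (I' : MatRep (UqHalf p q) m) (J' : MatRep (UqHalf p q) n)
      (hI : IsSimpleOrPIM I) (hJ : IsSimpleOrPIM J) (hI' : IsLifting I' I) (hJ' : IsLifting J' J)
      (x y : Fin m × Fin n) : LoopRel hp hq r
        (freeM (tensorRep hp hq I J) x y) (fusionRHS r I J I' J' x y)

/-- The loop algebra `L_{0,1}(Ū_q)`. -/
def L01 {p : ℕ} {q : ℂ} (hp : 2 ≤ p) (hq : IsPrimitiveRoot q (2 * p)) (r : ℂ) : Type :=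
  RingQuot (LoopRel hp hq r)

instance {p : ℕ} {q : ℂ} (hp : 2 ≤ p) (hq : IsPrimitiveRoot q (2 * p)) (r : ℂ) :
    Ring (L01 hp hq r) := inferInstanceAs (Ring (RingQuot (LoopRel hp hq r)))
instance {p : ℕ} {q : ℂ} (hp : 2 ≤ p) (hq : IsPrimitiveRoot q (2 * p)) (r : ℂ) :
    Algebra ℂ (L01 hp hq r) := inferInstanceAs (Algebra ℂ (RingQuot (LoopRel hp hq r)))

/-- The quotient map from the tensor algebra. -/
def L01.mk {p : ℕ} {q : ℂ} (hp : 2 ≤ p) (hq : IsPrimitiveRoot q (2 * p)) (r : ℂ) :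
    TensorAlgebra ℂ (Module.Dual ℂ (Uq p q)) →ₐ[ℂ] L01 hp hq r :=
  RingQuot.mkAlgHom ℂ (LoopRel hp hq r)

/-- The matrix `M` of the representation `I`, with coefficients in the loop algebra. -/
def loopM {p : ℕ} {q : ℂ} (hp : 2 ≤ p) (hq : IsPrimitiveRoot q (2 * p)) (r : ℂ) {n : ℕ}
    (I : MatRep (Uq p q) n) : Matrix (Fin n) (Fin n) (L01 hp hq r) :=
  (freeM I).map (L01.mk hp hq r)

/-! ### The presentation -/

/-- The lifting of `X⁺(2)` with `K^{1/2} v₀ = q^{1/2} v₀` and `K^{1/2} v₁ = q^{-1/2} v₁`. -/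
def X2lift {p : ℕ} {q : ℂ} (hp : 2 ≤ p) (hq : IsPrimitiveRoot q (2 * p)) (r : ℂ)
    (hr : r ^ 2 = q) : MatRep (UqHalf p q) 2 :=
  UqHalf.lift !![0, 1; 0, 0] !![0, 0; 1, 0] !![r, 0; 0, r⁻¹]
    (pow_eq_zero_of_le hp (by
      rw [pow_two, Matrix.mul_fin_two]
      ext i j
      fin_cases i <;> fin_cases j <;> simp))
    (pow_eq_zero_of_le hp (by
      rw [pow_two, Matrix.mul_fin_two]
      ext i j
      fin_cases i <;> fin_cases j <;> simp))
    (by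
      have h1 : r ^ (4 * p) = 1 := by
        rw [show 4 * p = 2 * (2 * p) by ring, pow_mul, hr, hq.pow_eq_one]
      rw [diag_two_pow, inv_pow, h1, inv_one, Matrix.one_fin_two])
    (by
      have h0 := Uq.q_ne_zero hp hq
      have h1 : r ≠ 0 := by rintro rfl; simp at hr; exact h0 hr.symm
      subst hr
      simp
      field_simp)
    (by
      have h0 := Uq.q_ne_zero hp hq
      have h1 : r ≠ 0 := by rintro rfl; simp at hr; exact h0 hr.symm
      subst hr
      simp
      field_simp)
    (by
      have h0 := Uq.q_ne_zero hp hq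
      have h1 := Uq.q_sub_inv_ne_zero hp hq
      have h2 : r ^ (4 * p - 2) = q⁻¹ := by
        rw [show 4 * p - 2 = 2 * (2 * p - 1) by omega, pow_mul, hr]
        apply mul_left_cancel₀ h0
        rw [← pow_succ', Nat.sub_add_cancel (by omega), hq.pow_eq_one, mul_inv_cancel₀ h0]
      have h3 : (q - q⁻¹)⁻¹ * (q⁻¹ - q) = -1 := by
        rw [← neg_sub q, mul_neg, inv_mul_cancel₀ h1]
      rw [diag_two_pow, diag_two_pow, inv_pow, inv_pow, h2, hr, inv_inv]
      ext i j
      fin_cases i <;> fin_cases j <;> simp [h1, h3])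

/-- The reflection equation `R₁₂ M₁ R₂₁ M₂ = M₂ R₁₂ M₁ R₂₁` for a `2 × 2` matrix `M` over an
algebra, where `R` is evaluated on the lifting of `X⁺(2)` in both factors. -/
def ReflectionEquation {p : ℕ} {q : ℂ} (hp : 2 ≤ p) (hq : IsPrimitiveRoot q (2 * p)) (r : ℂ)
    (hr : r ^ 2 = q) {A : Type} [Ring A] [Algebra ℂ A] (M : Matrix (Fin 2) (Fin 2) A) : Prop :=
  let R12 := scalarMat A (evalTensor (X2lift hp hq r hr) (X2lift hp hq r hr) (RMatrix p q r))
  let R21 := scalarMat A (evalTensor (X2lift hp hq r hr) (X2lift hp hq r hr) (RMatrix' p q r))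
  R12 * leg1 M * R21 * leg2 M = leg2 M * R12 * leg1 M * R21

/-- The exchange relations between the coefficients `a, b, c, d`. -/
structure ExchangeRelations (q : ℂ) {A : Type} [Ring A] [Algebra ℂ A] (a b c d : A) : Prop where
  d_a : d * a = a * d
  d_b : d * b = q ^ 2 • (b * d)
  d_c : d * c = (q⁻¹) ^ 2 • (c * d)
  b_a : b * a = a * b + (q⁻¹ * (q - q⁻¹)) • (b * d)
  c_b : c * b = b * c + (q⁻¹ * (q - q⁻¹)) • (d * a - d ^ 2)
  c_a : c * a = a * c - (q⁻¹ * (q - q⁻¹)) • (d * c)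

/-- The four generators of the presentation. -/
inductive PresGen
  | a | b | c | d

/-- The generators of the presentation, in the free algebra. -/
abbrev PresGen.x (g : PresGen) : FreeAlgebra ℂ PresGen := FreeAlgebra.ι ℂ g

open PresGen in
/-- The relations of the presentation. -/
inductive PresRel (p : ℕ) (q : ℂ) : FreeAlgebra ℂ PresGen → FreeAlgebra ℂ PresGen → Prop
  | d_a : PresRel p q (d.x * a.x) (a.x * d.x)
  | d_b : PresRel p q (d.x * b.x) (q ^ 2 • (b.x * d.x))
  | d_c : PresRel p q (d.x * c.x) ((q⁻¹) ^ 2 • (c.x * d.x))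
  | b_a : PresRel p q (b.x * a.x) (a.x * b.x + (q⁻¹ * (q - q⁻¹)) • (b.x * d.x))
  | c_b : PresRel p q (c.x * b.x)
      (b.x * c.x + (q⁻¹ * (q - q⁻¹)) • (d.x * a.x - d.x ^ 2))
  | c_a : PresRel p q (c.x * a.x) (a.x * c.x - (q⁻¹ * (q - q⁻¹)) • (d.x * c.x))
  | det : PresRel p q (a.x * d.x - q ^ 2 • (b.x * c.x)) 1
  | b_pow : PresRel p q (b.x ^ p) 0
  | c_pow : PresRel p q (c.x ^ p) 0
  | d_pow : PresRel p q (d.x ^ (2 * p)) 1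

/-- The algebra defined by the presentation. -/
def PresAlg (p : ℕ) (q : ℂ) : Type := RingQuot (PresRel p q)

instance (p : ℕ) (q : ℂ) : Ring (PresAlg p q) := inferInstanceAs (Ring (RingQuot (PresRel p q)))
instance (p : ℕ) (q : ℂ) : Algebra ℂ (PresAlg p q) :=
  inferInstanceAs (Algebra ℂ (RingQuot (PresRel p q)))

/-- The class of a generator in the algebra defined by the presentation. -/
def PresAlg.gen (p : ℕ) (q : ℂ) (g : PresGen) : PresAlg p q :=
  RingQuot.mkAlgHom ℂ (PresRel p q) g.x

end LoopAlgebra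

end

/-! The proof squeezes the dimension of the loop algebra between two bounds, both equal to `2p³`,
the number of ordered monomials `bⁱcʲdᵏ`.

Upper bound: the image of the dual of `Ū_q` is already the whole loop algebra (`coeffRange_eq_top`).
The fusion relation, multiplied on the right by `R'`, says that certain combinations of the products
`M_{is} N_{tl}` are coefficients of `I ⊗ J`. For fixed `i` and `l` this is a linear system in the
products, and its matrix is the partial transpose of `R'`. This matrix is invertible
(`isUnit_partialTranspose`), so each product of coefficients is a combination of coefficients. Every
functional on `Ū_q` is reached in this way: `1` is a sum of idempotents `e` homogeneous for `K`
whose left ideals are principal indecomposable and extend to `Ū_q^{1/2}`, and `φ` is the sum of the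
functionals `x ↦ φ(x e)`, which are combinations of coefficients of these ideals
(`span_liftableCoeffs`). Hence the dimension is at most that of `Ū_q`, which is at most `2p³` by
normal ordering.

Lower bound: the map `φ ↦ (φ ⊗ id)(R R')` respects the defining relations. The fusion relation
becomes an identity between products of `R`-matrices that follows from `(Δ ⊗ id)(R) = R₁₃R₂₃`, `(id
⊗ Δ)(R) = R₁₃R₁₂` and the Yang-Baxter equation (`fusion_identity`). The resulting morphism
`toUqHalf` sends `b`, `c`, `d` to nonzero multiples of `F`, `K⁻¹E`, `K⁻¹`, and the ordered monomials
in these are linearly independent (`linearIndependent_monomials`), as their action on modules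
induced from characters of the Cartan part shows.

So the monomials form a basis and `toUqHalf` is injective. The relations of the presentation can
then be verified in `Ū_q^{1/2}` and pulled back. The abstractly presented algebra is spanned by the
same monomials (`LoopRelations.mem_span`), which go to a basis, so it is isomorphic to the loop
algebra. That the reflection equation is the same as the exchange relations is a separate comparison
of entries of `4 × 4` matrices. -/

noncomputable section

namespace LoopAlgebra

/-! ### Roots of unity -/

section Roots

variable {p : ℕ} {q r : ℂ}

/-- From `r ^ l = 1` follows `q ^ l = 1`, hence `2p ∣ l`. Below `4p` this leaves only `l = 2p`,
which is excluded because `r ^ (2p) = q ^ p ≠ 1`. -/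
theorem isPrimitiveRoot_sqrt (hp : 2 ≤ p) (hq : IsPrimitiveRoot q (2 * p)) (hr : r ^ 2 = q) :
    IsPrimitiveRoot r (4 * p) := by
  have h1 : r ^ (4 * p) = 1 := by
    rw [show 4 * p = 2 * (2 * p) by ring, pow_mul, hr, hq.pow_eq_one]
  refine IsPrimitiveRoot.mk_of_lt r (by omega) h1 fun l hl hl' h => ?_
  have h2 : q ^ l = 1 := by rw [← hr, ← pow_mul, mul_comm, pow_mul, h, one_pow]
  obtain ⟨m, rfl⟩ := hq.dvd_of_pow_eq_one l h2
  have hm : m = 1 := by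
    have : 0 < m := Nat.pos_of_ne_zero (by rintro rfl; omega)
    have : m < 2 := by by_contra hm; nlinarith
    omega
  subst hm
  rw [mul_one, pow_mul, hr] at h
  exact hq.pow_ne_one_of_pos_of_lt (by omega) (by omega) h

theorem geom_sum_primitiveRoot {ζ : ℂ} {N : ℕ} (hζ : ζ ^ N = 1) (h1 : ζ ≠ 1) :
    ∑ i ∈ Finset.range N, ζ ^ i = 0 := by
  rw [geom_sum_eq h1, hζ, sub_self, zero_div]

theorem qInt_ne_zero (hp : 2 ≤ p) (hq : IsPrimitiveRoot q (2 * p)) {m : ℕ} (h0 : 0 < m)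
    (hm : m < p) : qInt q m ≠ 0 := by
  have hq0 := Uq.q_ne_zero hp hq
  refine div_ne_zero (fun h => ?_) (Uq.q_sub_inv_ne_zero hp hq)
  refine hq.pow_ne_one_of_pos_of_lt (l := 2 * m) (by omega) (by omega) ?_
  rw [sub_eq_zero, inv_pow] at h
  rw [two_mul, pow_add]
  nth_rw 1 [h]
  exact inv_mul_cancel₀ (pow_ne_zero _ hq0)

/-- The coefficients of the universal `R`-matrix. -/
def rCoeff (q : ℂ) (m : ℕ) : ℂ := (q - q⁻¹) ^ m / qFact q m * q ^ (m * (m - 1) / 2)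

theorem rCoeff_zero (q : ℂ) : rCoeff q 0 = 1 := by simp [rCoeff, qFact]

theorem rCoeff_succ_mul (hp : 2 ≤ p) (hq : IsPrimitiveRoot q (2 * p)) {m : ℕ} (hm : m + 1 < p) :
    rCoeff q (m + 1) * qInt q (m + 1) = rCoeff q m * ((q - q⁻¹) * q ^ m) := by
  have h := qInt_ne_zero hp hq (Nat.succ_pos m) hm
  have ht : (m + 1) * (m + 1 - 1) / 2 = m * (m - 1) / 2 + m := by
    have := Nat.triangle_succ m
    simpa using this
  have hf : qFact q (m + 1) = qFact q m * qInt q (m + 1) := Finset.prod_range_succ _ _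
  rw [rCoeff, rCoeff, ht, hf, pow_succ (q - q⁻¹), mul_comm (qFact q m), ← div_div]
  rw [pow_add]
  field_simp

theorem rCoeff_one (hp : 2 ≤ p) (hq : IsPrimitiveRoot q (2 * p)) : rCoeff q 1 = q - q⁻¹ := by
  have h0 := Uq.q_sub_inv_ne_zero hp hq
  simp [rCoeff, qFact, qInt, h0]

/-- Up to the `m`-th power of a constant, the coefficients of the `R`-matrix are the inverses of the
products of `1 - zⁱ` with `z = q⁻²`. The series is thus a `q`-exponential in base `q⁻²`, which fixes
the commutation factor in `qExp_add`. -/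
theorem rCoeff_mul_prod (hp : 2 ≤ p) (hq : IsPrimitiveRoot q (2 * p)) : ∀ m < p,
    rCoeff q m * ∏ i ∈ Finset.range m, (1 - (q⁻¹ ^ 2) ^ (i + 1)) = ((q - q⁻¹) ^ 2 * q⁻¹) ^ m := by
  intro m
  induction m with
  | zero => simp [rCoeff_zero]
  | succ m ih =>
    intro hm
    have hq0 := Uq.q_ne_zero hp hq
    have h1 := rCoeff_succ_mul hp hq hm
    have h2 : (q - q⁻¹) * qInt q (m + 1) = q ^ (m + 1) * (1 - (q⁻¹ ^ 2) ^ (m + 1)) := by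
      rw [qInt, mul_div_cancel₀ _ (Uq.q_sub_inv_ne_zero hp hq), ← pow_mul, mul_comm 2, pow_mul,
        inv_pow]
      have : q ^ (m + 1) ≠ 0 := pow_ne_zero _ hq0
      field_simp
    have h3 : rCoeff q (m + 1) * (1 - (q⁻¹ ^ 2) ^ (m + 1)) =
        rCoeff q m * ((q - q⁻¹) ^ 2 * q⁻¹) := by
      have h4 : q ^ (m + 1) ≠ 0 := pow_ne_zero _ hq0
      apply mul_left_cancel₀ h4
      have h5 : q ^ (m + 1) * q⁻¹ = q ^ m := by rw [pow_succ, mul_assoc, mul_inv_cancel₀ hq0, mul_one]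
      linear_combination (q - q⁻¹) * h1 - rCoeff q (m + 1) * h2 -
        rCoeff q m * (q - q⁻¹) ^ 2 * h5
    rw [Finset.prod_range_succ, pow_succ ((q - q⁻¹) ^ 2 * q⁻¹), ← ih (by omega)]
    linear_combination (∏ i ∈ Finset.range m, (1 - (q⁻¹ ^ 2) ^ (i + 1))) * h3

theorem prod_one_sub_ne_zero {z : ℂ} (hz : IsPrimitiveRoot z p) {m : ℕ} (hm : m < p) :
    ∏ i ∈ Finset.range m, (1 - z ^ (i + 1)) ≠ 0 := by
  refine Finset.prod_ne_zero_iff.mpr fun i hi => ?_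
  have hi' : i < m := Finset.mem_range.mp hi
  exact sub_ne_zero.mpr (hz.pow_ne_one_of_pos_of_lt (by omega) (by omega)).symm

/-- Both sides are quotients of the products of `rCoeff_mul_prod`. The bound `k + j < p` keeps the
denominators nonzero, since `q⁻²` has order `p`. -/
theorem rCoeff_mul_gaussBinom (hp : 2 ≤ p) (hq : IsPrimitiveRoot q (2 * p)) {k j : ℕ}
    (h : k + j < p) :
    rCoeff q (k + j) * gaussBinom (q⁻¹ ^ 2) (k + j) k = rCoeff q k * rCoeff q j := by
  have hz : IsPrimitiveRoot (q⁻¹ ^ 2) p := by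
    rw [inv_pow]; exact (Uq.q_sq_primitive hp hq).inv
  have hk := prod_one_sub_ne_zero hz (show k < p by omega)
  have hj := prod_one_sub_ne_zero hz (show j < p by omega)
  apply mul_right_cancel₀ (mul_ne_zero hk hj)
  rw [mul_assoc, gaussBinom_mul _ _ _ _ rfl, rCoeff_mul_prod hp hq _ h, pow_add,
    ← rCoeff_mul_prod hp hq k (by omega), ← rCoeff_mul_prod hp hq j (by omega)]
  ring

end Roots

/-! ### The Cartan part and the `q`-exponential in an arbitrary algebra -/

section Universal

variable {p : ℕ} {q r : ℂ} {A : Type*} [Ring A] [Algebra ℂ A]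

/-- The projector onto the eigenspace of `k` for the eigenvalue `r ^ n`. -/
def weightProj (p : ℕ) (r : ℂ) (k : A) (n : ℕ) : A :=
  (1 / (4 * p : ℂ)) • ∑ j ∈ Finset.range (4 * p), (r⁻¹) ^ (n * j) • k ^ j

theorem mul_weightProj (hp : 2 ≤ p) (hr : IsPrimitiveRoot r (4 * p)) {k : A}
    (hk : k ^ (4 * p) = 1) (n : ℕ) : k * weightProj p r k n = r ^ n • weightProj p r k n := by
  have h0 : r ≠ 0 := hr.ne_zero (by omega)
  rw [weightProj, mul_smul_comm, smul_comm]
  congr 1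
  -- The summand is periodic in `j` with period `4p`, so a shift of the index does not change the
  -- sum.
  have h1 : ∑ j ∈ Finset.range (4 * p), (r⁻¹) ^ (n * (j + 1)) • k ^ (j + 1) =
      ∑ j ∈ Finset.range (4 * p), (r⁻¹) ^ (n * j) • k ^ j := by
    have h2 := Finset.sum_range_succ (fun j => (r⁻¹) ^ (n * j) • k ^ j) (4 * p)
    rw [Finset.sum_range_succ' (fun j => (r⁻¹) ^ (n * j) • k ^ j)] at h2
    have h3 : (r⁻¹) ^ (n * (4 * p)) = 1 := by
      rw [mul_comm, pow_mul, inv_pow, hr.pow_eq_one, inv_one, one_pow]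
    simpa [h3, hk] using h2
  conv_rhs => rw [← h1]
  rw [Finset.mul_sum, Finset.smul_sum]
  refine Finset.sum_congr rfl fun j _ => ?_
  rw [mul_smul_comm, smul_smul, ← pow_succ', mul_add, mul_one, pow_add r⁻¹, mul_left_comm,
    ← mul_pow, mul_inv_cancel₀ h0, one_pow, mul_one]

theorem pow_mul_weightProj (hp : 2 ≤ p) (hr : IsPrimitiveRoot r (4 * p)) {k : A}
    (hk : k ^ (4 * p) = 1) (n j : ℕ) :
    k ^ j * weightProj p r k n = r ^ (n * j) • weightProj p r k n := by
  induction j with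
  | zero => simp
  | succ j ih =>
    rw [pow_succ', mul_assoc, ih, mul_smul_comm, mul_weightProj hp hr hk, smul_smul, ← pow_add]
    rfl

/-- No condition on `k` is needed: after exchanging the sums, the coefficient of `k ^ j` is a sum of
powers of the root of unity `r⁻ʲ`, which vanishes unless `j = 0`. -/
theorem sum_weightProj (hp : 2 ≤ p) (hr : IsPrimitiveRoot r (4 * p)) (k : A) :
    ∑ n ∈ Finset.range (4 * p), weightProj p r k n = 1 := by
  have hp0 : (4 * p : ℂ) ≠ 0 := by
    have : (p : ℂ) ≠ 0 := by exact_mod_cast (by omega : p ≠ 0)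
    simpa using this
  simp only [weightProj]
  rw [← Finset.smul_sum, Finset.sum_comm, Finset.sum_eq_single 0]
  · simp only [mul_zero, pow_zero, one_smul, Finset.sum_const, Finset.card_range]
    rw [← Nat.cast_smul_eq_nsmul ℂ, smul_smul]
    push_cast
    rw [one_div, inv_mul_cancel₀ hp0, one_smul]
  · intro j hj hj0
    have hj' : j < 4 * p := Finset.mem_range.mp hj
    rw [← Finset.sum_smul]
    have h1 : r⁻¹ ^ j ≠ 1 := hr.inv.pow_ne_one_of_pos_of_lt hj0 hj'
    have h2 : (r⁻¹ ^ j) ^ (4 * p) = 1 := by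
      rw [← pow_mul, mul_comm, pow_mul, hr.inv.pow_eq_one, one_pow]
    have h3 := geom_sum_primitiveRoot h2 h1
    simp only [← pow_mul, mul_comm j] at h3
    rw [h3, zero_smul]
  · intro h
    exact absurd (Finset.mem_range.mpr (by omega)) h

theorem weightProj_mul (hp : 2 ≤ p) (hr : IsPrimitiveRoot r (4 * p)) {k : A}
    (hk : k ^ (4 * p) = 1) {n m : ℕ} (hn : n < 4 * p) (hm : m < 4 * p) :
    weightProj p r k n * weightProj p r k m = if n = m then weightProj p r k m else 0 := by
  have h0 : r ≠ 0 := hr.ne_zero (by omega)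
  have hp0 : (4 * p : ℂ) ≠ 0 := by
    have : (p : ℂ) ≠ 0 := by exact_mod_cast (by omega : p ≠ 0)
    simpa using this
  conv_lhs => rw [weightProj]
  rw [smul_mul_assoc, Finset.sum_mul]
  have h1 : ∀ j, (r⁻¹ ^ (n * j) • k ^ j) * weightProj p r k m =
      (r⁻¹ ^ n * r ^ m) ^ j • weightProj p r k m := by
    intro j
    rw [smul_mul_assoc, pow_mul_weightProj hp hr hk, smul_smul, pow_mul, pow_mul, mul_pow]
  simp only [h1]
  rw [← Finset.sum_smul, smul_smul]
  split_ifs with h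
  · subst h
    have h2 : (1 / (4 * p : ℂ)) * (4 * p) = 1 := one_div_mul_cancel hp0
    rw [← mul_pow, inv_mul_cancel₀ h0]
    simpa using congrArg (fun z : ℂ => z • weightProj p r k n) h2
  · rw [geom_sum_primitiveRoot, mul_zero, zero_smul]
    · rw [mul_pow, ← pow_mul, ← pow_mul, mul_comm n, mul_comm m, pow_mul _ (4 * p), pow_mul _ (4 * p),
        hr.inv.pow_eq_one, hr.pow_eq_one]
      simp
    · intro h2
      rw [inv_pow, inv_mul_eq_one₀ (pow_ne_zero _ h0)] at h2
      exact h (hr.pow_inj hn hm h2)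

theorem commute_weightProj {x k : A} (h : Commute x k) (n : ℕ) :
    Commute x (weightProj p r k n) :=
  (Commute.sum_right _ _ _ fun j _ => (h.pow_right j).smul_right _).smul_right _

/-- An identity may be tested on each weight space of `k`, and there `cartan p r k₁ k` is simply `k₁
^ n`. The multiplication and exchange rules of the Cartan part are proved in this way. -/
theorem eq_of_mul_weightProj (hp : 2 ≤ p) (hr : IsPrimitiveRoot r (4 * p)) (k : A) {x y : A}
    (h : ∀ n < 4 * p, x * weightProj p r k n = y * weightProj p r k n) : x = y := by
  rw [← mul_one x, ← mul_one y, ← sum_weightProj hp hr k, Finset.mul_sum, Finset.mul_sum]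
  exact Finset.sum_congr rfl fun n hn => h n (Finset.mem_range.mp hn)

/-- The element `q^{H ⊗ H / 2}` evaluated on the pair `k₁, k₂`. -/
def cartan (p : ℕ) (r : ℂ) (k₁ k₂ : A) : A :=
  ∑ n ∈ Finset.range (4 * p), k₁ ^ n * weightProj p r k₂ n

theorem cartan_eq_sum (k₁ k₂ : A) : cartan p r k₁ k₂ =
    (1 / (4 * p : ℂ)) • ∑ n ∈ Finset.range (4 * p), ∑ j ∈ Finset.range (4 * p),
      (r⁻¹) ^ (n * j) • (k₁ ^ n * k₂ ^ j) := by
  simp only [cartan, weightProj, mul_smul_comm, Finset.mul_sum, Finset.smul_sum]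

theorem cartan_comm {k₁ k₂ : A} (h : Commute k₁ k₂) : cartan p r k₁ k₂ = cartan p r k₂ k₁ := by
  rw [cartan_eq_sum, cartan_eq_sum, Finset.sum_comm]
  simp only [mul_comm, (h.pow_pow _ _).eq]

theorem cartan_mul_weightProj (hp : 2 ≤ p) (hr : IsPrimitiveRoot r (4 * p)) (k₁ : A) {k₂ : A}
    (hk : k₂ ^ (4 * p) = 1) {n : ℕ} (hn : n < 4 * p) :
    cartan p r k₁ k₂ * weightProj p r k₂ n = k₁ ^ n * weightProj p r k₂ n := by
  rw [cartan, Finset.sum_mul, Finset.sum_eq_single n]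
  · rw [mul_assoc, weightProj_mul hp hr hk hn hn, if_pos rfl]
  · intro m hm hmn
    rw [mul_assoc, weightProj_mul hp hr hk (Finset.mem_range.mp hm) hn, if_neg hmn, mul_zero]
  · intro h
    exact absurd (Finset.mem_range.mpr hn) h

theorem cartan_mul_left (hp : 2 ≤ p) (hr : IsPrimitiveRoot r (4 * p)) {k₁ k₂ k₃ : A}
    (hk : k₃ ^ (4 * p) = 1) (h12 : Commute k₁ k₂) (h23 : Commute k₂ k₃) :
    cartan p r (k₁ * k₂) k₃ = cartan p r k₁ k₃ * cartan p r k₂ k₃ := by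
  refine eq_of_mul_weightProj hp hr k₃ fun n hn => ?_
  have h := ((commute_weightProj (p := p) (r := r) h23 n).pow_left n).eq
  rw [mul_assoc, cartan_mul_weightProj hp hr _ hk hn, cartan_mul_weightProj hp hr _ hk hn, h,
    ← mul_assoc, cartan_mul_weightProj hp hr _ hk hn, mul_assoc, ← h, h12.mul_pow, mul_assoc]

theorem commute_cartan {x k₁ k₂ : A} (h1 : Commute x k₁) (h2 : Commute x k₂) :
    Commute x (cartan p r k₁ k₂) :=
  Commute.sum_right _ _ _ fun n _ => (h1.pow_right n).mul_right (commute_weightProj h2 n)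

theorem isUnit_cartan (hp : 2 ≤ p) (hr : IsPrimitiveRoot r (4 * p)) {k₁ k₂ : A}
    (h12 : Commute k₁ k₂) (h1 : k₁ ^ (4 * p) = 1) (h2 : k₂ ^ (4 * p) = 1) :
    IsUnit (cartan p r k₁ k₂) := by
  have h3 : k₁ * k₁ ^ (4 * p - 1) = 1 := by
    rw [← pow_succ', Nat.sub_add_cancel (by omega), h1]
  have h4 : k₁ ^ (4 * p - 1) * k₁ = 1 := by rw [← pow_succ, Nat.sub_add_cancel (by omega), h1]
  have h5 : cartan p r 1 k₂ = 1 := by simp [cartan, sum_weightProj hp hr]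
  refine isUnit_iff_exists.mpr ⟨cartan p r (k₁ ^ (4 * p - 1)) k₂, ?_, ?_⟩
  · rw [← cartan_mul_left hp hr h2 ((Commute.refl k₁).pow_right _) (h12.pow_left _), h3, h5]
  · rw [← cartan_mul_left hp hr h2 ((Commute.refl k₁).pow_left _) h12, h4, h5]

/-! ### Exchange rules for weight vectors and the truncated `q`-exponential -/

theorem pow_mul_skew {x k : A} {z : ℂ} (h : k * x = z • (x * k)) (n : ℕ) :
    k ^ n * x = z ^ n • (x * k ^ n) := by
  induction n with
  | zero => simp
  | succ n ih =>
    rw [pow_succ, mul_assoc, h, mul_smul_comm, ← mul_assoc, ih, smul_mul_assoc, smul_smul,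
      mul_assoc, ← pow_succ']

theorem mul_pow_skew {x k : A} {z : ℂ} (h : k * x = z • (x * k)) (n : ℕ) :
    k * x ^ n = z ^ n • (x ^ n * k) := by
  induction n with
  | zero => simp
  | succ n ih =>
    rw [pow_succ x, ← mul_assoc, ih, smul_mul_assoc, mul_assoc, h, mul_smul_comm, smul_smul,
      ← mul_assoc, ← pow_succ z]

/-- An element of weight `1` for `k₁` moved across the Cartan part. -/
theorem cartan_mul_raise (hp : 2 ≤ p) (hr : IsPrimitiveRoot r (4 * p)) (hrq : r ^ 2 = q)
    {k₁ k₂ x : A} (hk : k₂ ^ (4 * p) = 1) (h1 : k₁ * x = q • (x * k₁)) (h2 : Commute x k₂) :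
    cartan p r k₁ k₂ * x = x * cartan p r k₁ k₂ * k₂ ^ 2 := by
  -- On the weight space `n` of `k₂` the Cartan part is `k₁ ^ n`. Moving it past `x` produces `q ^ n
  -- = r ^ (2n)`, which is the eigenvalue of `k₂ ^ 2` there.
  refine eq_of_mul_weightProj hp hr k₂ fun n hn => ?_
  have h := (commute_weightProj (p := p) (r := r) h2 n).eq
  rw [mul_assoc, h, ← mul_assoc, cartan_mul_weightProj hp hr _ hk hn, mul_assoc, ← h, ← mul_assoc,
    pow_mul_skew h1, mul_assoc, pow_mul_weightProj hp hr hk, mul_smul_comm, mul_assoc x,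
    cartan_mul_weightProj hp hr _ hk hn, smul_mul_assoc, mul_assoc, ← hrq, ← pow_mul, mul_comm 2]

/-- An element of weight `-1` for `k₁` moved across the Cartan part. -/
theorem mul_cartan_lower (hp : 2 ≤ p) (hr : IsPrimitiveRoot r (4 * p)) (hrq : r ^ 2 = q)
    {k₁ k₂ x : A} (hk : k₂ ^ (4 * p) = 1) (h1 : k₁ * x = q⁻¹ • (x * k₁)) (h2 : Commute x k₂) :
    x * cartan p r k₁ k₂ = cartan p r k₁ k₂ * x * k₂ ^ 2 := by
  have h0 : r ≠ 0 := hr.ne_zero (by omega)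
  refine eq_of_mul_weightProj hp hr k₂ fun n hn => ?_
  have h := (commute_weightProj (p := p) (r := r) h2 n).eq
  rw [mul_assoc, cartan_mul_weightProj hp hr _ hk hn, mul_assoc, pow_mul_weightProj hp hr hk,
    mul_smul_comm, mul_assoc _ x, h, ← mul_assoc (cartan p r k₁ k₂), cartan_mul_weightProj hp hr _ hk hn,
    mul_assoc _ _ x, ← h, ← mul_assoc _ x, pow_mul_skew h1, smul_mul_assoc, smul_smul, ← hrq, mul_comm n,
    pow_mul, ← mul_pow, mul_inv_cancel₀ (pow_ne_zero _ h0), one_pow, one_smul, mul_assoc]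

/-- The truncated `q`-exponential of the universal `R`-matrix. -/
def qExp (p : ℕ) (q : ℂ) (x : A) : A := ∑ m ∈ Finset.range p, rCoeff q m • x ^ m

theorem semiconj_qExp {x y c : A} (h : x * c = c * y) : qExp p q x * c = c * qExp p q y := by
  rw [qExp, qExp, Finset.sum_mul, Finset.mul_sum]
  refine Finset.sum_congr rfl fun m _ => ?_
  have : SemiconjBy c y x := h.symm
  rw [smul_mul_assoc, mul_smul_comm, (this.pow_right m).eq]

theorem commute_qExp {x y : A} (h : Commute x y) : Commute x (qExp p q y) :=
  (semiconj_qExp (p := p) (q := q) h.symm.eq).symm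

/-- The `q`-binomial theorem turns the left side into the terms with `i + j < p` of the product on
the right. The truncated exponentials also produce terms with `i + j ≥ p`, and `h0` removes these.
-/
theorem qExp_add (hp : 2 ≤ p) (hq : IsPrimitiveRoot q (2 * p)) {x y : A}
    (h : y * x = q⁻¹ ^ 2 • (x * y)) (h0 : ∀ i j, p ≤ i + j → x ^ i * y ^ j = 0) :
    qExp p q (x + y) = qExp p q x * qExp p q y := by
  have h1 : ∀ m ∈ Finset.range p, rCoeff q m • (x + y) ^ m = ∑ k ∈ Finset.range (m + 1),
      (fun i j => (rCoeff q i * rCoeff q j) • (x ^ i * y ^ j)) k (m - k) := by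
    intro m hm
    have hm' : m < p := Finset.mem_range.mp hm
    rw [gaussBinom_expand _ x y h, Finset.smul_sum]
    refine Finset.sum_congr rfl fun k hk => ?_
    have hk' : k < m + 1 := Finset.mem_range.mp hk
    obtain ⟨j, rfl⟩ : ∃ j, m = k + j := ⟨m - k, by omega⟩
    simp only [Nat.add_sub_cancel_left]
    rw [smul_smul, rCoeff_mul_gaussBinom hp hq hm']
  rw [qExp, Finset.sum_congr rfl h1, Finset.sum_range_diag_flip p fun i j =>
    (rCoeff q i * rCoeff q j) • (x ^ i * y ^ j), qExp, qExp,
    Finset.sum_mul_sum]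
  refine Finset.sum_congr rfl fun i _ => ?_
  have hsub : Finset.range (p - i) ⊆ Finset.range p := Finset.range_mono (Nat.sub_le p i)
  rw [Finset.sum_subset hsub]
  · refine Finset.sum_congr rfl fun j _ => ?_
    rw [smul_mul_smul_comm]
  · intro j _ hj
    have hj' : p - i ≤ j := by simpa using hj
    rw [h0 i j (by omega), smul_zero]

/-- The sum is `1` plus a multiple of the nilpotent `x` by an element commuting with it. -/
theorem isUnit_sum_smul_pow {x : A} (h : x ^ p = 0)
    (hp : 2 ≤ p) {t : ℕ → ℂ} (ht : t 0 = 1) : IsUnit (∑ m ∈ Finset.range p, t m • x ^ m) := by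
  obtain ⟨n, rfl⟩ : ∃ n, p = n + 1 := ⟨p - 1, by omega⟩
  have h1 : ∑ m ∈ Finset.range (n + 1), t m • x ^ m =
      (∑ m ∈ Finset.range n, t (m + 1) • x ^ m) * x + 1 := by
    rw [Finset.sum_range_succ', ht, pow_zero, one_smul, Finset.sum_mul]
    congr 1
    refine Finset.sum_congr rfl fun m _ => ?_
    rw [pow_succ, smul_mul_assoc]
  rw [h1]
  refine IsNilpotent.isUnit_add_one (Commute.isNilpotent_mul_left ?_ ⟨n + 1, h⟩)
  exact Commute.sum_left _ _ _ fun m _ => ((Commute.refl x).pow_left m).smul_left _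

theorem isUnit_qExp {x : A} (h : x ^ p = 0) (hp : 2 ≤ p) : IsUnit (qExp p q x) :=
  isUnit_sum_smul_pow h hp (rCoeff_zero q)

end Universal

end LoopAlgebra

end

noncomputable section

namespace LoopAlgebra

/-! ### Quasitriangularity -/

/-- Elements of an algebra that satisfy the relations of the extended quantum group. -/
structure HalfTriple (p : ℕ) (q : ℂ) {A : Type*} [Ring A] [Algebra ℂ A] (E F k : A) : Prop where
  E_pow : E ^ p = 0
  F_pow : F ^ p = 0
  k_pow : k ^ (4 * p) = 1
  k_E : k * E = q • (E * k)
  k_F : k * F = q⁻¹ • (F * k)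
  E_F : E * F = F * E + (q - q⁻¹)⁻¹ • (k ^ 2 - k ^ (4 * p - 2))

/-- Two triples of elements whose members commute pairwise. -/
structure CommTriples {A : Type*} [Ring A] (E₁ F₁ k₁ E₂ F₂ k₂ : A) : Prop where
  E_E : Commute E₁ E₂
  E_F : Commute E₁ F₂
  E_k : Commute E₁ k₂
  F_E : Commute F₁ E₂
  F_F : Commute F₁ F₂
  F_k : Commute F₁ k₂
  k_E : Commute k₁ E₂
  k_F : Commute k₁ F₂
  k_k : Commute k₁ k₂

theorem CommTriples.symm {A : Type*} [Ring A] {E₁ F₁ k₁ E₂ F₂ k₂ : A}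
    (h : CommTriples E₁ F₁ k₁ E₂ F₂ k₂) : CommTriples E₂ F₂ k₂ E₁ F₁ k₁ :=
  ⟨h.E_E.symm, h.F_E.symm, h.k_E.symm, h.E_F.symm, h.F_F.symm, h.k_F.symm, h.E_k.symm, h.F_k.symm,
    h.k_k.symm⟩

/-- The universal `R`-matrix with its first tensor factor evaluated at `E₁, k₁` and its second one
at `F₂, k₂`. -/
def rElt (p : ℕ) (q r : ℂ) {A : Type*} [Ring A] [Algebra ℂ A] (E₁ k₁ F₂ k₂ : A) : A :=
  cartan p r k₁ k₂ * qExp p q (E₁ * F₂)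

section

variable {p : ℕ} {q r : ℂ} {A : Type*} [Ring A] [Algebra ℂ A]
  {E₁ F₁ k₁ E₂ F₂ k₂ E₃ F₃ k₃ : A}

theorem isUnit_rElt (hp : 2 ≤ p) (hr : IsPrimitiveRoot r (4 * p)) (h1 : HalfTriple p q E₁ F₁ k₁)
    (h2 : HalfTriple p q E₂ F₂ k₂) (h : CommTriples E₁ F₁ k₁ E₂ F₂ k₂) :
    IsUnit (rElt p q r E₁ k₁ F₂ k₂) :=
  (isUnit_cartan hp hr h.k_k h1.k_pow h2.k_pow).mul
    (isUnit_qExp (by rw [h.E_F.mul_pow, h1.E_pow, zero_mul]) hp)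

theorem HalfTriple.K_F (h : HalfTriple p q E₁ F₁ k₁) : k₁ ^ 2 * F₁ = q⁻¹ ^ 2 • (F₁ * k₁ ^ 2) :=
  pow_mul_skew h.k_F 2

theorem HalfTriple.K_E (h : HalfTriple p q E₁ F₁ k₁) : k₁ ^ 2 * E₁ = q ^ 2 • (E₁ * k₁ ^ 2) :=
  pow_mul_skew h.k_E 2

theorem HalfTriple.K_Kinv (hp : 2 ≤ p) (h : HalfTriple p q E₁ F₁ k₁) :
    k₁ ^ 2 * k₁ ^ (4 * p - 2) = 1 := by
  rw [← pow_add, show 2 + (4 * p - 2) = 4 * p by omega, h.k_pow]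

theorem HalfTriple.Kinv_K (hp : 2 ≤ p) (h : HalfTriple p q E₁ F₁ k₁) :
    k₁ ^ (4 * p - 2) * k₁ ^ 2 = 1 := by
  rw [← pow_add, show (4 * p - 2) + 2 = 4 * p by omega, h.k_pow]

theorem skew_inv {K L x : A} {z : ℂ} (hz : z ≠ 0) (hKL : K * L = 1) (hLK : L * K = 1)
    (h : K * x = z • (x * K)) : L * x = z⁻¹ • (x * L) := by
  have h1 : x * K = z⁻¹ • (K * x) := by rw [h, smul_smul, inv_mul_cancel₀ hz, one_smul]
  calc L * x = L * (x * K) * L := by rw [mul_assoc, mul_assoc, hKL, mul_one]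
    _ = _ := by rw [h1, mul_smul_comm, smul_mul_assoc, ← mul_assoc, hLK, one_mul]

theorem HalfTriple.Kinv_F (hp : 2 ≤ p) (hq : IsPrimitiveRoot q (2 * p))
    (h : HalfTriple p q E₁ F₁ k₁) :
    k₁ ^ (4 * p - 2) * F₁ = q ^ 2 • (F₁ * k₁ ^ (4 * p - 2)) := by
  have := skew_inv (pow_ne_zero 2 (inv_ne_zero (Uq.q_ne_zero hp hq))) (h.K_Kinv hp) (h.Kinv_K hp)
    h.K_F
  rwa [inv_pow, inv_inv] at this

theorem HalfTriple.Kinv_E (hp : 2 ≤ p) (hq : IsPrimitiveRoot q (2 * p))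
    (h : HalfTriple p q E₁ F₁ k₁) :
    k₁ ^ (4 * p - 2) * E₁ = q⁻¹ ^ 2 • (E₁ * k₁ ^ (4 * p - 2)) := by
  have := skew_inv (pow_ne_zero 2 (Uq.q_ne_zero hp hq)) (h.K_Kinv hp) (h.Kinv_K hp) h.K_E
  rwa [← inv_pow] at this

/-- `(Δ ⊗ id)(R) = R₁₃ R₂₃`. -/
theorem rElt_comul_left (hp : 2 ≤ p) (hq : IsPrimitiveRoot q (2 * p)) (hr : r ^ 2 = q)
    (h2 : HalfTriple p q E₂ F₂ k₂) (h3 : HalfTriple p q E₃ F₃ k₃)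
    (h12 : CommTriples E₁ F₁ k₁ E₂ F₂ k₂) (h13 : CommTriples E₁ F₁ k₁ E₃ F₃ k₃)
    (h23 : CommTriples E₂ F₂ k₂ E₃ F₃ k₃) :
    rElt p q r (E₂ + E₁ * k₂ ^ 2) (k₁ * k₂) F₃ k₃ =
      rElt p q r E₁ k₁ F₃ k₃ * rElt p q r E₂ k₂ F₃ k₃ := by
  have hr' := isPrimitiveRoot_sqrt hp hq hr
  have e1 : E₁ * F₃ * cartan p r k₂ k₃ = cartan p r k₂ k₃ * (E₁ * F₃ * k₂ ^ 2) := by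
    rw [mul_assoc, cartan_comm h23.k_k, mul_cartan_lower hp hr' hr h2.k_pow h3.k_F h23.k_F.symm,
      ← mul_assoc, ← mul_assoc, (commute_cartan h13.E_k h12.E_k).eq, mul_assoc, mul_assoc,
      mul_assoc]
  -- The order of the summands matters: with `E₁ * F₃ * k₂ ^ 2` first, the commutation factor is the
  -- `q⁻²` that `qExp_add` requires. Terms of total degree at least `p` vanish because both summands
  -- contain `F₃`.
  have e2 : (E₂ + E₁ * k₂ ^ 2) * F₃ = E₁ * F₃ * k₂ ^ 2 + E₂ * F₃ := by
    rw [add_mul, add_comm, mul_assoc, mul_assoc, (h23.k_F.pow_left 2).eq]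
  have c1 : Commute (E₁ * F₃) (k₂ ^ 2) := (h12.E_k.mul_left h23.k_F.symm).pow_right 2
  have c2 : Commute E₂ F₃ := h23.E_F
  have e3 : qExp p q ((E₂ + E₁ * k₂ ^ 2) * F₃) =
      qExp p q (E₁ * F₃ * k₂ ^ 2) * qExp p q (E₂ * F₃) := by
    rw [e2]
    refine qExp_add hp hq ?_ fun i j hij => ?_
    · have hc : Commute (E₂ * F₃) (E₁ * F₃) :=
        (h12.E_E.symm.mul_right h23.E_F).mul_left (h13.E_F.symm.mul_right (Commute.refl _))
      have hk : k₂ ^ 2 * (E₂ * F₃) = q ^ 2 • (E₂ * F₃ * k₂ ^ 2) := by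
        rw [← mul_assoc, h2.K_E, smul_mul_assoc, mul_assoc, (h23.k_F.pow_left 2).eq, mul_assoc]
      rw [← mul_assoc, hc.eq, mul_assoc (E₁ * F₃), mul_assoc (E₁ * F₃) (k₂ ^ 2), hk, mul_smul_comm,
        smul_smul, ← mul_pow, inv_mul_cancel₀ (Uq.q_ne_zero hp hq), one_pow, one_smul]
    · have hF : F₃ ^ i * F₃ ^ j = 0 := by rw [← pow_add, pow_eq_zero_of_le hij h3.F_pow]
      have hk : Commute F₃ (k₂ ^ 2) := h23.k_F.symm.pow_right 2
      rw [c1.mul_pow, h13.E_F.mul_pow, h23.E_F.symm.symm.eq, (h23.E_F.symm).mul_pow,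
        mul_assoc, mul_assoc, ← mul_assoc ((k₂ ^ 2) ^ i), ((hk.pow_pow j i).symm).eq, mul_assoc,
        ← mul_assoc (F₃ ^ i), hF, zero_mul, mul_zero]
  rw [rElt, rElt, rElt, e3, cartan_mul_left hp hr' h3.k_pow h12.k_k h23.k_k]
  have e4 := semiconj_qExp (p := p) (q := q) e1
  calc _ = cartan p r k₁ k₃ * (cartan p r k₂ k₃ * qExp p q (E₁ * F₃ * k₂ ^ 2)) *
        qExp p q (E₂ * F₃) := by simp only [mul_assoc]
    _ = _ := by rw [← e4]; simp only [mul_assoc]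

/-- `(id ⊗ Δ)(R) = R₁₃ R₁₂`, with the first tensor factor moved to the third place. -/
theorem rElt_comul_right (hp : 2 ≤ p) (hq : IsPrimitiveRoot q (2 * p)) (hr : r ^ 2 = q)
    (h1 : HalfTriple p q E₁ F₁ k₁) (h3 : HalfTriple p q E₃ F₃ k₃)
    (h12 : CommTriples E₁ F₁ k₁ E₂ F₂ k₂) (h13 : CommTriples E₁ F₁ k₁ E₃ F₃ k₃)
    (h23 : CommTriples E₂ F₂ k₂ E₃ F₃ k₃) :
    rElt p q r E₃ k₃ (F₁ + k₁ ^ (4 * p - 2) * F₂) (k₁ * k₂) =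
      rElt p q r E₃ k₃ F₂ k₂ * rElt p q r E₃ k₃ F₁ k₁ := by
  have hr' := isPrimitiveRoot_sqrt hp hq hr
  set L := k₁ ^ (4 * p - 2) with hL
  have hKL : k₁ ^ 2 * L = 1 := h1.K_Kinv hp
  have hLK : L * k₁ ^ 2 = 1 := h1.Kinv_K hp
  have cL3 : Commute L E₃ := h13.k_E.pow_left _
  have cL2 : Commute L F₂ := h12.k_F.pow_left _
  have e0 : E₃ * cartan p r k₃ k₁ = cartan p r k₃ k₁ * (E₃ * L) := by
    have := cartan_mul_raise hp hr' hr h1.k_pow h3.k_E h13.k_E.symm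
    rw [← mul_assoc, this, mul_assoc, hKL, mul_one]
  have e1 : E₃ * F₂ * cartan p r k₃ k₁ = cartan p r k₃ k₁ * (E₃ * F₂ * L) := by
    rw [mul_assoc, (commute_cartan h23.F_k h12.k_F.symm).eq, ← mul_assoc, e0, mul_assoc,
      mul_assoc, cL2.eq, mul_assoc]
  -- The summands are exchanged so that they again commute up to `q⁻²`, as `qExp_add` requires. Here
  -- the common factor `E₃` kills the terms of degree at least `p`.
  have e2 : E₃ * (F₁ + L * F₂) = E₃ * F₂ * L + E₃ * F₁ := by
    rw [mul_add, add_comm, cL2.eq, mul_assoc]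
  have c1 : Commute (E₃ * F₂) L := (cL3.mul_right cL2).symm
  have e3 : qExp p q (E₃ * (F₁ + L * F₂)) = qExp p q (E₃ * F₂ * L) * qExp p q (E₃ * F₁) := by
    rw [e2]
    refine qExp_add hp hq ?_ fun i j hij => ?_
    · have hc : Commute (E₃ * F₁) (E₃ * F₂) :=
        ((Commute.refl _).mul_right h23.F_E.symm).mul_left (h13.F_E.mul_right h12.F_F)
      have hk : L * (E₃ * F₁) = q ^ 2 • (E₃ * F₁ * L) := by
        rw [← mul_assoc, cL3.eq, mul_assoc, h1.Kinv_F hp hq, mul_smul_comm, mul_assoc]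
      rw [← mul_assoc, hc.eq, mul_assoc (E₃ * F₂), mul_assoc (E₃ * F₂) L, hk, mul_smul_comm,
        smul_smul, ← mul_pow, inv_mul_cancel₀ (Uq.q_ne_zero hp hq), one_pow, one_smul]
    · have hE : E₃ ^ i * E₃ ^ j = 0 := by rw [← pow_add, pow_eq_zero_of_le hij h3.E_pow]
      have h32 : Commute E₃ F₂ := h23.F_E.symm
      have h31 : Commute E₃ F₁ := h13.F_E.symm
      have h4 : Commute (F₂ ^ i * L ^ i) (E₃ ^ j) :=
        (h32.symm.pow_pow _ _).mul_left (cL3.pow_pow _ _)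
      rw [c1.mul_pow, h32.mul_pow, h31.mul_pow, mul_assoc (E₃ ^ i), mul_assoc (E₃ ^ i), ← mul_assoc (F₂ ^ i * L ^ i), h4.eq,
        mul_assoc, ← mul_assoc (E₃ ^ i), hE, zero_mul]
  have hc : cartan p r k₃ (k₁ * k₂) = cartan p r k₃ k₂ * cartan p r k₃ k₁ := by
    rw [cartan_comm (h13.k_k.symm.mul_right h23.k_k.symm), cartan_comm h13.k_k.symm,
      cartan_comm h23.k_k.symm, h12.k_k.eq,
      cartan_mul_left hp hr' h3.k_pow h12.k_k.symm h13.k_k]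
  rw [rElt, rElt, rElt, e3, hc]
  have e4 := semiconj_qExp (p := p) (q := q) e1
  calc _ = cartan p r k₃ k₂ * (cartan p r k₃ k₁ * qExp p q (E₃ * F₂ * L)) *
        qExp p q (E₃ * F₁) := by simp only [mul_assoc]
    _ = _ := by rw [← e4]; simp only [mul_assoc]

/-- The recursions for the coefficients of `K` and `K⁻¹` in the commutator of `E` with `Fᵐ`, and
likewise in that of `Eᵐ` with `F`. -/
theorem qInt_succ_identities {q : ℂ} (hq0 : q ≠ 0) (h0 : q - q⁻¹ ≠ 0) (m : ℕ) :
    (q - q⁻¹)⁻¹ + qInt q (m + 1) / (q - q⁻¹) * (q⁻¹ ^ m * q⁻¹ ^ 2) =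
        qInt q (m + 2) / (q - q⁻¹) * q⁻¹ ^ (m + 1) ∧
      (q - q⁻¹)⁻¹ + qInt q (m + 1) / (q - q⁻¹) * (q ^ m * q ^ 2) =
        qInt q (m + 2) / (q - q⁻¹) * q ^ (m + 1) := by
  have hx : q ^ m ≠ 0 := pow_ne_zero _ hq0
  have h0' : q ^ 2 - 1 ≠ 0 := by
    intro h'
    apply h0
    field_simp
    rw [h', mul_zero]
  constructor
  · rw [qInt, qInt, inv_pow, inv_pow, inv_pow, inv_pow, pow_succ q (m + 1), pow_succ q m]
    generalize q ^ m = x at hx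
    field_simp
    ring
  · rw [qInt, qInt, inv_pow, inv_pow, pow_succ q (m + 1), pow_succ q m]
    generalize q ^ m = x at hx
    field_simp
    ring

/-- The commutator of `E` with a power of `F`. -/
theorem HalfTriple.E_mul_F_pow (hp : 2 ≤ p) (hq : IsPrimitiveRoot q (2 * p))
    (h : HalfTriple p q E₁ F₁ k₁) (m : ℕ) : E₁ * F₁ ^ (m + 1) = F₁ ^ (m + 1) * E₁ +
      (qInt q (m + 1) / (q - q⁻¹)) •
        (F₁ ^ m * (q⁻¹ ^ m • k₁ ^ 2 - q ^ m • k₁ ^ (4 * p - 2))) := by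
  have h0 := Uq.q_sub_inv_ne_zero hp hq
  have hq0 := Uq.q_ne_zero hp hq
  induction m with
  | zero =>
    have : qInt q 1 = 1 := by simp [qInt, h0]
    simp [h.E_F, this]
  | succ m ih =>
    rw [pow_succ F₁ (m + 1), ← mul_assoc, ih, add_mul, mul_assoc _ E₁, h.E_F]
    simp only [smul_mul_assoc, mul_assoc, sub_mul, mul_sub, mul_add, mul_smul_comm, smul_sub,
      h.K_F, h.Kinv_F hp hq, smul_smul]
    simp only [← mul_assoc, ← pow_succ]
    obtain ⟨a1, a2⟩ := qInt_succ_identities hq0 h0 m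
    rw [show m + 1 + 1 = m + 2 from rfl, ← a1, ← a2, add_smul, add_smul]
    simp only [mul_assoc, pow_succ]
    abel

/-- `R Δ(E) = Δᵒᵖ(E) R`. -/
theorem rElt_intertwines_E (hp : 2 ≤ p) (hq : IsPrimitiveRoot q (2 * p)) (hr : r ^ 2 = q)
    (h1 : HalfTriple p q E₁ F₁ k₁) (h2 : HalfTriple p q E₂ F₂ k₂)
    (h12 : CommTriples E₁ F₁ k₁ E₂ F₂ k₂) :
    rElt p q r E₁ k₁ F₂ k₂ * (E₂ + E₁ * k₂ ^ 2) = (E₁ + E₂ * k₁ ^ 2) * rElt p q r E₁ k₁ F₂ k₂ := by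
  have hr' := isPrimitiveRoot_sqrt hp hq hr
  have h0 := Uq.q_sub_inv_ne_zero hp hq
  have hq0 := Uq.q_ne_zero hp hq
  set C := cartan p r k₁ k₂ with hC
  set L := k₂ ^ (4 * p - 2) with hL
  have hKL : k₂ ^ 2 * L = 1 := h2.K_Kinv hp
  have e1 : E₁ * C = C * (E₁ * L) := by
    have := cartan_mul_raise hp hr' hr h2.k_pow h1.k_E h12.E_k
    rw [← mul_assoc, this, mul_assoc, hKL, mul_one]
  have e2 : E₂ * k₁ ^ 2 * C = C * E₂ := by
    have h3 := cartan_mul_raise hp hr' hr h1.k_pow h2.k_E h12.k_E.symm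
    have h4 : Commute (k₁ ^ 2) C :=
      (commute_cartan (Commute.refl _) h12.k_k).pow_left 2
    rw [mul_assoc, h4.eq, hC, cartan_comm h12.k_k, h3, mul_assoc]
  -- Moving `Δᵒᵖ(E)` through the Cartan part by `e1` and `e2` leaves an identity for the exponential
  -- alone. With the terms in `E₁` on one side and those in `E₂` on the other, both differences turn
  -- out to be the same sum.
  have key : qExp p q (E₁ * F₂) * (E₂ + E₁ * k₂ ^ 2) = (E₁ * L + E₂) * qExp p q (E₁ * F₂) := by
    have t0 : ∀ m, (E₁ * F₂) ^ m = E₁ ^ m * F₂ ^ m := h12.E_F.mul_pow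
    obtain ⟨n, hn⟩ : ∃ n, p = n + 1 := ⟨p - 1, by omega⟩
    have l1 : qExp p q (E₁ * F₂) * (E₁ * k₂ ^ 2) - E₁ * L * qExp p q (E₁ * F₂) =
        ∑ m ∈ Finset.range n, rCoeff q m •
          (E₁ ^ (m + 1) * (F₂ ^ m * (k₂ ^ 2 - (q ^ 2) ^ m • L))) := by
      have t1 : ∀ m, rCoeff q m • (E₁ * F₂) ^ m * (E₁ * k₂ ^ 2) -
          E₁ * L * rCoeff q m • (E₁ * F₂) ^ m =
          rCoeff q m • (E₁ ^ (m + 1) * (F₂ ^ m * (k₂ ^ 2 - (q ^ 2) ^ m • L))) := by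
        intro m
        have hL1 : L * E₁ ^ m = E₁ ^ m * L := ((h12.E_k.pow_pow m _).eq).symm
        have hL2 := mul_pow_skew (h2.Kinv_F hp hq) m
        have hF : F₂ ^ m * E₁ = E₁ * F₂ ^ m := (h12.E_F.pow_right m).eq.symm
        rw [t0, smul_mul_assoc, mul_smul_comm, ← smul_sub]
        congr 1
        rw [mul_sub, mul_sub, mul_smul_comm, mul_smul_comm, mul_assoc, ← mul_assoc (F₂ ^ m) E₁, hF,
          mul_assoc E₁ L, ← mul_assoc L, hL1, mul_assoc _ L, hL2, pow_succ E₁, mul_smul_comm,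
          mul_smul_comm]
        congr 1
        · simp only [mul_assoc]
        · rw [← pow_succ, pow_succ' E₁]
          simp only [mul_assoc, hL]
      -- The top term `m = p - 1` contains `E₁ ^ p = 0`, so the sum stops at `n = p - 1` terms, as
      -- in `l2`, where instead the term `m = 0` drops out.
      rw [qExp, Finset.sum_mul, Finset.mul_sum, ← Finset.sum_sub_distrib,
        Finset.sum_congr rfl fun m _ => t1 m, hn, Finset.sum_range_succ, ← hn, h1.E_pow]
      simp
    have l2 : E₂ * qExp p q (E₁ * F₂) - qExp p q (E₁ * F₂) * E₂ =
        ∑ m ∈ Finset.range n, rCoeff q m •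
          (E₁ ^ (m + 1) * (F₂ ^ m * (k₂ ^ 2 - (q ^ 2) ^ m • L))) := by
      rw [qExp, Finset.sum_mul, Finset.mul_sum, ← Finset.sum_sub_distrib, hn,
        Finset.sum_range_succ']
      simp only [pow_zero, mul_smul_comm, smul_mul_assoc, mul_one, one_mul, sub_self, add_zero]
      refine Finset.sum_congr rfl fun m hm => ?_
      have hm' : m + 1 < p := by have := Finset.mem_range.mp hm; omega
      -- The `q`-integer produced by the commutator of `E₂` with `F₂ ^ (m + 1)` is absorbed by the
      -- recursion of the coefficients.
      have hc := rCoeff_succ_mul hp hq hm'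
      have hE : E₂ * E₁ ^ (m + 1) = E₁ ^ (m + 1) * E₂ := (h12.E_E.symm.pow_right _).eq
      rw [t0, ← mul_assoc, hE, mul_assoc, h2.E_mul_F_pow hp hq, mul_add, mul_assoc, smul_add,
        add_sub_cancel_left, mul_smul_comm, smul_smul, ← mul_div_assoc, hc]
      have b1 : rCoeff q m * ((q - q⁻¹) * q ^ m) / (q - q⁻¹) = rCoeff q m * q ^ m := by
        rw [mul_left_comm, mul_div_cancel_left₀ _ h0]
      have b2 : q ^ m • (q⁻¹ ^ m • k₂ ^ 2 - q ^ m • L) = k₂ ^ 2 - (q ^ 2) ^ m • L := by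
        rw [smul_sub, smul_smul, smul_smul, ← mul_pow, ← mul_pow, mul_inv_cancel₀ hq0, one_pow,
          one_smul, pow_two q]
      rw [b1, mul_smul, ← hL, ← b2]
      simp only [mul_smul_comm]
    rw [← l2, sub_eq_sub_iff_add_eq_add] at l1
    rw [mul_add, add_mul, add_comm, l1, add_comm]
  rw [rElt, ← hC, mul_assoc, key, ← mul_assoc, mul_add, ← e1, ← e2, ← add_mul, mul_assoc]

theorem rElt_intertwines_k (hp : 2 ≤ p) (hq : IsPrimitiveRoot q (2 * p))
    (h1 : HalfTriple p q E₁ F₁ k₁) (h2 : HalfTriple p q E₂ F₂ k₂)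
    (h12 : CommTriples E₁ F₁ k₁ E₂ F₂ k₂) :
    Commute (k₁ * k₂) (rElt p q r E₁ k₁ F₂ k₂) := by
  have hq0 := Uq.q_ne_zero hp hq
  refine Commute.mul_right ?_ (commute_qExp ?_)
  · exact (commute_cartan (Commute.refl _) h12.k_k).mul_left
      (commute_cartan h12.k_k.symm (Commute.refl _))
  · have hkF := h2.k_F
    have hkE := h1.k_E
    change k₁ * k₂ * (E₁ * F₂) = E₁ * F₂ * (k₁ * k₂)
    calc k₁ * k₂ * (E₁ * F₂) = (k₁ * E₁) * (k₂ * F₂) := by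
          rw [mul_assoc, ← mul_assoc k₂, h12.E_k.symm.eq]; simp only [mul_assoc]
      _ = (E₁ * k₁) * (F₂ * k₂) := by
          rw [hkE, hkF, smul_mul_smul_comm, mul_inv_cancel₀ hq0, one_smul]
      _ = _ := by rw [mul_assoc, ← mul_assoc k₁, h12.k_F.eq]; simp only [mul_assoc]

/-- The Yang-Baxter equation. -/
theorem rElt_yangBaxter (hp : 2 ≤ p) (hq : IsPrimitiveRoot q (2 * p)) (hr : r ^ 2 = q)
    (h1 : HalfTriple p q E₁ F₁ k₁) (h2 : HalfTriple p q E₂ F₂ k₂) (h3 : HalfTriple p q E₃ F₃ k₃)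
    (h12 : CommTriples E₁ F₁ k₁ E₂ F₂ k₂) (h13 : CommTriples E₁ F₁ k₁ E₃ F₃ k₃)
    (h23 : CommTriples E₂ F₂ k₂ E₃ F₃ k₃) :
    rElt p q r E₁ k₁ F₂ k₂ * (rElt p q r E₁ k₁ F₃ k₃ * rElt p q r E₂ k₂ F₃ k₃) =
      rElt p q r E₂ k₂ F₃ k₃ * rElt p q r E₁ k₁ F₃ k₃ * rElt p q r E₁ k₁ F₂ k₂ := by
  -- In the form `R₁₂ (Δ ⊗ id)(R) = (Δᵒᵖ ⊗ id)(R) R₁₂` the equation only needs that `R₁₂`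
  -- intertwines `Δ` and `Δᵒᵖ` on `E` and `k`, since the first factor of `R` contains no `F`.
  rw [← rElt_comul_left hp hq hr h2 h3 h12 h13 h23,
    ← rElt_comul_left hp hq hr h1 h3 h12.symm h23 h13]
  set R := rElt p q r E₁ k₁ F₂ k₂ with hR
  have hF : Commute R F₃ := by
    refine (commute_cartan h13.k_F.symm h23.k_F.symm).symm.mul_left (commute_qExp ?_).symm
    exact h13.E_F.symm.mul_right h23.F_F.symm
  have hk : Commute R k₃ := by
    refine (commute_cartan h13.k_k.symm h23.k_k.symm).symm.mul_left (commute_qExp ?_).symm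
    exact h13.E_k.symm.mul_right h23.F_k.symm
  have hkk : Commute R (k₂ * k₁) := by
    rw [← h12.k_k.eq]; exact (rElt_intertwines_k hp hq h1 h2 h12).symm
  have hE := rElt_intertwines_E hp hq hr h1 h2 h12
  rw [rElt, rElt, h12.k_k.eq, ← mul_assoc, (commute_cartan hkk hk).eq, mul_assoc, mul_assoc]
  congr 1
  refine (semiconj_qExp ?_).symm
  rw [mul_assoc, ← hF.eq, ← mul_assoc, ← hE, mul_assoc]

/-- The fusion identity for `X = R R'`. -/
theorem fusion_identity (hp : 2 ≤ p) (hq : IsPrimitiveRoot q (2 * p)) (hr : r ^ 2 = q)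
    (h1 : HalfTriple p q E₁ F₁ k₁) (h2 : HalfTriple p q E₂ F₂ k₂) (h3 : HalfTriple p q E₃ F₃ k₃)
    (h12 : CommTriples E₁ F₁ k₁ E₂ F₂ k₂) (h13 : CommTriples E₁ F₁ k₁ E₃ F₃ k₃)
    (h23 : CommTriples E₂ F₂ k₂ E₃ F₃ k₃) :
    rElt p q r (E₂ + E₁ * k₂ ^ 2) (k₁ * k₂) F₃ k₃ *
        rElt p q r E₃ k₃ (F₁ + k₁ ^ (4 * p - 2) * F₂) (k₁ * k₂) * rElt p q r E₂ k₂ F₁ k₁ =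
      rElt p q r E₁ k₁ F₃ k₃ * rElt p q r E₃ k₃ F₁ k₁ * rElt p q r E₂ k₂ F₁ k₁ *
        (rElt p q r E₂ k₂ F₃ k₃ * rElt p q r E₃ k₃ F₂ k₂) := by
  rw [rElt_comul_left hp hq hr h2 h3 h12 h13 h23, rElt_comul_right hp hq hr h1 h3 h12 h13 h23]
  -- The left side is now `R₁₃ R₂₃ R₃₂ R₃₁ R₂₁`. By `y2`, `R₃₂ R₃₁ R₂₁` becomes `R₂₁ R₃₁ R₃₂`; by
  -- `y1`, `R₂₃ R₂₁ R₃₁` becomes `R₃₁ R₂₁ R₂₃`.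
  have y1 := rElt_yangBaxter (r := r) hp hq hr h2 h3 h1 h23 h12.symm h13.symm
  have y2 := rElt_yangBaxter (r := r) hp hq hr h3 h2 h1 h23.symm h13.symm h12.symm
  calc _ = rElt p q r E₁ k₁ F₃ k₃ * (rElt p q r E₂ k₂ F₃ k₃ *
        (rElt p q r E₃ k₃ F₂ k₂ * (rElt p q r E₃ k₃ F₁ k₁ * rElt p q r E₂ k₂ F₁ k₁))) := by
        simp only [mul_assoc]
    _ = rElt p q r E₁ k₁ F₃ k₃ * (rElt p q r E₂ k₂ F₃ k₃ *
        (rElt p q r E₂ k₂ F₁ k₁ * rElt p q r E₃ k₃ F₁ k₁)) * rElt p q r E₃ k₃ F₂ k₂ := by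
        rw [y2]; simp only [mul_assoc]
    _ = _ := by rw [y1]; simp only [mul_assoc]

end

end LoopAlgebra

end

noncomputable section

namespace LoopAlgebra

/-! ### Normally ordered monomials -/

section NormalForm

variable {A : Type*} [Ring A] [Algebra ℂ A] {f e k w : A} {z₁ z₂ α : ℂ}

/-- The span of the normally ordered monomials. -/
def monomialSpan (f e k : A) : Submodule ℂ A :=
  Submodule.span ℂ (Set.range fun x : ℕ × ℕ × ℕ => f ^ x.1 * e ^ x.2.1 * k ^ x.2.2)

theorem monomial_mem (f e k : A) (i j l : ℕ) : f ^ i * e ^ j * k ^ l ∈ monomialSpan f e k :=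
  Submodule.subset_span ⟨(i, j, l), rfl⟩

theorem mul_mem_monomialSpan {s : A}
    (h : ∀ i j l : ℕ, s * (f ^ i * e ^ j * k ^ l) ∈ monomialSpan f e k) {x : A}
    (hx : x ∈ monomialSpan f e k) : s * x ∈ monomialSpan f e k := by
  have : monomialSpan f e k ≤ (monomialSpan f e k).comap (LinearMap.mulLeft ℂ s) := by
    refine Submodule.span_le.mpr ?_
    rintro _ ⟨⟨i, j, l⟩, rfl⟩
    exact h i j l
  exact this hx

theorem f_mul_mem_monomialSpan {x : A} (hx : x ∈ monomialSpan f e k) :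
    f * x ∈ monomialSpan f e k := by
  refine mul_mem_monomialSpan (fun i j l => ?_) hx
  rw [← mul_assoc, ← mul_assoc, ← pow_succ']
  exact monomial_mem f e k (i + 1) j l

theorem k_mul_mem_monomialSpan (hkf : k * f = z₁ • (f * k)) (hke : k * e = z₂ • (e * k)) {x : A}
    (hx : x ∈ monomialSpan f e k) : k * x ∈ monomialSpan f e k := by
  refine mul_mem_monomialSpan (fun i j l => ?_) hx
  rw [← mul_assoc, ← mul_assoc, mul_pow_skew hkf, smul_mul_assoc, smul_mul_assoc, mul_assoc (f ^ i),
    mul_pow_skew hke, mul_smul_comm, smul_mul_assoc, ← mul_assoc, mul_assoc _ k, ← pow_succ']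
  exact Submodule.smul_mem _ _ (Submodule.smul_mem _ _ (monomial_mem f e k i j (l + 1)))

theorem adjoin_mul_mem {S : Set A} {N : Submodule ℂ A} (hS : ∀ s ∈ S, ∀ x ∈ N, s * x ∈ N) {y : A}
    (hy : y ∈ Algebra.adjoin ℂ S) : ∀ x ∈ N, y * x ∈ N := by
  induction hy using Algebra.adjoin_induction with
  | mem s hs => exact hS s hs
  | algebraMap c => intro x hx; rw [← Algebra.smul_def]; exact N.smul_mem c hx
  | add a b _ _ ha hb => intro x hx; rw [add_mul]; exact N.add_mem (ha x hx) (hb x hx)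
  | mul a b _ _ ha hb => intro x hx; rw [mul_assoc]; exact ha _ (hb x hx)

/-- The span of the ordered monomials contains `1` and is stable under left multiplication by `f`,
`e` and `k`. For `e`, induct on the exponent of `f`: each exchange costs only the term `w`, a
polynomial in `k`. The parameters cover `Ū_q` (`α = 1`) and the presentation of the loop algebra (`α
= q²`). -/
theorem adjoin_le_monomialSpan (hkf : k * f = z₁ • (f * k)) (hke : k * e = z₂ • (e * k))
    (hef : e * f = α • (f * e) + w) (hw : w ∈ Algebra.adjoin ℂ {k}) {y : A}
    (hy : y ∈ Algebra.adjoin ℂ {f, e, k}) : y ∈ monomialSpan f e k := by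
  have hk := fun x hx => k_mul_mem_monomialSpan (x := x) hkf hke hx
  have hwm := adjoin_mul_mem (N := monomialSpan f e k) (S := {k})
    (by rintro s hs x hx; rw [Set.mem_singleton_iff.mp hs]; exact hk x hx) hw
  have he : ∀ i j l : ℕ, e * (f ^ i * e ^ j * k ^ l) ∈ monomialSpan f e k := by
    intro i
    induction i with
    | zero =>
      intro j l
      rw [pow_zero, one_mul, ← mul_assoc, ← pow_succ']
      simpa using monomial_mem f e k 0 (j + 1) l
    | succ i ih =>
      intro j l
      have h1 : e * (f ^ (i + 1) * e ^ j * k ^ l) =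
          α • (f * (e * (f ^ i * e ^ j * k ^ l))) + w * (f ^ i * e ^ j * k ^ l) := by
        rw [pow_succ', mul_assoc f, mul_assoc f, ← mul_assoc e, hef, add_mul, smul_mul_assoc,
          mul_assoc f e]
      rw [h1]
      exact Submodule.add_mem _ (Submodule.smul_mem _ _ (f_mul_mem_monomialSpan (ih j l)))
        (hwm _ (monomial_mem f e k i j l))
  have h1 : (1 : A) ∈ monomialSpan f e k := by simpa using monomial_mem f e k 0 0 0
  have := adjoin_mul_mem (N := monomialSpan f e k) (S := {f, e, k}) (by
    rintro s (rfl | rfl | rfl) x hx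
    · exact f_mul_mem_monomialSpan hx
    · exact mul_mem_monomialSpan he hx
    · exact hk x hx) hy 1 h1
  simpa using this

theorem monomialSpan_eq_finite {p : ℕ} (hp : 2 ≤ p) (hf : f ^ p = 0) (he : e ^ p = 0)
    (hk : k ^ (2 * p) = 1) : monomialSpan f e k =
      Submodule.span ℂ (Set.range fun x : Fin p × Fin p × Fin (2 * p) =>
        f ^ (x.1 : ℕ) * e ^ (x.2.1 : ℕ) * k ^ (x.2.2 : ℕ)) := by
  refine le_antisymm (Submodule.span_le.mpr ?_) (Submodule.span_mono ?_)
  · rintro _ ⟨⟨i, j, l⟩, rfl⟩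
    simp only
    by_cases hi : p ≤ i
    · rw [pow_eq_zero_of_le hi hf]; simp
    by_cases hj : p ≤ j
    · rw [pow_eq_zero_of_le hj he]; simp
    rw [pow_eq_pow_mod l hk]
    exact Submodule.subset_span ⟨(⟨i, by omega⟩, ⟨j, by omega⟩, ⟨l % (2 * p),
      Nat.mod_lt _ (by omega)⟩), rfl⟩
  · rintro _ ⟨⟨i, j, l⟩, rfl⟩
    exact ⟨(i, j, l), rfl⟩

end NormalForm

theorem Uq.adjoin_eq_top (p : ℕ) (q : ℂ) :
    Algebra.adjoin ℂ {Uq.F p q, Uq.E p q, Uq.K p q} = (⊤ : Subalgebra ℂ (Uq p q)) := by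
  have h1 : Function.Surjective (Uq.mk p q) := RingQuot.mkAlgHom_surjective ℂ _
  rw [eq_top_iff, ← (AlgHom.range_eq_top (Uq.mk p q)).mpr h1, ← Algebra.map_top,
    ← FreeAlgebra.adjoin_range_ι, AlgHom.map_adjoin]
  refine Algebra.adjoin_mono ?_
  rintro _ ⟨_, ⟨g, rfl⟩, rfl⟩
  cases g
  · exact Or.inr (Or.inl rfl)
  · exact Or.inl rfl
  · exact Or.inr (Or.inr rfl)

theorem Uq.span_monomials {p : ℕ} {q : ℂ} (hp : 2 ≤ p) :
    Submodule.span ℂ (Set.range fun x : Fin p × Fin p × Fin (2 * p) =>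
      Uq.F p q ^ (x.1 : ℕ) * Uq.E p q ^ (x.2.1 : ℕ) * Uq.K p q ^ (x.2.2 : ℕ)) = ⊤ := by
  rw [← monomialSpan_eq_finite hp (Uq.F_pow p q) (Uq.E_pow p q) (Uq.K_pow p q), eq_top_iff]
  intro y _
  refine adjoin_le_monomialSpan (α := 1) (Uq.K_mul_F p q) (Uq.K_mul_E p q)
    (by rw [one_smul]; exact Uq.E_mul_F p q) ?_ (by rw [Uq.adjoin_eq_top]; trivial)
  have hk : Uq.K p q ∈ Algebra.adjoin ℂ {Uq.K p q} := Algebra.self_mem_adjoin_singleton ℂ _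
  exact Subalgebra.smul_mem _ (Subalgebra.sub_mem _ hk (Subalgebra.pow_mem _ hk _)) _

theorem Uq.finite {p : ℕ} (q : ℂ) (hp : 2 ≤ p) : Module.Finite ℂ (Uq p q) :=
  ⟨⟨(Set.finite_range _).toFinset, by
    rw [Set.Finite.coe_toFinset]; exact Uq.span_monomials hp⟩⟩

theorem Uq.finrank_le {p : ℕ} (q : ℂ) (hp : 2 ≤ p) :
    Module.finrank ℂ (Uq p q) ≤ Fintype.card (Fin p × Fin p × Fin (2 * p)) := by
  rw [← finrank_top ℂ (Uq p q), ← Uq.span_monomials hp]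
  exact finrank_range_le_card _

/-! ### Representations on normally ordered monomials -/

section

variable {p : ℕ} {q r : ℂ}

/-- Algebra morphisms out of the extended quantum group from triples of elements. -/
def HalfTriple.lift {A : Type*} [Ring A] [Algebra ℂ A] {E F k : A} (h : HalfTriple p q E F k) :
    UqHalf p q →ₐ[ℂ] A :=
  UqHalf.lift E F k h.E_pow h.F_pow h.k_pow h.k_E h.k_F h.E_F

theorem UqHalf.lift_gen {A : Type*} [Ring A] [Algebra ℂ A] (e f k : A)
    (he : e ^ p = 0) (hf : f ^ p = 0) (hk : k ^ (4 * p) = 1)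
    (hke : k * e = q • (e * k)) (hkf : k * f = q⁻¹ • (f * k))
    (hef : e * f = f * e + (q - q⁻¹)⁻¹ • (k ^ 2 - k ^ (4 * p - 2))) (x : UqHalfGen) :
    UqHalf.lift e f k he hf hk hke hkf hef (UqHalf.gen p q x) = UqHalf.genMap e f k x := by
  have h := RingQuot.liftAlgHom_mkAlgHom_apply ℂ (FreeAlgebra.lift ℂ (UqHalf.genMap e f k))
    (s := UqHalfRel p q) (by
      intro x y h
      induction h <;> simp [UqHalf.genMap, he, hf, hk, hke, hkf]
      simpa using hef) (FreeAlgebra.ι ℂ x)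
  exact h.trans (FreeAlgebra.lift_ι_apply _ _)

theorem HalfTriple.lift_gen {A : Type*} [Ring A] [Algebra ℂ A] {E F k : A}
    (h : HalfTriple p q E F k) (x : UqHalfGen) :
    h.lift (UqHalf.gen p q x) = UqHalf.genMap E F k x :=
  UqHalf.lift_gen _ _ _ _ _ _ _ _ _ x

theorem halfTriple_gen (p : ℕ) (q : ℂ) :
    HalfTriple p q (UqHalf.E p q) (UqHalf.F p q) (UqHalf.k p q) :=
  ⟨UqHalf.E_pow p q, UqHalf.F_pow p q, UqHalf.k_pow p q, UqHalf.k_mul_E p q, UqHalf.k_mul_F p q,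
    UqHalf.E_mul_F p q⟩

theorem HalfTriple.map {A B : Type*} [Ring A] [Algebra ℂ A] [Ring B] [Algebra ℂ B] {E F k : A}
    (h : HalfTriple p q E F k) (φ : A →ₐ[ℂ] B) : HalfTriple p q (φ E) (φ F) (φ k) := by
  refine ⟨?_, ?_, ?_, ?_, ?_, ?_⟩
  · rw [← map_pow, h.E_pow, map_zero]
  · rw [← map_pow, h.F_pow, map_zero]
  · rw [← map_pow, h.k_pow, map_one]
  · rw [← map_mul, h.k_E, map_smul, map_mul]
  · rw [← map_mul, h.k_F, map_smul, map_mul]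
  · rw [← map_mul, h.E_F]; simp

/-! ### Modules induced from characters of the Cartan part -/

theorem qInt_order (hp : 2 ≤ p) (hq : IsPrimitiveRoot q (2 * p)) : qInt q p = 0 := by
  have hq0 := Uq.q_ne_zero hp hq
  have h : q ^ p = (q ^ p)⁻¹ := by
    rw [← mul_eq_one_iff_eq_inv₀ (pow_ne_zero _ hq0), ← pow_add, ← two_mul, hq.pow_eq_one]
  rw [qInt, inv_pow, ← h, sub_self, zero_div]

/-- The commutator of `F` with a power of `E`. -/
theorem E_pow_mul_F {A : Type*} [Ring A] [Algebra ℂ A] {e f K L : A} (hq0 : q ≠ 0)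
    (h0 : q - q⁻¹ ≠ 0) (hK : K * e = q ^ 2 • (e * K)) (hL : L * e = q⁻¹ ^ 2 • (e * L))
    (hef : e * f = f * e + (q - q⁻¹)⁻¹ • (K - L)) (m : ℕ) : e ^ (m + 1) * f = f * e ^ (m + 1) +
      (qInt q (m + 1) / (q - q⁻¹)) • ((q⁻¹ ^ m • K - q ^ m • L) * e ^ m) := by
  have hK' : e * K = q⁻¹ ^ 2 • (K * e) := by
    rw [hK, smul_smul, ← mul_pow, inv_mul_cancel₀ hq0, one_pow, one_smul]
  have hL' : e * L = q ^ 2 • (L * e) := by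
    rw [hL, smul_smul, ← mul_pow, mul_inv_cancel₀ hq0, one_pow, one_smul]
  induction m with
  | zero =>
    have : qInt q 1 = 1 := by simp [qInt, h0]
    simp [hef, this]
  | succ m ih =>
    rw [pow_succ' e (m + 1), mul_assoc, ih, mul_add, ← mul_assoc, hef]
    simp only [smul_mul_assoc, ← mul_assoc, sub_mul, mul_sub, add_mul, mul_smul_comm, smul_sub,
      hK', hL', smul_smul]
    simp only [mul_assoc, ← pow_succ']
    obtain ⟨a1, a2⟩ := qInt_succ_identities hq0 h0 m
    rw [show m + 1 + 1 = m + 2 from rfl, ← a1, ← a2, add_smul, add_smul]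
    simp only [mul_assoc, pow_succ]
    abel

/-- The basis vector `F^i E^j v` of the module induced from a character of the Cartan part. -/
def pbwVec (p : ℕ) (i j : ℕ) : Fin p × Fin p →₀ ℂ :=
  if h : i < p ∧ j < p then Finsupp.single (⟨i, h.1⟩, ⟨j, h.2⟩) 1 else 0

theorem pbwVec_coe (x : Fin p × Fin p) : pbwVec p x.1 x.2 = Finsupp.single x 1 := by
  simp [pbwVec]

theorem pbwVec_eq_zero {i j : ℕ} (h : p ≤ i ∨ p ≤ j) : pbwVec p i j = 0 := by
  rw [pbwVec, dif_neg]; omega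

theorem pbwVec_hom_ext {S T : Module.End ℂ (Fin p × Fin p →₀ ℂ)}
    (h : ∀ i j : ℕ, S (pbwVec p i j) = T (pbwVec p i j)) : S = T := by
  refine Finsupp.lhom_ext' fun x => LinearMap.ext_ring ?_
  simpa [pbwVec_coe] using h x.1 x.2

/-- The linear map with prescribed values on the vectors `pbwVec`. -/
def pbwMap (p : ℕ) (g : ℕ → ℕ → Fin p × Fin p →₀ ℂ) : Module.End ℂ (Fin p × Fin p →₀ ℂ) :=
  Finsupp.linearCombination ℂ fun x : Fin p × Fin p => g x.1 x.2

theorem pbwMap_apply {g : ℕ → ℕ → Fin p × Fin p →₀ ℂ} (hg : ∀ i j, p ≤ i ∨ p ≤ j → g i j = 0)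
    (i j : ℕ) : pbwMap p g (pbwVec p i j) = g i j := by
  by_cases h : i < p ∧ j < p
  · rw [pbwVec, dif_pos h, pbwMap, Finsupp.linearCombination_single, one_smul]
  · rw [pbwVec_eq_zero (by omega), map_zero, hg i j (by omega)]

/-- The coefficient of `F^{i-1} E^j v` in `E F^i E^j v`, for `K v = t v`. -/
def pbwCoeff (q t : ℂ) (i j : ℕ) : ℂ :=
  qInt q i / (q - q⁻¹) * (q⁻¹ ^ i * q * t * q ^ (2 * j) - q ^ i * q⁻¹ * t⁻¹ * q⁻¹ ^ (2 * j))

/-- The action of `E`, for `K v = t v`. -/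
def pbwE (p : ℕ) (q t : ℂ) : Module.End ℂ (Fin p × Fin p →₀ ℂ) :=
  pbwMap p fun i j => pbwVec p i (j + 1) + pbwCoeff q t i j • pbwVec p (i - 1) j

/-- The action of `F`. -/
def pbwF (p : ℕ) : Module.End ℂ (Fin p × Fin p →₀ ℂ) :=
  pbwMap p fun i j => pbwVec p (i + 1) j

/-- The action of `K^{1/2}`, for `K^{1/2} v = s v`. -/
def pbwk (p : ℕ) (q s : ℂ) : Module.End ℂ (Fin p × Fin p →₀ ℂ) :=
  pbwMap p fun i j => (s * q⁻¹ ^ i * q ^ j) • pbwVec p i j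

theorem pbwF_apply (i j : ℕ) : pbwF p (pbwVec p i j) = pbwVec p (i + 1) j :=
  pbwMap_apply (fun i j h => pbwVec_eq_zero (by omega)) i j

theorem pbwk_apply (s : ℂ) (i j : ℕ) :
    pbwk p q s (pbwVec p i j) = (s * q⁻¹ ^ i * q ^ j) • pbwVec p i j :=
  pbwMap_apply (fun i j h => by rw [pbwVec_eq_zero h, smul_zero]) i j

theorem pbwk_pow_apply (s : ℂ) (i j n : ℕ) :
    (pbwk p q s ^ n) (pbwVec p i j) = (s * q⁻¹ ^ i * q ^ j) ^ n • pbwVec p i j := by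
  induction n with
  | zero => simp
  | succ n ih => rw [pow_succ, Module.End.mul_apply, pbwk_apply, map_smul, ih, smul_smul, pow_succ']

/-- The boundary cases are what needs proof. At `i = p` the vector with index `p - 1` is not zero,
but its coefficient contains `[p] = 0`. At `i = 0` the truncated `i - 1` is harmless because the
coefficient contains `[0] = 0`. -/
theorem pbwE_apply (hp : 2 ≤ p) (hq : IsPrimitiveRoot q (2 * p)) (t : ℂ) (i j : ℕ) :
    pbwE p q t (pbwVec p i j) = pbwVec p i (j + 1) + pbwCoeff q t i j • pbwVec p (i - 1) j := by
  refine pbwMap_apply (fun i j h => ?_) i j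
  rw [pbwVec_eq_zero (by omega), zero_add]
  by_cases hi : i = p
  · subst hi
    rw [pbwCoeff, qInt_order hp hq]
    simp
  · rw [pbwVec_eq_zero (by omega), smul_zero]

theorem pbwCoeff_zero (t : ℂ) (j : ℕ) : pbwCoeff q t 0 j = 0 := by simp [pbwCoeff, qInt]

/-- The increment is the eigenvalue of `(K - K⁻¹) / (q - q⁻¹)` on `F^i E^j v`, as the relation for
`EF - FE` demands. -/
theorem pbwCoeff_succ (hq0 : q ≠ 0) (h0 : q - q⁻¹ ≠ 0) {t : ℂ} (ht : t ≠ 0) (i j : ℕ) :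
    pbwCoeff q t (i + 1) j = pbwCoeff q t i j + (q - q⁻¹)⁻¹ *
      (t * (q⁻¹ ^ i) ^ 2 * (q ^ j) ^ 2 - t⁻¹ * (q ^ i) ^ 2 * (q⁻¹ ^ j) ^ 2) := by
  have h0' : q ^ 2 - 1 ≠ 0 := by
    intro h'
    apply h0
    field_simp
    rw [h', mul_zero]
  have hi : q ^ i ≠ 0 := pow_ne_zero _ hq0
  have hj : q ^ j ≠ 0 := pow_ne_zero _ hq0
  simp only [pbwCoeff, qInt, inv_pow, pow_succ q i, mul_comm 2 j, pow_mul]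
  generalize q ^ i = x at *
  generalize q ^ j = y at *
  field_simp
  ring

/-- All relations but `E ^ p = 0` are read off on the basis vectors. For that one, `E ^ p` commutes
with `F` because `[p] = 0` in the commutator formula, and it kills the vectors with `i = 0`, on
which `E` only raises `j`; powers of `F` carry this to all `i`. -/
theorem halfTriple_pbw (hp : 2 ≤ p) (hq : IsPrimitiveRoot q (2 * p)) {s : ℂ}
    (hs : s ^ (4 * p) = 1) : HalfTriple p q (pbwE p q (s ^ 2)) (pbwF p) (pbwk p q s) := by
  have hq0 := Uq.q_ne_zero hp hq
  have h0 := Uq.q_sub_inv_ne_zero hp hq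
  have hs0 : s ≠ 0 := by rintro rfl; rw [zero_pow (by omega)] at hs; exact zero_ne_one hs
  have hev : ∀ i j, (s * q⁻¹ ^ i * q ^ j) ^ (4 * p) = 1 := by
    intro i j
    have hq4 : q ^ (4 * p) = 1 := by
      rw [show 4 * p = 2 * p * 2 by ring, pow_mul, hq.pow_eq_one, one_pow]
    rw [mul_pow, mul_pow, hs, ← pow_mul, ← pow_mul, mul_comm i, mul_comm j, pow_mul, pow_mul q,
      inv_pow, hq4]
    simp
  have hkE : pbwk p q s * pbwE p q (s ^ 2) = q • (pbwE p q (s ^ 2) * pbwk p q s) := by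
    refine pbwVec_hom_ext fun i j => ?_
    rw [Module.End.mul_apply, LinearMap.smul_apply, Module.End.mul_apply, pbwk_apply, map_smul,
      pbwE_apply hp hq, map_add, map_smul, pbwk_apply, pbwk_apply, smul_add, smul_add, smul_smul,
      smul_smul, smul_smul, smul_smul]
    congr 1
    · rw [pow_succ]; congr 1; ring
    · rcases i with _ | i
      · simp [pbwCoeff_zero]
      · rw [Nat.add_sub_cancel, pow_succ q⁻¹ i]; congr 1; field_simp
  have hkF : pbwk p q s * pbwF p = q⁻¹ • (pbwF p * pbwk p q s) := by
    refine pbwVec_hom_ext fun i j => ?_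
    rw [Module.End.mul_apply, LinearMap.smul_apply, Module.End.mul_apply, pbwk_apply, map_smul,
      pbwF_apply, pbwk_apply, smul_smul, pow_succ]
    congr 1; ring
  have hk4 : pbwk p q s ^ (4 * p) = 1 := by
    refine pbwVec_hom_ext fun i j => ?_
    rw [pbwk_pow_apply, hev, one_smul, Module.End.one_apply]
  have hEF : pbwE p q (s ^ 2) * pbwF p = pbwF p * pbwE p q (s ^ 2) +
      (q - q⁻¹)⁻¹ • (pbwk p q s ^ 2 - pbwk p q s ^ (4 * p - 2)) := by
    refine pbwVec_hom_ext fun i j => ?_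
    rw [LinearMap.add_apply, LinearMap.smul_apply, LinearMap.sub_apply, Module.End.mul_apply,
      Module.End.mul_apply, pbwk_pow_apply, pbwk_pow_apply, pbwF_apply, pbwE_apply hp hq,
      pbwE_apply hp hq, map_add, map_smul, pbwF_apply, pbwF_apply, Nat.add_sub_cancel,
      pbwCoeff_succ hq0 h0 (pow_ne_zero 2 hs0), ← sub_smul, smul_smul]
    have h1 : (s * q⁻¹ ^ i * q ^ j) ^ (4 * p - 2) =
        (s ^ 2)⁻¹ * (q ^ i) ^ 2 * (q⁻¹ ^ j) ^ 2 := by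
      have hne : (s * q⁻¹ ^ i * q ^ j) ^ 2 ≠ 0 := by positivity
      apply mul_left_cancel₀ hne
      rw [← pow_add, show 2 + (4 * p - 2) = 4 * p by omega, hev]
      simp only [inv_pow]
      field_simp
    have h2 : pbwCoeff q (s ^ 2) i j • pbwVec p (i - 1 + 1) j =
        pbwCoeff q (s ^ 2) i j • pbwVec p i j := by
      rcases i with _ | i
      · simp [pbwCoeff_zero]
      · rfl
    rw [h1, h2, add_smul, add_assoc]
    congr 4
    ring
  have hE0 : ∀ n j, (pbwE p q (s ^ 2) ^ n) (pbwVec p 0 j) = pbwVec p 0 (j + n) := by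
    intro n
    induction n with
    | zero => intro j; simp
    | succ n ih =>
      intro j
      rw [pow_succ, Module.End.mul_apply, pbwE_apply hp hq, pbwCoeff_zero, zero_smul, add_zero, ih,
        add_assoc, add_comm 1]
  have hEp : pbwE p q (s ^ 2) ^ p * pbwF p = pbwF p * pbwE p q (s ^ 2) ^ p := by
    have hK := pow_mul_skew (A := Module.End ℂ (Fin p × Fin p →₀ ℂ)) hkE 2
    have h1 : pbwk p q s ^ 2 * pbwk p q s ^ (4 * p - 2) = 1 := by
      rw [← pow_add, show 2 + (4 * p - 2) = 4 * p by omega, hk4]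
    have h2 : pbwk p q s ^ (4 * p - 2) * pbwk p q s ^ 2 = 1 := by
      rw [← pow_add, show 4 * p - 2 + 2 = 4 * p by omega, hk4]
    have hL := skew_inv (A := Module.End ℂ (Fin p × Fin p →₀ ℂ)) (pow_ne_zero 2 hq0) h1 h2 hK
    rw [← inv_pow] at hL
    have h3 := E_pow_mul_F hq0 h0 hK hL hEF (p - 1)
    rw [Nat.sub_add_cancel (by omega), qInt_order hp hq, zero_div, zero_smul, add_zero] at h3
    exact h3
  refine ⟨pbwVec_hom_ext fun i => ?_, ?_, hk4, hkE, hkF, hEF⟩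
  · induction i with
    | zero => intro j; rw [hE0, pbwVec_eq_zero (by omega), LinearMap.zero_apply]
    | succ i ih =>
      intro j
      rw [← pbwF_apply, ← Module.End.mul_apply, hEp, Module.End.mul_apply, ih]
      simp
  · have hF : ∀ n i j, (pbwF p ^ n) (pbwVec p i j) = pbwVec p (i + n) j := by
      intro n
      induction n with
      | zero => intro i j; simp
      | succ n ih =>
        intro i j
        rw [pow_succ, Module.End.mul_apply, pbwF_apply, ih, add_assoc, add_comm 1]
    refine pbwVec_hom_ext fun i j => ?_
    rw [hF, pbwVec_eq_zero (by omega), LinearMap.zero_apply]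

/-- The monomials in `q⁻¹ (q - q⁻¹) F`, `(q - q⁻¹) K⁻¹ E` and `K⁻¹` are linearly independent. -/
theorem linearIndependent_monomials (hp : 2 ≤ p) (hq : IsPrimitiveRoot q (2 * p))
    (hr : r ^ 2 = q) : LinearIndependent ℂ fun x : Fin p × Fin p × Fin (2 * p) =>
      ((q⁻¹ * (q - q⁻¹)) • UqHalf.F p q) ^ (x.1 : ℕ) *
        ((q - q⁻¹) • (UqHalf.k p q ^ (4 * p - 2) * UqHalf.E p q)) ^ (x.2.1 : ℕ) *
          (UqHalf.k p q ^ (4 * p - 2)) ^ (x.2.2 : ℕ) := by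
  have hq0 := Uq.q_ne_zero hp hq
  have h0 := Uq.q_sub_inv_ne_zero hp hq
  have hr' := isPrimitiveRoot_sqrt hp hq hr
  have hr0 : r ≠ 0 := hr'.ne_zero (by omega)
  rw [Fintype.linearIndependent_iff]
  intro g hg
  -- In the module where `K^{1/2}` has eigenvalue `r ^ a` on the cyclic vector `v`, a monomial sends
  -- `v` to a multiple of `F^i E^j v`. The scalar depends on `l` only through `(q⁻¹ ^ a) ^ l`.
  have key : ∀ (a i j : ℕ), ∃ t : ℂ, t ≠ 0 ∧ ∀ (l : ℕ) (s : ℂ) (hs : s = r ^ a)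
      (hh : HalfTriple p q (pbwE p q (s ^ 2)) (pbwF p) (pbwk p q s)),
      hh.lift (((q⁻¹ * (q - q⁻¹)) • UqHalf.F p q) ^ i *
        ((q - q⁻¹) • (UqHalf.k p q ^ (4 * p - 2) * UqHalf.E p q)) ^ j *
          (UqHalf.k p q ^ (4 * p - 2)) ^ l) (pbwVec p 0 0) =
        ((q⁻¹ ^ a) ^ l * t) • pbwVec p i j := by
    intro a i j
    have hra : r ^ a ≠ 0 := pow_ne_zero _ hr0
    have hra4 : (r ^ a) ^ (4 * p) = 1 := by
      rw [← pow_mul, mul_comm, pow_mul, hr'.pow_eq_one, one_pow]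
    have hra2 : (r ^ a) ^ (4 * p - 2) = q⁻¹ ^ a := by
      apply mul_left_cancel₀ (pow_ne_zero 2 hra)
      rw [← pow_add, show 2 + (4 * p - 2) = 4 * p by omega, hra4, ← pow_mul, mul_comm a, pow_mul,
        hr, ← mul_pow, mul_inv_cancel₀ hq0, one_pow]
    have hh : HalfTriple p q (pbwE p q ((r ^ a) ^ 2)) (pbwF p) (pbwk p q (r ^ a)) :=
      halfTriple_pbw hp hq hra4
    have hF : hh.lift (UqHalf.F p q) = pbwF p := hh.lift_gen _
    have hE : hh.lift (UqHalf.E p q) = pbwE p q ((r ^ a) ^ 2) := hh.lift_gen _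
    have hk : hh.lift (UqHalf.k p q) = pbwk p q (r ^ a) := hh.lift_gen _
    have hb : ∀ i j, ∃ t : ℂ, t ≠ 0 ∧ (((q⁻¹ * (q - q⁻¹)) • pbwF p) ^ i) (pbwVec p 0 j) =
        t • pbwVec p i j := by
      intro i j
      induction i with
      | zero => exact ⟨1, one_ne_zero, by simp⟩
      | succ i ih =>
        obtain ⟨t, ht, h⟩ := ih
        refine ⟨t * (q⁻¹ * (q - q⁻¹)), mul_ne_zero ht (mul_ne_zero (inv_ne_zero hq0) h0), ?_⟩
        rw [pow_succ', Module.End.mul_apply, h, map_smul, LinearMap.smul_apply, pbwF_apply,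
          smul_smul]
    have hc : ∀ j, ∃ t : ℂ, t ≠ 0 ∧ (((q - q⁻¹) • (pbwk p q (r ^ a) ^ (4 * p - 2) *
        pbwE p q ((r ^ a) ^ 2))) ^ j) (pbwVec p 0 0) = t • pbwVec p 0 j := by
      intro j
      induction j with
      | zero => exact ⟨1, one_ne_zero, by simp⟩
      | succ j ih =>
        obtain ⟨t, ht, h⟩ := ih
        refine ⟨t * ((q - q⁻¹) * (r ^ a * q⁻¹ ^ 0 * q ^ (j + 1)) ^ (4 * p - 2)),
          mul_ne_zero ht (mul_ne_zero h0 (pow_ne_zero _ (mul_ne_zero (mul_ne_zero hra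
            (pow_ne_zero _ (inv_ne_zero hq0))) (pow_ne_zero _ hq0)))), ?_⟩
        rw [pow_succ', Module.End.mul_apply, h, map_smul, LinearMap.smul_apply,
          Module.End.mul_apply, pbwE_apply hp hq, pbwCoeff_zero, zero_smul, add_zero,
          pbwk_pow_apply, smul_smul, smul_smul, mul_assoc]
    obtain ⟨t₁, ht₁, h₁⟩ := hb i j
    obtain ⟨t₂, ht₂, h₂⟩ := hc j
    refine ⟨t₂ * t₁, mul_ne_zero ht₂ ht₁, ?_⟩
    rintro l s rfl hh'
    have hd : ((pbwk p q (r ^ a) ^ (4 * p - 2)) ^ l) (pbwVec p 0 0) =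
        (q⁻¹ ^ a) ^ l • pbwVec p 0 0 := by
      rw [← pow_mul, pbwk_pow_apply, pow_zero, pow_zero, mul_one, mul_one, pow_mul, hra2]
    simp only [map_mul, map_pow, map_smul, hF, hE, hk]
    rw [Module.End.mul_apply, Module.End.mul_apply, hd, map_smul, h₂, map_smul, map_smul, h₁,
      smul_smul, smul_smul, mul_assoc]
  have hvan : ∀ i j : Fin p, (fun l => g (i, j, l)) = 0 := by
    intro i j
    -- For fixed `i, j` the characters `a = 0, …, 2p - 1` give a Vandermonde system in the
    -- coefficients, with nodes `q⁻ᵃ` that are distinct since `q` has order `2p`.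
    refine Matrix.eq_zero_of_forall_index_sum_mul_pow_eq_zero
      (f := fun a : Fin (2 * p) => q⁻¹ ^ (a : ℕ)) (fun a b hab => ?_) fun a => ?_
    · exact Fin.ext (hq.inv.pow_inj a.2 b.2 hab)
    · choose t ht hkey using key a
      have hra4 : (r ^ (a : ℕ)) ^ (4 * p) = 1 := by
        rw [← pow_mul, mul_comm, pow_mul, hr'.pow_eq_one, one_pow]
      have hh := halfTriple_pbw hp hq hra4
      have h1 := congrArg (fun y => hh.lift y (pbwVec p 0 0) (i, j)) hg
      simp only [map_sum, map_smul, map_zero, LinearMap.zero_apply, Finsupp.zero_apply,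
        LinearMap.sum_apply, LinearMap.smul_apply, hkey _ _ _ _ rfl hh, Finsupp.finsetSum_apply,
        Finsupp.smul_apply] at h1
      have h2 : ∀ x : Fin p × Fin p × Fin (2 * p), pbwVec p x.1 x.2.1 (i, j) =
          if (x.1, x.2.1) = (i, j) then 1 else 0 := by
        intro x
        have h3 := pbwVec_coe (x.1, x.2.1)
        simp only at h3
        rw [h3, Finsupp.single_apply]
      simp only [h2] at h1
      rw [Fintype.sum_prod_type, Finset.sum_eq_single i, Fintype.sum_prod_type,
        Finset.sum_eq_single j] at h1
      · simp only [if_true, smul_eq_mul, mul_one, ← mul_assoc] at h1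
        rw [← Finset.sum_mul] at h1
        exact (mul_eq_zero.mp h1).resolve_right (ht i j)
      · intro b _ hb
        simp [hb]
      · simp
      · intro b _ hb
        simp [hb]
      · simp
  rintro ⟨i, j, l⟩
  exact congrFun (hvan i j) l

end

end LoopAlgebra

end

noncomputable section

namespace LoopAlgebra

/-! ### The morphism from the loop algebra to the extended quantum group -/

section

variable {p : ℕ} {q r : ℂ}

theorem map_weightProj {A B : Type*} [Ring A] [Algebra ℂ A] [Ring B] [Algebra ℂ B] (φ : A →ₐ[ℂ] B)
    (k : A) (n : ℕ) : φ (weightProj p r k n) = weightProj p r (φ k) n := by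
  simp [weightProj]

theorem map_cartan {A B : Type*} [Ring A] [Algebra ℂ A] [Ring B] [Algebra ℂ B] (φ : A →ₐ[ℂ] B)
    (k₁ k₂ : A) : φ (cartan p r k₁ k₂) = cartan p r (φ k₁) (φ k₂) := by
  simp [cartan, map_weightProj]

theorem map_qExp {A B : Type*} [Ring A] [Algebra ℂ A] [Ring B] [Algebra ℂ B] (φ : A →ₐ[ℂ] B)
    (x : A) : φ (qExp p q x) = qExp p q (φ x) := by
  simp [qExp]

theorem qExp_zero (hp : 2 ≤ p) {A : Type*} [Ring A] [Algebra ℂ A] : qExp p q (0 : A) = 1 := by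
  obtain ⟨n, rfl⟩ : ∃ n, p = n + 1 := ⟨p - 1, by omega⟩
  rw [qExp, Finset.sum_range_succ']
  simp [rCoeff_zero]

/-- The element `R R'`, written in terms of `K` in the first tensor factor. -/
def xElt (p : ℕ) (q r : ℂ) {A : Type*} [Ring A] [Algebra ℂ A] (E₁ F₁ K₁ E₃ F₃ k₃ : A) : A :=
  cartan p r K₁ k₃ * qExp p q (E₁ * K₁ * (k₃ ^ (4 * p - 2) * F₃)) * qExp p q (F₁ * E₃)

/-- Moving the second Cartan part to the left through the first exponential merges the two Cartan
parts into one with `k₁ ^ 2` in place of `k₁`. Thus `R R'` involves the first factor only through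
`E`, `F` and `K`, and functionals on `Ū_q` can be applied to it. Few relations are asked of the
first triple, so that the coproduct can be put there. -/
theorem rElt_mul_rElt (hp : 2 ≤ p) (hq : IsPrimitiveRoot q (2 * p)) (hr : r ^ 2 = q)
    {A : Type*} [Ring A] [Algebra ℂ A] {E₁ F₁ k₁ E₃ F₃ k₃ : A} (hk : k₁ ^ (4 * p) = 1)
    (hkE : k₁ * E₁ = q • (E₁ * k₁)) (h3 : HalfTriple p q E₃ F₃ k₃)
    (h13 : CommTriples E₁ F₁ k₁ E₃ F₃ k₃) :
    rElt p q r E₁ k₁ F₃ k₃ * rElt p q r E₃ k₃ F₁ k₁ = xElt p q r E₁ F₁ (k₁ ^ 2) E₃ F₃ k₃ := by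
  have hr' := isPrimitiveRoot_sqrt hp hq hr
  have e1 : E₁ * cartan p r k₁ k₃ = cartan p r k₁ k₃ * (E₁ * k₃ ^ (4 * p - 2)) := by
    have := cartan_mul_raise hp hr' hr h3.k_pow hkE h13.E_k
    rw [← mul_assoc, this, mul_assoc, h3.K_Kinv hp, mul_one]
  have e2 : F₃ * cartan p r k₁ k₃ = cartan p r k₁ k₃ * F₃ * k₁ ^ 2 := by
    rw [cartan_comm h13.k_k]
    exact mul_cartan_lower hp hr' hr hk h3.k_F h13.k_F.symm
  have e3 : E₁ * F₃ * cartan p r k₁ k₃ =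
      cartan p r k₁ k₃ * (E₁ * k₁ ^ 2 * (k₃ ^ (4 * p - 2) * F₃)) := by
    have c : Commute (k₁ ^ 2) (k₃ ^ (4 * p - 2) * F₃) :=
      ((h13.k_k.pow_right _).mul_right h13.k_F).pow_left 2
    rw [mul_assoc, e2, ← mul_assoc, ← mul_assoc, e1, mul_assoc E₁, c.eq]
    simp only [mul_assoc]
  have e4 : cartan p r (k₁ ^ 2) k₃ = cartan p r k₁ k₃ * cartan p r k₁ k₃ := by
    rw [pow_two, cartan_mul_left hp hr' h3.k_pow (Commute.refl _) h13.k_k]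
  rw [rElt, rElt, xElt, cartan_comm h13.k_k.symm, e4, h13.F_E.eq, mul_assoc (cartan p r k₁ k₃),
    ← mul_assoc (qExp p q (E₁ * F₃)), semiconj_qExp e3]
  simp only [mul_assoc]

theorem map_xElt {A B : Type*} [Ring A] [Algebra ℂ A] [Ring B] [Algebra ℂ B] (φ : A →ₐ[ℂ] B)
    (E₁ F₁ K₁ E₃ F₃ k₃ : A) : φ (xElt p q r E₁ F₁ K₁ E₃ F₃ k₃) =
      xElt p q r (φ E₁) (φ F₁) (φ K₁) (φ E₃) (φ F₃) (φ k₃) := by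
  simp [xElt, map_cartan, map_qExp]

theorem map_rElt {A B : Type*} [Ring A] [Algebra ℂ A] [Ring B] [Algebra ℂ B] (φ : A →ₐ[ℂ] B)
    (E₁ k₁ F₂ k₂ : A) : φ (rElt p q r E₁ k₁ F₂ k₂) =
      rElt p q r (φ E₁) (φ k₁) (φ F₂) (φ k₂) := by
  simp [rElt, map_cartan, map_qExp]

theorem RMatrix_eq_rElt : RMatrix p q r = rElt p q r (UqHalf.E p q ⊗ₜ[ℂ] (1 : UqHalf p q))
    (UqHalf.k p q ⊗ₜ 1) (1 ⊗ₜ UqHalf.F p q) (1 ⊗ₜ UqHalf.k p q) := by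
  rw [RMatrix, rElt, cartan_eq_sum, cartanPart, qExp]
  simp [Algebra.TensorProduct.tmul_pow, rCoeff]

theorem RMatrix'_eq_rElt : RMatrix' p q r = rElt p q r ((1 : UqHalf p q) ⊗ₜ[ℂ] UqHalf.E p q)
    (1 ⊗ₜ UqHalf.k p q) (UqHalf.F p q ⊗ₜ 1) (UqHalf.k p q ⊗ₜ 1) := by
  rw [RMatrix', RMatrix_eq_rElt]
  exact map_rElt (Algebra.TensorProduct.comm ℂ (UqHalf p q) (UqHalf p q)).toAlgHom _ _ _ _

/-- The element `R R'` in `Ū_q ⊗ Ū_q^{1/2}`. -/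
def doubleR (p : ℕ) (q r : ℂ) : Uq p q ⊗[ℂ] UqHalf p q :=
  xElt p q r (Uq.E p q ⊗ₜ 1) (Uq.F p q ⊗ₜ 1) (Uq.K p q ⊗ₜ 1) (1 ⊗ₜ UqHalf.E p q)
    (1 ⊗ₜ UqHalf.F p q) (1 ⊗ₜ UqHalf.k p q)

/-- The map `φ ↦ (φ ⊗ id)(R R')`. -/
def slice (p : ℕ) (q r : ℂ) : Module.Dual ℂ (Uq p q) →ₗ[ℂ] UqHalf p q :=
  (TensorProduct.lid ℂ (UqHalf p q)).toLinearMap ∘ₗ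
    (LinearMap.applyₗ (doubleR p q r)) ∘ₗ (LinearMap.rTensorHom (UqHalf p q))

theorem slice_apply (φ : Module.Dual ℂ (Uq p q)) :
    slice p q r φ = TensorProduct.lid ℂ (UqHalf p q) (LinearMap.rTensor _ φ (doubleR p q r)) := rfl

theorem slice_algHom (φ : Uq p q →ₐ[ℂ] ℂ) : slice p q r φ.toLinearMap =
    xElt p q r (algebraMap ℂ (UqHalf p q) (φ (Uq.E p q))) (algebraMap ℂ _ (φ (Uq.F p q)))
      (algebraMap ℂ _ (φ (Uq.K p q))) (UqHalf.E p q) (UqHalf.F p q) (UqHalf.k p q) := by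
  have h : slice p q r φ.toLinearMap =
      ((Algebra.TensorProduct.lid ℂ (UqHalf p q)).toAlgHom.comp
        (Algebra.TensorProduct.map φ (AlgHom.id ℂ (UqHalf p q)))) (doubleR p q r) := rfl
  rw [h, doubleR, map_xElt]
  simp [Algebra.algebraMap_eq_smul_one]

theorem slice_counit (hp : 2 ≤ p) (hq : IsPrimitiveRoot q (2 * p)) (hr : r ^ 2 = q) :
    slice p q r (Uq.counit (p := p) (q := q) hp).toLinearMap = 1 := by
  rw [slice_algHom]
  have hE : Uq.counit (p := p) (q := q) hp (Uq.E p q) = 0 := Uq.lift_gen _ _ _ _ _ _ _ _ _ _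
  have hF : Uq.counit (p := p) (q := q) hp (Uq.F p q) = 0 := Uq.lift_gen _ _ _ _ _ _ _ _ _ _
  have hK : Uq.counit (p := p) (q := q) hp (Uq.K p q) = 1 := Uq.lift_gen _ _ _ _ _ _ _ _ _ _
  rw [hE, hF, hK, map_zero, map_one, xElt, zero_mul, zero_mul, zero_mul, qExp_zero hp, mul_one,
    mul_one, cartan]
  simp [sum_weightProj hp (isPrimitiveRoot_sqrt hp hq hr)]

/-! ### Evaluation in matrices and the fusion relation -/

theorem map_scalarMat {ι : Type} {A B : Type} [Ring A] [Algebra ℂ A] [Ring B] [Algebra ℂ B] (φ : A →ₐ[ℂ] B)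
    (Q : Matrix ι ι ℂ) : (scalarMat A Q).map φ = scalarMat B Q := by
  ext i j
  simp [scalarMat]

variable {ι : Type} [Fintype ι] [DecidableEq ι]

/-- Scalar matrices, as an algebra morphism. -/
def scalarHom (ι : Type) [Fintype ι] [DecidableEq ι] (A : Type) [Ring A] [Algebra ℂ A] :
    A →ₐ[ℂ] Matrix ι ι A where
  toRingHom := Matrix.scalar ι
  commutes' c := by
    ext i j
    simp [Matrix.algebraMap_matrix_apply, Matrix.diagonal_apply]

/-- Complex matrices viewed with coefficients in an algebra, as an algebra morphism. -/
def scalarMatHom (ι : Type) [Fintype ι] [DecidableEq ι] (A : Type) [Ring A] [Algebra ℂ A] :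
    Matrix ι ι ℂ →ₐ[ℂ] Matrix ι ι A :=
  (Algebra.ofId ℂ A).mapMatrix

theorem scalarMatHom_apply (A : Type) [Ring A] [Algebra ℂ A] (Q : Matrix ι ι ℂ) :
    scalarMatHom ι A Q = scalarMat A Q := rfl

theorem scalarMatHom_mul_scalarHom_apply {A : Type} [Ring A] [Algebra ℂ A] (Q : Matrix ι ι ℂ)
    (a : A) (i j : ι) : (scalarMatHom ι A Q * scalarHom ι A a) i j = Q i j • a := by
  change (scalarMat A Q * Matrix.scalar ι a) i j = _
  rw [Matrix.scalar_apply, Matrix.mul_diagonal, Algebra.smul_def]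
  rfl

theorem commute_scalarMatHom {A : Type} [Ring A] [Algebra ℂ A] (Q : Matrix ι ι ℂ) (a : A) :
    Commute (scalarMatHom ι A Q) (scalarHom ι A a) := by
  ext i j
  rw [scalarMatHom_mul_scalarHom_apply]
  change _ = (Matrix.scalar ι a * scalarMat A Q) i j
  rw [Matrix.scalar_apply, Matrix.diagonal_mul, Algebra.smul_def, Algebra.commutes]
  rfl

/-- Evaluation of the first tensor factor in a matrix representation. -/
def evalLeft (ρ : Uq p q →ₐ[ℂ] Matrix ι ι ℂ) :
    Uq p q ⊗[ℂ] UqHalf p q →ₐ[ℂ] Matrix ι ι (UqHalf p q) :=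
  Algebra.TensorProduct.lift ((scalarMatHom ι (UqHalf p q)).comp ρ) (scalarHom ι (UqHalf p q))
    fun _ _ => commute_scalarMatHom _ _

theorem evalLeft_tmul (ρ : Uq p q →ₐ[ℂ] Matrix ι ι ℂ) (x : Uq p q) (y : UqHalf p q) :
    evalLeft ρ (x ⊗ₜ y) = scalarMatHom ι _ (ρ x) * scalarHom ι _ y :=
  Algebra.TensorProduct.lift_tmul _ _ _ _ _

/-- Slices against matrix coefficients become entries of an algebra morphism, so that multiplicative
identities for `R R'` apply to them. -/
theorem evalLeft_apply (ρ : Uq p q →ₐ[ℂ] Matrix ι ι ℂ) (z : Uq p q ⊗[ℂ] UqHalf p q) (i j : ι) :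
    evalLeft ρ z i j = TensorProduct.lid ℂ (UqHalf p q) (LinearMap.rTensor _
      ((Matrix.entryLinearMap ℂ ℂ i j).comp ρ.toLinearMap) z) := by
  induction z using TensorProduct.induction_on with
  | zero => simp
  | tmul x y => rw [evalLeft_tmul, scalarMatHom_mul_scalarHom_apply]; simp
  | add x y hx hy => simp only [map_add, Matrix.add_apply, hx, hy]

theorem lift_slice_freeM (ρ : Uq p q →ₐ[ℂ] Matrix ι ι ℂ) :
    (freeM ρ).map (TensorAlgebra.lift ℂ (slice p q r)) = evalLeft ρ (doubleR p q r) := by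
  ext i j
  rw [evalLeft_apply, ← slice_apply, Matrix.map_apply, freeM, Matrix.of_apply,
    TensorAlgebra.lift_ι_apply]

theorem evalLeft_doubleR (ρ : Uq p q →ₐ[ℂ] Matrix ι ι ℂ) : evalLeft ρ (doubleR p q r) =
    xElt p q r (scalarMatHom ι _ (ρ (Uq.E p q))) (scalarMatHom ι _ (ρ (Uq.F p q)))
      (scalarMatHom ι _ (ρ (Uq.K p q))) (scalarHom ι _ (UqHalf.E p q))
      (scalarHom ι _ (UqHalf.F p q)) (scalarHom ι _ (UqHalf.k p q)) := by
  rw [doubleR, map_xElt]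
  simp [evalLeft_tmul]

theorem isUnit_evalTensor_RMatrix' (hp : 2 ≤ p) (hq : IsPrimitiveRoot q (2 * p)) (hr : r ^ 2 = q)
    {m n : ℕ} (I' : MatRep (UqHalf p q) m) (J' : MatRep (UqHalf p q) n) :
    IsUnit (evalTensor I' J' (RMatrix' p q r)) := by
  refine IsUnit.map _ ?_
  rw [RMatrix'_eq_rElt]
  have h := halfTriple_gen p q
  have h1 := h.map (Algebra.TensorProduct.includeLeft (R := ℂ) (S := ℂ) (A := UqHalf p q) (B := UqHalf p q))
  have h2 := h.map (Algebra.TensorProduct.includeRight (R := ℂ) (A := UqHalf p q) (B := UqHalf p q))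
  have hc : ∀ x y : UqHalf p q, Commute ((1 : UqHalf p q) ⊗ₜ[ℂ] x) (y ⊗ₜ[ℂ] (1 : UqHalf p q)) := by
    intro x y
    simp [Commute, SemiconjBy]
  exact isUnit_rElt hp (isPrimitiveRoot_sqrt hp hq hr) h2 h1
    ⟨hc _ _, hc _ _, hc _ _, hc _ _, hc _ _, hc _ _, hc _ _, hc _ _, hc _ _⟩

theorem leg1_evalLeft {m n : ℕ} (I : MatRep (Uq p q) m) (J : MatRep (Uq p q) n)
    (z : Uq p q ⊗[ℂ] UqHalf p q) : leg1 (evalLeft I z) =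
      evalLeft ((evalTensor I J).comp Algebra.TensorProduct.includeLeft) z := by
  refine Matrix.ext fun ⟨a, b⟩ ⟨c, d⟩ => ?_
  induction z using TensorProduct.induction_on with
  | zero => simp [leg1]
  | tmul x y =>
    rw [leg1, Matrix.kroneckerMap_apply, evalLeft_tmul, evalLeft_tmul,
      scalarMatHom_mul_scalarHom_apply, scalarMatHom_mul_scalarHom_apply]
    by_cases hbd : b = d <;> simp [evalTensor, hbd, Matrix.one_apply]
  | add x y hx hy =>
    rw [map_add, map_add, Matrix.add_apply, ← hx, ← hy]
    simp [leg1, add_mul]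

theorem leg2_evalLeft {m n : ℕ} (I : MatRep (Uq p q) m) (J : MatRep (Uq p q) n)
    (z : Uq p q ⊗[ℂ] UqHalf p q) : leg2 (evalLeft J z) =
      evalLeft ((evalTensor I J).comp Algebra.TensorProduct.includeRight) z := by
  refine Matrix.ext fun ⟨a, b⟩ ⟨c, d⟩ => ?_
  induction z using TensorProduct.induction_on with
  | zero => simp [leg2]
  | tmul x y =>
    rw [leg2, Matrix.kroneckerMap_apply, evalLeft_tmul, evalLeft_tmul,
      scalarMatHom_mul_scalarHom_apply, scalarMatHom_mul_scalarHom_apply]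
    by_cases hac : a = c <;> simp [evalTensor, hac, Matrix.one_apply]
  | add x y hx hy =>
    rw [map_add, map_add, Matrix.add_apply, ← hx, ← hy]
    simp [leg2, mul_add]

theorem map_leg1 {A B : Type} [Ring A] [Ring B] {m n : ℕ} (φ : A →+* B)
    (M : Matrix (Fin m) (Fin m) A) : (leg1 (n := n) M).map φ = leg1 (M.map φ) := by
  refine Matrix.ext fun ⟨a, b⟩ ⟨c, d⟩ => ?_
  by_cases h : b = d <;> simp [leg1, h]

theorem map_leg2 {A B : Type} [Ring A] [Ring B] {m n : ℕ} (φ : A →+* B)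
    (M : Matrix (Fin n) (Fin n) A) : (leg2 (m := m) M).map φ = leg2 (M.map φ) := by
  refine Matrix.ext fun ⟨a, b⟩ ⟨c, d⟩ => ?_
  by_cases h : a = c <;> simp [leg2, h]

theorem map_fusionRHS {A : Type} [Ring A] [Algebra ℂ A]
    (φ : TensorAlgebra ℂ (Module.Dual ℂ (Uq p q)) →ₐ[ℂ] A) {m n : ℕ}
    (I : MatRep (Uq p q) m) (J : MatRep (Uq p q) n)
    (I' : MatRep (UqHalf p q) m) (J' : MatRep (UqHalf p q) n) :
    (fusionRHS r I J I' J').map φ = leg1 ((freeM I).map φ) *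
      scalarMat A (evalTensor I' J' (RMatrix' p q r)) * leg2 ((freeM J).map φ) *
        scalarMat A (evalTensor I' J' (RMatrix' p q r))⁻¹ := by
  have h : ∀ X Y : Matrix (Fin m × Fin n) (Fin m × Fin n)
      (TensorAlgebra ℂ (Module.Dual ℂ (Uq p q))), (X * Y).map φ = X.map φ * Y.map φ :=
    fun X Y => map_mul (AlgHom.mapMatrix φ) X Y
  have h1 : (leg1 (n := n) (freeM I)).map φ = leg1 ((freeM I).map φ) := map_leg1 φ.toRingHom _
  have h2 : (leg2 (m := m) (freeM J)).map φ = leg2 ((freeM J).map φ) := map_leg2 φ.toRingHom _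
  rw [fusionRHS, h, h, h, h1, h2, map_scalarMat, map_scalarMat]

theorem scalarMat_mul_inv {A : Type} [Ring A] [Algebra ℂ A] {R : Matrix ι ι ℂ} (h : IsUnit R) :
    scalarMat A R * scalarMat A R⁻¹ = 1 := by
  rw [← scalarMatHom_apply, ← scalarMatHom_apply, ← map_mul,
    Matrix.mul_nonsing_inv _ ((Matrix.isUnit_iff_isUnit_det _).mp h), map_one]

theorem scalarMat_inv_mul {A : Type} [Ring A] [Algebra ℂ A] {R : Matrix ι ι ℂ} (h : IsUnit R) :
    scalarMat A R⁻¹ * scalarMat A R = 1 := by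
  rw [← scalarMatHom_apply, ← scalarMatHom_apply, ← map_mul,
    Matrix.nonsing_inv_mul _ ((Matrix.isUnit_iff_isUnit_det _).mp h), map_one]

/-- Three commuting copies of the extended quantum group act: `j₁` and `j₂` through the liftings in
the two matrix factors, `j₃` in the coefficients. In terms of them the claim is `fusion_identity`.
The liftings are needed because `R'` contains `k` in both factors. -/
theorem slice_fusion (hp : 2 ≤ p) (hq : IsPrimitiveRoot q (2 * p)) (hr : r ^ 2 = q) {m n : ℕ}
    (I : MatRep (Uq p q) m) (J : MatRep (Uq p q) n)
    (I' : MatRep (UqHalf p q) m) (J' : MatRep (UqHalf p q) n)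
    (hI' : IsLifting I' I) (hJ' : IsLifting J' J) :
    evalLeft (tensorRep hp hq I J) (doubleR p q r) *
        scalarMat (UqHalf p q) (evalTensor I' J' (RMatrix' p q r)) =
      leg1 (evalLeft I (doubleR p q r)) *
        scalarMat (UqHalf p q) (evalTensor I' J' (RMatrix' p q r)) *
          leg2 (evalLeft J (doubleR p q r)) := by
  set ε : UqHalf p q ⊗[ℂ] UqHalf p q →ₐ[ℂ] Matrix (Fin m × Fin n) (Fin m × Fin n) (UqHalf p q) :=
    (scalarMatHom _ (UqHalf p q)).comp (evalTensor I' J') with hε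
  set j₁ : UqHalf p q →ₐ[ℂ] Matrix (Fin m × Fin n) (Fin m × Fin n) (UqHalf p q) :=
    ε.comp Algebra.TensorProduct.includeLeft with hj₁
  set j₂ : UqHalf p q →ₐ[ℂ] Matrix (Fin m × Fin n) (Fin m × Fin n) (UqHalf p q) :=
    ε.comp Algebra.TensorProduct.includeRight with hj₂
  set j₃ : UqHalf p q →ₐ[ℂ] Matrix (Fin m × Fin n) (Fin m × Fin n) (UqHalf p q) := scalarHom _ (UqHalf p q) with hj₃
  have c12 : ∀ x y, Commute (j₁ x) (j₂ y) := fun x y =>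
    (show Commute (x ⊗ₜ[ℂ] (1 : UqHalf p q)) ((1 : UqHalf p q) ⊗ₜ[ℂ] y) by simp [Commute, SemiconjBy]).map ε
  have c13 : ∀ x y, Commute (j₁ x) (j₃ y) := fun x y => commute_scalarMatHom _ _
  have c23 : ∀ x y, Commute (j₂ x) (j₃ y) := fun x y => commute_scalarMatHom _ _
  have h := halfTriple_gen p q
  have h1 := h.map j₁
  have h2 := h.map j₂
  have h3 := h.map j₃
  have comm : ∀ {j j' : UqHalf p q →ₐ[ℂ] Matrix (Fin m × Fin n) (Fin m × Fin n) (UqHalf p q)},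
      (∀ x y, Commute (j x) (j' y)) → CommTriples (j (UqHalf.E p q)) (j (UqHalf.F p q))
        (j (UqHalf.k p q)) (j' (UqHalf.E p q)) (j' (UqHalf.F p q)) (j' (UqHalf.k p q)) :=
    fun hc => ⟨hc _ _, hc _ _, hc _ _, hc _ _, hc _ _, hc _ _, hc _ _, hc _ _, hc _ _⟩
  have hR : scalarMat (UqHalf p q) (evalTensor I' J' (RMatrix' p q r)) = rElt p q r (j₂ (UqHalf.E p q))
      (j₂ (UqHalf.k p q)) (j₁ (UqHalf.F p q)) (j₁ (UqHalf.k p q)) := by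
    rw [RMatrix'_eq_rElt]
    exact map_rElt ε _ _ _ _
  have gE : toHalf p q (Uq.E p q) = UqHalf.E p q := Uq.lift_gen _ _ _ _ _ _ _ _ _ _
  have gF : toHalf p q (Uq.F p q) = UqHalf.F p q := Uq.lift_gen _ _ _ _ _ _ _ _ _ _
  have gK : toHalf p q (Uq.K p q) = UqHalf.k p q ^ 2 := Uq.lift_gen _ _ _ _ _ _ _ _ _ _
  have hI : ∀ x, I x = I' (toHalf p q x) := fun x => by rw [← hI']; rfl
  have hJ : ∀ x, J x = J' (toHalf p q x) := fun x => by rw [← hJ']; rfl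
  have hten : ∀ x y : Uq p q, scalarMatHom _ (UqHalf p q) (evalTensor I J (x ⊗ₜ y)) =
      j₁ (toHalf p q x) * j₂ (toHalf p q y) := by
    intro x y
    have : evalTensor I J (x ⊗ₜ y) = evalTensor I' J' (toHalf p q x ⊗ₜ toHalf p q y) := by
      simp [evalTensor, hI, hJ]
    rw [this]
    change ε _ = ε (toHalf p q x ⊗ₜ 1) * ε (1 ⊗ₜ toHalf p q y)
    rw [← map_mul, Algebra.TensorProduct.tmul_mul_tmul, mul_one, one_mul]
  have hleg1 : leg1 (evalLeft I (doubleR p q r)) = xElt p q r (j₁ (UqHalf.E p q))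
      (j₁ (UqHalf.F p q)) (j₁ (UqHalf.k p q) ^ 2) (j₃ (UqHalf.E p q)) (j₃ (UqHalf.F p q))
      (j₃ (UqHalf.k p q)) := by
    rw [leg1_evalLeft I J, evalLeft_doubleR]
    simp [hten, gE, gF, gK, hj₃]
  have hleg2 : leg2 (evalLeft J (doubleR p q r)) = xElt p q r (j₂ (UqHalf.E p q))
      (j₂ (UqHalf.F p q)) (j₂ (UqHalf.k p q) ^ 2) (j₃ (UqHalf.E p q)) (j₃ (UqHalf.F p q))
      (j₃ (UqHalf.k p q)) := by
    rw [leg2_evalLeft I J, evalLeft_doubleR]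
    simp [hten, gE, gF, gK, hj₃]
  have hΔE : Uq.comul hp hq (Uq.E p q) = 1 ⊗ₜ Uq.E p q + Uq.E p q ⊗ₜ Uq.K p q :=
    Uq.lift_gen _ _ _ _ _ _ _ _ _ _
  have hΔF : Uq.comul hp hq (Uq.F p q) = Uq.F p q ⊗ₜ 1 + Uq.Kinv p q ⊗ₜ Uq.F p q :=
    Uq.lift_gen _ _ _ _ _ _ _ _ _ _
  have hΔK : Uq.comul hp hq (Uq.K p q) = Uq.K p q ⊗ₜ Uq.K p q :=
    Uq.lift_gen _ _ _ _ _ _ _ _ _ _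
  have hT : evalLeft (tensorRep hp hq I J) (doubleR p q r) =
      xElt p q r (j₂ (UqHalf.E p q) + j₁ (UqHalf.E p q) * j₂ (UqHalf.k p q) ^ 2)
        (j₁ (UqHalf.F p q) + j₁ (UqHalf.k p q) ^ (4 * p - 2) * j₂ (UqHalf.F p q))
        ((j₁ (UqHalf.k p q) * j₂ (UqHalf.k p q)) ^ 2) (j₃ (UqHalf.E p q)) (j₃ (UqHalf.F p q))
        (j₃ (UqHalf.k p q)) := by
    rw [evalLeft_doubleR]
    have hE : scalarMatHom _ (UqHalf p q) (tensorRep hp hq I J (Uq.E p q)) =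
        j₂ (UqHalf.E p q) + j₁ (UqHalf.E p q) * j₂ (UqHalf.k p q) ^ 2 := by
      rw [tensorRep, AlgHom.comp_apply, hΔE, map_add, map_add, hten, hten]
      simp [gE, gK]
    have hF : scalarMatHom _ (UqHalf p q) (tensorRep hp hq I J (Uq.F p q)) =
        j₁ (UqHalf.F p q) + j₁ (UqHalf.k p q) ^ (4 * p - 2) * j₂ (UqHalf.F p q) := by
      rw [tensorRep, AlgHom.comp_apply, hΔF, map_add, map_add, hten, hten]
      simp [gF, gK, ← pow_mul, show 2 * (2 * p - 1) = 4 * p - 2 by omega]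
    have hK : scalarMatHom _ (UqHalf p q) (tensorRep hp hq I J (Uq.K p q)) =
        (j₁ (UqHalf.k p q) * j₂ (UqHalf.k p q)) ^ 2 := by
      rw [tensorRep, AlgHom.comp_apply, hΔK, hten, (c12 _ _).mul_pow]
      simp [gK]
    rw [hE, hF, hK]
  rw [hT, hleg1, hleg2, hR]
  have q12 := comm c12
  have q13 := comm c13
  have q23 := comm c23
  have cΔ : CommTriples (j₂ (UqHalf.E p q) + j₁ (UqHalf.E p q) * j₂ (UqHalf.k p q) ^ 2)
      (j₁ (UqHalf.F p q) + j₁ (UqHalf.k p q) ^ (4 * p - 2) * j₂ (UqHalf.F p q))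
      (j₁ (UqHalf.k p q) * j₂ (UqHalf.k p q)) (j₃ (UqHalf.E p q)) (j₃ (UqHalf.F p q))
      (j₃ (UqHalf.k p q)) := by
    have a1 : ∀ y, Commute (j₂ (UqHalf.E p q) + j₁ (UqHalf.E p q) * j₂ (UqHalf.k p q) ^ 2)
        (j₃ y) := fun y => (c23 _ _).add_left ((c13 _ _).mul_left ((c23 _ _).pow_left 2))
    have a2 : ∀ y, Commute
        (j₁ (UqHalf.F p q) + j₁ (UqHalf.k p q) ^ (4 * p - 2) * j₂ (UqHalf.F p q)) (j₃ y) :=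
      fun y => (c13 _ _).add_left (((c13 _ _).pow_left _).mul_left (c23 _ _))
    have a3 : ∀ y, Commute (j₁ (UqHalf.k p q) * j₂ (UqHalf.k p q)) (j₃ y) :=
      fun y => (c13 _ _).mul_left (c23 _ _)
    exact ⟨a1 _, a1 _, a1 _, a2 _, a2 _, a2 _, a3 _, a3 _, a3 _⟩
  have hkΔ : (j₁ (UqHalf.k p q) * j₂ (UqHalf.k p q)) ^ (4 * p) = 1 := by
    rw [(c12 _ _).mul_pow, h1.k_pow, h2.k_pow, mul_one]
  have hkE : j₁ (UqHalf.k p q) * j₂ (UqHalf.k p q) *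
      (j₂ (UqHalf.E p q) + j₁ (UqHalf.E p q) * j₂ (UqHalf.k p q) ^ 2) =
      q • ((j₂ (UqHalf.E p q) + j₁ (UqHalf.E p q) * j₂ (UqHalf.k p q) ^ 2) *
        (j₁ (UqHalf.k p q) * j₂ (UqHalf.k p q))) := by
    have b1 : j₁ (UqHalf.k p q) * j₂ (UqHalf.k p q) * j₂ (UqHalf.E p q) =
        q • (j₂ (UqHalf.E p q) * (j₁ (UqHalf.k p q) * j₂ (UqHalf.k p q))) := by
      rw [mul_assoc, h2.k_E, mul_smul_comm, ← mul_assoc, q12.k_E.eq, mul_assoc]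
    have b2 : j₁ (UqHalf.k p q) * j₂ (UqHalf.k p q) * j₁ (UqHalf.E p q) =
        q • (j₁ (UqHalf.E p q) * (j₁ (UqHalf.k p q) * j₂ (UqHalf.k p q))) := by
      rw [mul_assoc, ← q12.E_k.eq, ← mul_assoc, h1.k_E, smul_mul_assoc, mul_assoc]
    have b3 : Commute (j₁ (UqHalf.k p q) * j₂ (UqHalf.k p q)) (j₂ (UqHalf.k p q) ^ 2) :=
      (q12.k_k.mul_left (Commute.refl _)).pow_right 2
    rw [mul_add, add_mul, smul_add, b1, ← mul_assoc _ (j₁ (UqHalf.E p q)), b2, smul_mul_assoc,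
      mul_assoc (j₁ (UqHalf.E p q)), b3.eq, mul_assoc]
  -- Each `R R'` is split again into two `R`-matrices. For the tensor product the square root of
  -- `Δ(K)` is `k₁ k₂`.
  rw [← rElt_mul_rElt hp hq hr hkΔ hkE h3 cΔ, ← rElt_mul_rElt hp hq hr h1.k_pow h1.k_E h3 q13,
    ← rElt_mul_rElt hp hq hr h2.k_pow h2.k_E h3 q23]
  exact fusion_identity hp hq hr h1 h2 h3 q12 q13 q23

/-- The algebra morphism `M ↦ (id ⊗ ρ)(R R')` from the loop algebra to the extended quantum
group. -/
def toUqHalf (hp : 2 ≤ p) (hq : IsPrimitiveRoot q (2 * p)) (hr : r ^ 2 = q) :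
    L01 hp hq r →ₐ[ℂ] UqHalf p q :=
  RingQuot.liftAlgHom ℂ ⟨TensorAlgebra.lift ℂ (slice p q r), by
    intro x y h
    induction h with
    | unit => rw [TensorAlgebra.lift_ι_apply, slice_counit hp hq hr, map_one]
    | fusion I J I' J' hI hJ hI' hJ' x y =>
      have hu := isUnit_evalTensor_RMatrix' (r := r) hp hq hr I' J'
      have h1 := slice_fusion hp hq hr I J I' J' hI' hJ'
      have h2 : (freeM (tensorRep hp hq I J)).map (TensorAlgebra.lift ℂ (slice p q r)) =
          (fusionRHS r I J I' J').map (TensorAlgebra.lift ℂ (slice p q r)) := by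
        rw [map_fusionRHS, lift_slice_freeM, lift_slice_freeM, lift_slice_freeM, ← h1, mul_assoc,
          scalarMat_mul_inv hu, mul_one]
      exact congrFun (congrFun h2 x) y⟩

theorem toUqHalf_mk (hp : 2 ≤ p) (hq : IsPrimitiveRoot q (2 * p)) (hr : r ^ 2 = q)
    (x : TensorAlgebra ℂ (Module.Dual ℂ (Uq p q))) :
    toUqHalf hp hq hr (L01.mk hp hq r x) = TensorAlgebra.lift ℂ (slice p q r) x :=
  RingQuot.liftAlgHom_mkAlgHom_apply ℂ _ _ _

theorem map_toUqHalf_loopM (hp : 2 ≤ p) (hq : IsPrimitiveRoot q (2 * p)) (hr : r ^ 2 = q) {n : ℕ}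
    (I : MatRep (Uq p q) n) : (loopM hp hq r I).map (toUqHalf hp hq hr) =
      evalLeft I (doubleR p q r) := by
  rw [← lift_slice_freeM, loopM, Matrix.map_map]
  congr 1
  funext x
  exact toUqHalf_mk hp hq hr x

end

end LoopAlgebra

end

noncomputable section

namespace LoopAlgebra

/-! ### The image of the generators -/

section

variable {p : ℕ} {q r : ℂ}

theorem sum_smul_weightProj {A : Type*} [Ring A] [Algebra ℂ A] (hp : 2 ≤ p)
    (hr : IsPrimitiveRoot r (4 * p)) {k : A} (hk : k ^ (4 * p) = 1) (j : ℕ) :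
    ∑ n ∈ Finset.range (4 * p), r ^ (n * j) • weightProj p r k n = k ^ j := by
  rw [← mul_one (k ^ j), ← sum_weightProj hp hr k, Finset.mul_sum]
  exact Finset.sum_congr rfl fun n _ => (pow_mul_weightProj hp hr hk n j).symm

theorem qExp_of_sq_eq_zero (hp : 2 ≤ p) (hq : IsPrimitiveRoot q (2 * p)) {A : Type*} [Ring A]
    [Algebra ℂ A] {x : A} (h : x ^ 2 = 0) : qExp p q x = 1 + (q - q⁻¹) • x := by
  obtain ⟨n, hn⟩ : ∃ n, p = n + 2 := ⟨p - 2, by omega⟩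
  rw [qExp, ← rCoeff_one hp hq, hn, Finset.sum_range_succ', Finset.sum_range_succ',
    Finset.sum_eq_zero fun m _ => ?_]
  · simp [rCoeff_zero, add_comm]
  · rw [pow_eq_zero_of_le (by omega) h, smul_zero]

theorem scalarMatHom_mul_scalarHom_fin_two {A : Type} [Ring A] [Algebra ℂ A] (w x y z : ℂ) (a : A) :
    scalarMatHom (Fin 2) A !![w, x; y, z] * scalarHom (Fin 2) A a =
      !![w • a, x • a; y • a, z • a] := by
  ext i j
  rw [scalarMatHom_mul_scalarHom_apply]
  fin_cases i <;> fin_cases j <;> rfl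

theorem r_pow_mul_eq (hp : 2 ≤ p) (hq : IsPrimitiveRoot q (2 * p)) (hr : r ^ 2 = q) (n : ℕ) :
    r ^ (n * (4 * p - 2)) = q⁻¹ ^ n := by
  have hq0 := Uq.q_ne_zero hp hq
  have h : r ^ (4 * p - 2) = q⁻¹ := by
    apply mul_left_cancel₀ hq0
    rw [mul_inv_cancel₀ hq0, ← hr, ← pow_add, show 2 + (4 * p - 2) = 4 * p by omega,
      (isPrimitiveRoot_sqrt hp hq hr).pow_eq_one]
  rw [mul_comm, pow_mul, h]

/-- The Cartan part evaluates to the diagonal matrix with entries `K, K⁻¹`, and both exponentials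
stop at first order because `E` and `F` square to zero in this representation. -/
theorem evalLeft_X2 (hp : 2 ≤ p) (hq : IsPrimitiveRoot q (2 * p)) (hr : r ^ 2 = q) :
    evalLeft (X2 hp hq) (doubleR p q r) =
      !![UqHalf.k p q ^ 2 + (q⁻¹ * (q - q⁻¹) ^ 2) • (UqHalf.F p q * UqHalf.E p q),
        (q⁻¹ * (q - q⁻¹)) • UqHalf.F p q;
        (q - q⁻¹) • (UqHalf.k p q ^ (4 * p - 2) * UqHalf.E p q), UqHalf.k p q ^ (4 * p - 2)] := by
  have hr' := isPrimitiveRoot_sqrt hp hq hr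
  have hE : X2 hp hq (Uq.E p q) = !![0, 1; 0, 0] := Uq.lift_gen _ _ _ _ _ _ _ _ _ _
  have hF : X2 hp hq (Uq.F p q) = !![0, 0; 1, 0] := Uq.lift_gen _ _ _ _ _ _ _ _ _ _
  have hK : X2 hp hq (Uq.K p q) = !![q, 0; 0, q⁻¹] := Uq.lift_gen _ _ _ _ _ _ _ _ _ _
  have h := halfTriple_gen p q
  have hC : cartan p r (scalarMatHom (Fin 2) (UqHalf p q) !![q, 0; 0, q⁻¹])
      (scalarHom (Fin 2) _ (UqHalf.k p q)) =
        !![UqHalf.k p q ^ 2, 0; 0, UqHalf.k p q ^ (4 * p - 2)] := by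
    simp only [cartan, ← map_weightProj, ← map_pow, diag_two_pow,
      scalarMatHom_mul_scalarHom_fin_two, zero_smul]
    ext i j
    rw [Matrix.sum_apply]
    fin_cases i <;> fin_cases j
    · simpa [← hr, ← pow_mul, mul_comm] using sum_smul_weightProj hp hr' h.k_pow 2
    · simp
    · simp
    · simpa [r_pow_mul_eq hp hq hr] using sum_smul_weightProj hp hr' h.k_pow (4 * p - 2)
  have hX : scalarMatHom (Fin 2) (UqHalf p q) !![0, 1; 0, 0] *
      scalarMatHom (Fin 2) (UqHalf p q) !![q, 0; 0, q⁻¹] *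
        (scalarHom (Fin 2) _ (UqHalf.k p q) ^ (4 * p - 2) *
          scalarHom (Fin 2) _ (UqHalf.F p q)) =
      !![0, q⁻¹ • (UqHalf.k p q ^ (4 * p - 2) * UqHalf.F p q); 0, 0] := by
    have h1 : !![(0 : ℂ), 1; 0, 0] * !![q, 0; 0, q⁻¹] = !![0, q⁻¹; 0, 0] := by
      rw [Matrix.mul_fin_two]; simp
    rw [← map_pow, ← map_mul (scalarMatHom _ _), ← map_mul (scalarHom _ _), h1,
      scalarMatHom_mul_scalarHom_fin_two]
    simp
  have hY : scalarMatHom (Fin 2) (UqHalf p q) !![0, 0; 1, 0] *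
      scalarHom (Fin 2) _ (UqHalf.E p q) = !![0, 0; UqHalf.E p q, 0] := by
    rw [scalarMatHom_mul_scalarHom_fin_two]
    simp
  have hKL : UqHalf.k p q ^ 2 * (UqHalf.k p q ^ (4 * p - 2) * UqHalf.F p q) = UqHalf.F p q := by
    rw [← mul_assoc, h.K_Kinv hp, one_mul]
  rw [evalLeft_doubleR, hE, hF, hK, xElt, hC, hX, hY,
    qExp_of_sq_eq_zero hp hq (by rw [pow_two, Matrix.mul_fin_two]; simp [← Matrix.ext_iff, Fin.forall_fin_two]),
    qExp_of_sq_eq_zero hp hq (by rw [pow_two, Matrix.mul_fin_two]; simp [← Matrix.ext_iff, Fin.forall_fin_two])]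
  simp only [Matrix.one_fin_two, Matrix.smul_of, Matrix.smul_cons, Matrix.smul_empty, smul_zero,
    smul_smul, Matrix.of_add_of, Matrix.add_cons, Matrix.head_cons, Matrix.tail_cons,
    Matrix.empty_add_empty, add_zero, zero_add, Matrix.mul_fin_two, mul_zero, zero_mul, mul_one,
    mul_smul_comm, hKL, smul_mul_assoc]
  rw [show (q - q⁻¹) * q⁻¹ = q⁻¹ * (q - q⁻¹) by ring, show (q - q⁻¹) * (q⁻¹ * (q - q⁻¹)) =
    q⁻¹ * (q - q⁻¹) ^ 2 by ring]

/-- The exchange relations for the matrix `M` of the fundamental representation. -/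
theorem exchangeRelations_of_triple (hq0 : q ≠ 0) (h0 : q - q⁻¹ ≠ 0) {A : Type} [Ring A]
    [Algebra ℂ A] {E F K L : A} (hKL : K * L = 1) (hLK : L * K = 1)
    (hKF : K * F = q⁻¹ ^ 2 • (F * K)) (hKE : K * E = q ^ 2 • (E * K))
    (hLF : L * F = q ^ 2 • (F * L)) (hLE : L * E = q⁻¹ ^ 2 • (E * L))
    (hEF : E * F = F * E + (q - q⁻¹)⁻¹ • (K - L)) :
    ExchangeRelations q (K + (q⁻¹ * (q - q⁻¹) ^ 2) • (F * E)) ((q⁻¹ * (q - q⁻¹)) • F)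
        ((q - q⁻¹) • (L * E)) L ∧
      (K + (q⁻¹ * (q - q⁻¹) ^ 2) • (F * E)) * L -
        q ^ 2 • ((q⁻¹ * (q - q⁻¹)) • F * (q - q⁻¹) • (L * E)) = 1 := by
  have hKE' : ∀ x, K * (E * x) = q ^ 2 • (E * (K * x)) := fun x => by
    rw [← mul_assoc, hKE, smul_mul_assoc, mul_assoc]
  have hLF' : ∀ x, L * (F * x) = q ^ 2 • (F * (L * x)) := fun x => by
    rw [← mul_assoc, hLF, smul_mul_assoc, mul_assoc]
  have hLE' : ∀ x, L * (E * x) = q⁻¹ ^ 2 • (E * (L * x)) := fun x => by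
    rw [← mul_assoc, hLE, smul_mul_assoc, mul_assoc]
  have hEF' : ∀ x, E * (F * x) = F * (E * x) + (q - q⁻¹)⁻¹ • (K * x - L * x) := fun x => by
    rw [← mul_assoc, hEF, add_mul, smul_mul_assoc, sub_mul, mul_assoc]
  have h0' : q ^ 2 - 1 ≠ 0 := by
    intro h'
    apply h0
    field_simp
    rw [h', mul_zero]
  refine ⟨⟨?_, ?_, ?_, ?_, ?_, ?_⟩, ?_⟩
  -- All products are brought to the order `F, E, K, L`; then the coefficients are compared.
  all_goals
    simp only [mul_add, add_mul, mul_sub, sub_mul, smul_mul_assoc, mul_smul_comm, mul_assoc, hKF,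
      hKE', hLF, hLF', hLE, hLE', hEF, hEF', hKL, hLK, smul_add, smul_sub, smul_smul, pow_two L,
      mul_one]
    try match_scalars
    all_goals
      field_simp
      try ring

end

end LoopAlgebra

end

noncomputable section

namespace LoopAlgebra

/-! ### The algebra defined by the presentation -/

/-- The relations of the presentation, for four elements of an algebra. -/
structure LoopRelations (p : ℕ) (q : ℂ) {A : Type} [Ring A] [Algebra ℂ A] (a b c d : A) :
    Prop where
  exchange : ExchangeRelations q a b c d
  det : a * d - q ^ 2 • (b * c) = 1
  b_pow : b ^ p = 0
  c_pow : c ^ p = 0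
  d_pow : d ^ (2 * p) = 1

section

variable {p : ℕ} {q r : ℂ} {A : Type} [Ring A] [Algebra ℂ A] {a b c d : A}

/-- As `d` is invertible, the determinant relation expresses `a` by `b, c, d`. Substituting `ad = 1
+ q²bc` in the relation for `cb` gives `cb = q²bc + q⁻¹(q - q⁻¹)(1 - d²)`, a relation of the type
that `adjoin_le_monomialSpan` orders. -/
theorem LoopRelations.mem_span (hp : 2 ≤ p) (hq0 : q ≠ 0) (h : LoopRelations p q a b c d) {y : A}
    (hy : y ∈ Algebra.adjoin ℂ {a, b, c, d}) :
    y ∈ Submodule.span ℂ (Set.range fun x : Fin p × Fin p × Fin (2 * p) =>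
      b ^ (x.1 : ℕ) * c ^ (x.2.1 : ℕ) * d ^ (x.2.2 : ℕ)) := by
  have hd : d * d ^ (2 * p - 1) = 1 := by
    rw [← pow_succ', Nat.sub_add_cancel (by omega), h.d_pow]
  have had : a * d = 1 + q ^ 2 • (b * c) := by rw [← h.det]; abel
  have ha : a = (1 + q ^ 2 • (b * c)) * d ^ (2 * p - 1) := by
    rw [← had, mul_assoc, hd, mul_one]
  rw [← monomialSpan_eq_finite hp h.b_pow h.c_pow h.d_pow]
  refine adjoin_le_monomialSpan (α := q ^ 2) (w := (q⁻¹ * (q - q⁻¹)) • (1 - d ^ 2)) h.exchange.d_b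
    h.exchange.d_c ?_ ?_ ?_
  · rw [h.exchange.c_b, h.exchange.d_a, had, add_sub_right_comm, smul_add, smul_smul,
      add_comm (_ • (1 - d ^ 2)), ← add_assoc]
    congr 1
    have : q ^ 2 = 1 + q⁻¹ * (q - q⁻¹) * q ^ 2 := by field_simp; ring
    conv_rhs => rw [this, add_smul, one_smul]
  · have hk : d ∈ Algebra.adjoin ℂ {d} := Algebra.self_mem_adjoin_singleton ℂ _
    exact Subalgebra.smul_mem _ (Subalgebra.sub_mem _ (Subalgebra.one_mem _)
      (Subalgebra.pow_mem _ hk _)) _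
  · refine Algebra.adjoin_le ?_ hy
    have hb : b ∈ Algebra.adjoin ℂ {b, c, d} := Algebra.subset_adjoin (by simp)
    have hc : c ∈ Algebra.adjoin ℂ {b, c, d} := Algebra.subset_adjoin (by simp)
    have hd' : d ∈ Algebra.adjoin ℂ {b, c, d} := Algebra.subset_adjoin (by simp)
    rintro s (rfl | rfl | rfl | rfl)
    · rw [ha]
      exact Subalgebra.mul_mem _ (Subalgebra.add_mem _ (Subalgebra.one_mem _)
        (Subalgebra.smul_mem _ (Subalgebra.mul_mem _ hb hc) _)) (Subalgebra.pow_mem _ hd' _)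
    · exact hb
    · exact hc
    · exact hd'

/-- The images of the generators of the presentation. -/
def presMap {B : Type} (a b c d : B) : PresGen → B
  | PresGen.a => a
  | PresGen.b => b
  | PresGen.c => c
  | PresGen.d => d

/-- Algebra morphisms out of the algebra defined by the presentation. -/
def LoopRelations.lift (h : LoopRelations p q a b c d) : PresAlg p q →ₐ[ℂ] A :=
  RingQuot.liftAlgHom ℂ ⟨FreeAlgebra.lift ℂ (presMap a b c d), by
    intro x y hxy
    cases hxy
    · simpa [presMap] using h.exchange.d_a
    · simpa [presMap] using h.exchange.d_b
    · simpa [presMap] using h.exchange.d_c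
    · simpa [presMap] using h.exchange.b_a
    · simpa [presMap] using h.exchange.c_b
    · simpa [presMap] using h.exchange.c_a
    · simpa [presMap] using h.det
    · simpa [presMap] using h.b_pow
    · simpa [presMap] using h.c_pow
    · simpa [presMap] using h.d_pow⟩

theorem LoopRelations.lift_gen (h : LoopRelations p q a b c d) (g : PresGen) :
    h.lift (PresAlg.gen p q g) = presMap a b c d g :=
  (RingQuot.liftAlgHom_mkAlgHom_apply ℂ _ _ _).trans (FreeAlgebra.lift_ι_apply _ _)

/-- The quotient map onto the algebra defined by the presentation. -/
def PresAlg.mk (p : ℕ) (q : ℂ) : FreeAlgebra ℂ PresGen →ₐ[ℂ] PresAlg p q :=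
  RingQuot.mkAlgHom ℂ (PresRel p q)

theorem PresAlg.relations (p : ℕ) (q : ℂ) : LoopRelations p q (PresAlg.gen p q PresGen.a)
    (PresAlg.gen p q PresGen.b) (PresAlg.gen p q PresGen.c) (PresAlg.gen p q PresGen.d) := by
  have hr : ∀ {x y}, PresRel p q x y → PresAlg.mk p q x = PresAlg.mk p q y :=
    fun h => RingQuot.mkAlgHom_rel ℂ h
  have hg : ∀ g, PresAlg.mk p q (PresGen.x g) = PresAlg.gen p q g := fun _ => rfl
  refine ⟨⟨?_, ?_, ?_, ?_, ?_, ?_⟩, ?_, ?_, ?_, ?_⟩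
  · simpa only [map_mul, hg] using hr PresRel.d_a
  · simpa only [map_mul, map_smul, hg] using hr PresRel.d_b
  · simpa only [map_mul, map_smul, hg] using hr PresRel.d_c
  · simpa only [map_mul, map_smul, map_add, hg] using hr PresRel.b_a
  · simpa only [map_mul, map_smul, map_add, map_sub, map_pow, hg] using hr PresRel.c_b
  · simpa only [map_mul, map_smul, map_sub, hg] using hr PresRel.c_a
  · simpa only [map_mul, map_smul, map_sub, map_one, hg] using hr PresRel.det
  · simpa only [map_pow, map_zero, hg] using hr PresRel.b_pow
  · simpa only [map_pow, map_zero, hg] using hr PresRel.c_pow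
  · simpa only [map_pow, map_one, hg] using hr PresRel.d_pow

theorem PresAlg.adjoin_eq_top (p : ℕ) (q : ℂ) :
    Algebra.adjoin ℂ {PresAlg.gen p q PresGen.a, PresAlg.gen p q PresGen.b,
      PresAlg.gen p q PresGen.c, PresAlg.gen p q PresGen.d} = ⊤ := by
  have h1 : Function.Surjective (PresAlg.mk p q) := RingQuot.mkAlgHom_surjective ℂ _
  rw [eq_top_iff, ← (AlgHom.range_eq_top (PresAlg.mk p q)).mpr h1, ← Algebra.map_top,
    ← FreeAlgebra.adjoin_range_ι, AlgHom.map_adjoin]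
  refine Algebra.adjoin_mono ?_
  rintro _ ⟨_, ⟨g, rfl⟩, rfl⟩
  cases g
  · exact Or.inl rfl
  · exact Or.inr (Or.inl rfl)
  · exact Or.inr (Or.inr (Or.inl rfl))
  · exact Or.inr (Or.inr (Or.inr rfl))

theorem PresAlg.span_monomials (hp : 2 ≤ p) (hq0 : q ≠ 0) :
    Submodule.span ℂ (Set.range fun x : Fin p × Fin p × Fin (2 * p) =>
      PresAlg.gen p q PresGen.b ^ (x.1 : ℕ) * PresAlg.gen p q PresGen.c ^ (x.2.1 : ℕ) *
        PresAlg.gen p q PresGen.d ^ (x.2.2 : ℕ)) = ⊤ := by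
  rw [eq_top_iff]
  intro y _
  exact (PresAlg.relations p q).mem_span hp hq0 (by rw [PresAlg.adjoin_eq_top]; trivial)

/-- The relations of the presentation in the extended quantum group. -/
theorem loopRelations_uqHalf (hp : 2 ≤ p) (hq : IsPrimitiveRoot q (2 * p)) :
    LoopRelations p q
      (UqHalf.k p q ^ 2 + (q⁻¹ * (q - q⁻¹) ^ 2) • (UqHalf.F p q * UqHalf.E p q))
      ((q⁻¹ * (q - q⁻¹)) • UqHalf.F p q)
      ((q - q⁻¹) • (UqHalf.k p q ^ (4 * p - 2) * UqHalf.E p q)) (UqHalf.k p q ^ (4 * p - 2)) := by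
  have h := halfTriple_gen p q
  obtain ⟨h1, h2⟩ := exchangeRelations_of_triple (Uq.q_ne_zero hp hq) (Uq.q_sub_inv_ne_zero hp hq)
    (h.K_Kinv hp) (h.Kinv_K hp) h.K_F h.K_E (h.Kinv_F hp hq) (h.Kinv_E hp hq) h.E_F
  refine ⟨h1, h2, ?_, ?_, ?_⟩
  · rw [smul_pow, h.F_pow, smul_zero]
  · have hc : ∀ n, ∃ t : ℂ, (UqHalf.k p q ^ (4 * p - 2) * UqHalf.E p q) ^ n =
        t • (UqHalf.E p q ^ n * (UqHalf.k p q ^ (4 * p - 2)) ^ n) := by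
      intro n
      induction n with
      | zero => exact ⟨1, by simp⟩
      | succ n ih =>
        obtain ⟨t, ht⟩ := ih
        have h3 := pow_mul_skew (h.Kinv_E hp hq) n
        refine ⟨t * q⁻¹ ^ 2 * (q⁻¹ ^ 2) ^ n, ?_⟩
        rw [pow_succ, ht, h.Kinv_E hp hq, smul_mul_smul_comm, mul_assoc (UqHalf.E p q ^ n),
          ← mul_assoc _ (UqHalf.E p q), h3, smul_mul_assoc, mul_smul_comm, smul_smul,
          mul_assoc (UqHalf.E p q), ← pow_succ, ← mul_assoc, ← pow_succ]
    obtain ⟨t, ht⟩ := hc p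
    rw [smul_pow, ht, h.E_pow, zero_mul, smul_zero, smul_zero]
  · rw [← pow_mul, show (4 * p - 2) * (2 * p) = 4 * p * (2 * p - 1) by
      obtain ⟨n, rfl⟩ : ∃ n, p = n + 1 := ⟨p - 1, by omega⟩
      rw [show 4 * (n + 1) - 2 = 4 * n + 2 by omega, show 2 * (n + 1) - 1 = 2 * n + 1 by omega]
      ring, pow_mul, h.k_pow, one_pow]

end

end LoopAlgebra

end

noncomputable section

namespace LoopAlgebra

/-! ### The reflection equation -/

section

variable {p : ℕ} {q r : ℂ}

/-- For a scalar `k` these are the spectral decompositions of `k` and of `k ^ (4p - 1) = k⁻¹`. They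
give the diagonal entries of `R` on the fundamental representation. -/
theorem cartan_smul_one (hp : 2 ≤ p) (hr : IsPrimitiveRoot r (4 * p)) {k : ℂ}
    (hk : k ^ (4 * p) = 1) : cartan p r r k = k ∧ cartan p r r⁻¹ k = k⁻¹ := by
  have h0 : r ≠ 0 := hr.ne_zero (by omega)
  have hk0 : k ≠ 0 := by rintro rfl; rw [zero_pow (by omega)] at hk; exact zero_ne_one hk
  have h1 : ∀ {z : ℂ}, z ^ (4 * p) = 1 → z ^ (4 * p - 1) = z⁻¹ := fun {z} hz =>
    eq_inv_of_mul_eq_one_left (by rw [← pow_succ, Nat.sub_add_cancel (by omega), hz])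
  constructor
  · simpa [cartan] using sum_smul_weightProj hp hr hk 1
  · rw [← h1 hk, ← sum_smul_weightProj hp hr hk (4 * p - 1)]
    simp only [cartan, smul_eq_mul, ← h1 hr.pow_eq_one, ← pow_mul, mul_comm]

/-- The value of the universal `R`-matrix on two copies of the fundamental representation has
off-diagonal entry `r⁻¹ (q - q⁻¹)` at `(s, t)`. -/
def fundamentalR (q r : ℂ) (s t : Fin 2 × Fin 2) : Matrix (Fin 2 × Fin 2) (Fin 2 × Fin 2) ℂ :=
  Matrix.of fun i j => if i = j then (if i.1 = i.2 then r else r⁻¹) else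
    if i = s ∧ j = t then r⁻¹ * (q - q⁻¹) else 0

theorem cartan_diagonal {ι : Type} [Fintype ι] [DecidableEq ι] (v w : ι → ℂ) :
    cartan p r (Matrix.diagonal v) (Matrix.diagonal w) =
      Matrix.diagonal fun i => cartan p r (v i) (w i) := by
  have h := map_cartan (p := p) (r := r) (Matrix.diagonalAlgHom ℂ (n := ι) (α := ℂ)) v w
  simp only [Matrix.diagonalAlgHom_apply] at h
  rw [← h]
  congr 1
  ext i
  exact map_cartan (Pi.evalAlgHom ℂ (fun _ : ι => ℂ) i) v w

theorem evalTensor_X2lift (hp : 2 ≤ p) (hq : IsPrimitiveRoot q (2 * p)) (hr : r ^ 2 = q) :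
    evalTensor (X2lift hp hq r hr) (X2lift hp hq r hr) (RMatrix p q r) =
        fundamentalR q r (0, 1) (1, 0) ∧
      evalTensor (X2lift hp hq r hr) (X2lift hp hq r hr) (RMatrix' p q r) =
        fundamentalR q r (1, 0) (0, 1) := by
  have hr' := isPrimitiveRoot_sqrt hp hq hr
  have hE : X2lift hp hq r hr (UqHalf.E p q) = !![0, 1; 0, 0] :=
    UqHalf.lift_gen _ _ _ _ _ _ _ _ _ _
  have hF : X2lift hp hq r hr (UqHalf.F p q) = !![0, 0; 1, 0] :=
    UqHalf.lift_gen _ _ _ _ _ _ _ _ _ _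
  have hK : X2lift hp hq r hr (UqHalf.k p q) = Matrix.diagonal ![r, r⁻¹] := by
    refine (UqHalf.lift_gen _ _ _ _ _ _ _ _ _ _).trans ?_
    ext i j
    fin_cases i <;> fin_cases j <;> rfl
  obtain ⟨h1, h2⟩ := cartan_smul_one hp hr' (k := r) hr'.pow_eq_one
  obtain ⟨h3, h4⟩ := cartan_smul_one hp hr' (k := r⁻¹) (by rw [inv_pow, hr'.pow_eq_one, inv_one])
  have hT : ∀ x y, evalTensor (X2lift hp hq r hr) (X2lift hp hq r hr) (x ⊗ₜ y) =
    X2lift hp hq r hr x ⊗ₖ X2lift hp hq r hr y := fun x y => rfl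
  constructor
  · rw [RMatrix_eq_rElt, map_rElt, rElt]
    simp only [hT, hE, hF, hK, map_one]
    rw [← Matrix.diagonal_one, Matrix.diagonal_kronecker_diagonal,
      Matrix.diagonal_kronecker_diagonal, cartan_diagonal, Matrix.diagonal_one,
      ← Matrix.mul_kronecker_mul, Matrix.mul_one, Matrix.one_mul, qExp_of_sq_eq_zero hp hq ?_]
    · ext ⟨i, i'⟩ ⟨j, j'⟩
      rw [Matrix.diagonal_mul]
      fin_cases i <;> fin_cases i' <;> fin_cases j <;> fin_cases j' <;>
        simp [fundamentalR, h1, h2, h3, h4]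
    · rw [pow_two, ← Matrix.mul_kronecker_mul, Matrix.mul_fin_two]
      simp [← Matrix.ext_iff, Fin.forall_fin_two]
  · rw [RMatrix'_eq_rElt, map_rElt, rElt]
    simp only [hT, hE, hF, hK, map_one]
    rw [← Matrix.diagonal_one, Matrix.diagonal_kronecker_diagonal,
      Matrix.diagonal_kronecker_diagonal, cartan_diagonal, Matrix.diagonal_one,
      ← Matrix.mul_kronecker_mul, Matrix.mul_one, Matrix.one_mul, qExp_of_sq_eq_zero hp hq ?_]
    · ext ⟨i, i'⟩ ⟨j, j'⟩
      rw [Matrix.diagonal_mul]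
      fin_cases i <;> fin_cases i' <;> fin_cases j <;> fin_cases j' <;>
        simp [fundamentalR, h1, h2, h3, h4]
    · rw [pow_two, ← Matrix.mul_kronecker_mul, Matrix.mul_fin_two]
      simp [← Matrix.ext_iff, Fin.forall_fin_two]

theorem reflectionEquation_iff (hp : 2 ≤ p) (hq : IsPrimitiveRoot q (2 * p)) (hr : r ^ 2 = q)
    {A : Type} [Ring A] [Algebra ℂ A] (N : Matrix (Fin 2) (Fin 2) A) :
    ReflectionEquation hp hq r hr N ↔
      ExchangeRelations q (N 0 0) (N 0 1) (N 1 0) (N 1 1) := by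
  have hr0 : r ≠ 0 := (isPrimitiveRoot_sqrt hp hq hr).ne_zero (by omega)
  obtain ⟨h1, h2⟩ := evalTensor_X2lift hp hq hr
  have ha : ∀ (x : ℂ) (u : A), u * algebraMap ℂ A x = x • u := fun x u => by
    rw [Algebra.smul_def, Algebra.commutes]
  rw [ReflectionEquation, h1, h2, ← Matrix.ext_iff]
  simp only [Prod.forall, Fin.forall_fin_two, Matrix.mul_apply, Fintype.sum_prod_type,
    Fin.sum_univ_two, scalarMat, leg1, leg2, fundamentalR, Matrix.map_apply,
    Matrix.kroneckerMap_apply, Matrix.of_apply, Matrix.one_apply]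
  generalize N 0 0 = a
  generalize N 0 1 = b
  generalize N 1 0 = c
  generalize N 1 1 = d
  simp only [and_true, one_ne_zero, zero_ne_one, and_false, if_true, if_false,
    Prod.mk.injEq, map_zero, mul_one, mul_zero, zero_mul, add_zero, zero_add, ← Algebra.smul_def,
    ha, mul_assoc, smul_add, add_mul, smul_mul_assoc, smul_smul, one_mul]
  subst hr
  constructor
  -- Six of the sixteen entries suffice. The factors `r * r` and `r⁻¹ * r⁻¹` clear the powers of `r`
  -- that come from the diagonal of `R`.
  · rintro ⟨⟨⟨-, e1, -⟩, -, e2, -⟩, ⟨⟨e3, -⟩, e4, e5⟩, -, e6, -⟩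
    constructor
    · linear_combination (norm := skip) (r * r) • e4
      match_scalars <;> field_simp <;> ring
    · linear_combination (norm := skip) (r * r) • e5
      match_scalars <;> field_simp <;> ring
    · linear_combination (norm := skip) (r⁻¹ * r⁻¹) • e6
      match_scalars <;> field_simp <;> ring
    · linear_combination (norm := skip) e1
      match_scalars <;> field_simp <;> ring
    · rw [pow_two d]
      linear_combination (norm := skip) -e2
      match_scalars <;> field_simp <;> ring
    · linear_combination (norm := skip) e3
      match_scalars <;> field_simp <;> ring
  -- Conversely, the exchange relations bring both sides of each entry to the same ordered form, so
  -- that only coefficients remain to be compared.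
  · rintro ⟨e1, e2, e3, e4, e5, e6⟩
    simp only [e1, e2, e3, e4, e5, e6, pow_two d]
    refine ⟨⟨⟨⟨?_, ?_⟩, ?_, ?_⟩, ⟨?_, ?_⟩, ?_, ?_⟩, ⟨⟨?_, ?_⟩, ?_, ?_⟩, ⟨?_, ?_⟩, ?_, ?_⟩
    all_goals
      match_scalars <;> field_simp <;> ring

end

end LoopAlgebra

end

noncomputable section

namespace LoopAlgebra

/-! ### Products of matrix coefficients -/

section

variable {p : ℕ} {q r : ℂ}

theorem exists_pow_mul_pow_eq_smul {A : Type*} [Ring A] [Algebra ℂ A] {z : ℂ} (hz : z ≠ 0)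
    {x y : A} (h : y * x = z • (x * y)) (m : ℕ) :
    ∃ s : ℂ, s ≠ 0 ∧ x ^ m * y ^ m = s • (x * y) ^ m := by
  induction m with
  | zero => exact ⟨1, one_ne_zero, by simp⟩
  | succ m ih =>
    obtain ⟨s, hs, hm⟩ := ih
    have h1 : y * (x * y) ^ m = z ^ m • ((x * y) ^ m * y) :=
      mul_pow_skew (by rw [← mul_assoc, h, smul_mul_assoc]) m
    have h2 : (x * y) ^ m * y = (z ^ m)⁻¹ • (y * (x * y) ^ m) := by
      rw [h1, smul_smul, inv_mul_cancel₀ (pow_ne_zero m hz), one_smul]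
    refine ⟨s * (z ^ m)⁻¹, mul_ne_zero hs (inv_ne_zero (pow_ne_zero m hz)), ?_⟩
    rw [pow_succ' x, pow_succ y, mul_assoc, ← mul_assoc (x ^ m), hm, smul_mul_assoc, h2,
      mul_smul_comm, mul_smul_comm, smul_smul, ← mul_assoc, ← pow_succ']

/-- Moving the Cartan part to the right of `e ^ m` turns `e ^ m` into `e ^ m (l ^ 2) ^ m`. The sum
becomes a polynomial with constant term `1` in the nilpotent element `f * e * l ^ 2`, times the
invertible Cartan part. -/
theorem isUnit_sum_mul_cartan_mul (hp : 2 ≤ p) (hq : IsPrimitiveRoot q (2 * p)) (hr : r ^ 2 = q)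
    {A : Type*} [Ring A] [Algebra ℂ A] {f l e k : A} (hf : f ^ p = 0) (hl : l ^ (4 * p) = 1)
    (hk : k ^ (4 * p) = 1) (hlf : l * f = q • (f * l)) (hke : k * e = q • (e * k))
    (hfe : Commute f e) (hle : Commute l e) (hlk : Commute l k) :
    IsUnit (∑ m ∈ Finset.range p, rCoeff q m • (f ^ m * cartan p r k l * e ^ m)) := by
  have hr' := isPrimitiveRoot_sqrt hp hq hr
  have hq0 := Uq.q_ne_zero hp hq
  set C := cartan p r k l with hC
  have hCl : Commute C l := (commute_cartan hlk (Commute.refl l)).symm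
  have hCe : ∀ m, C * e ^ m = e ^ m * (l ^ 2) ^ m * C := by
    intro m
    induction m with
    | zero => simp
    | succ m ih =>
      have h1 : C * e = e * C * l ^ 2 := cartan_mul_raise hp hr' hr hl hke hle.symm
      have h2 : (l ^ 2) ^ m * e = e * (l ^ 2) ^ m := ((hle.pow_left 2).pow_left m).eq
      have h3 : C * l ^ 2 = l ^ 2 * C := (hCl.pow_right 2).eq
      rw [pow_succ e, ← mul_assoc, ih, mul_assoc, h1, mul_assoc e, h3, ← mul_assoc, ← mul_assoc,
        mul_assoc (e ^ m), h2, ← mul_assoc, mul_assoc _ _ (l ^ 2), ← pow_succ, ← pow_succ]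
  have hly : l ^ 2 * (f * e) = (q ^ 2) • (f * e * l ^ 2) := by
    rw [← mul_assoc, pow_mul_skew hlf, smul_mul_assoc, mul_assoc, (hle.pow_left 2).eq, mul_assoc]
  choose s hs0 hs using exists_pow_mul_pow_eq_smul (pow_ne_zero 2 hq0) hly
  have h0 : (f * e * l ^ 2) ^ p = 0 := by
    have h1 := hs p
    rw [hfe.mul_pow, hf, zero_mul, zero_mul] at h1
    exact (smul_eq_zero.mp h1.symm).resolve_left (hs0 p)
  -- The chosen constants `s m` are only known to be nonzero, so the constant term is set to `1` by
  -- hand.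
  have hsum : ∑ m ∈ Finset.range p, rCoeff q m • (f ^ m * C * e ^ m) =
      (∑ m ∈ Finset.range p, (if m = 0 then 1 else rCoeff q m * s m) • (f * e * l ^ 2) ^ m) * C := by
    rw [Finset.sum_mul]
    refine Finset.sum_congr rfl fun m _ => ?_
    rw [mul_assoc, hCe, ← mul_assoc, ← mul_assoc, ← hfe.mul_pow]
    rcases Nat.eq_zero_or_pos m with rfl | hm
    · simp [rCoeff_zero]
    · rw [if_neg hm.ne', hs, smul_mul_assoc, smul_mul_assoc, smul_smul]
  rw [hsum]
  exact (isUnit_sum_smul_pow h0 hp (if_pos rfl)).mul (isUnit_cartan hp hr' hlk.symm hk hl)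

/-! ### Invertibility of the partial transpose of `R'` and solution of the fusion relation -/

theorem kronecker_pow {m n : ℕ} (A : Matrix (Fin m) (Fin m) ℂ) (B : Matrix (Fin n) (Fin n) ℂ)
    (k : ℕ) : (A ⊗ₖ B) ^ k = (A ^ k) ⊗ₖ (B ^ k) := by
  induction k with
  | zero => simp
  | succ k ih => rw [pow_succ, ih, ← Matrix.mul_kronecker_mul, ← pow_succ, ← pow_succ]

/-- The transpose in the first tensor factor. -/
def partialTranspose (m n : ℕ) : Matrix (Fin m × Fin n) (Fin m × Fin n) ℂ →ₗ[ℂ]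
    Matrix (Fin m × Fin n) (Fin m × Fin n) ℂ where
  toFun Q := Matrix.of fun i j => Q (j.1, i.2) (i.1, j.2)
  map_add' _ _ := rfl
  map_smul' _ _ := rfl

theorem partialTranspose_kronecker {m n : ℕ} (A : Matrix (Fin m) (Fin m) ℂ)
    (B : Matrix (Fin n) (Fin n) ℂ) : partialTranspose m n (A ⊗ₖ B) = A.transpose ⊗ₖ B := rfl

-- Transposition in the first factor reverses products there, so the powers of `F` pass to the left
-- of the Cartan part while those of `E` stay on its right. It also inverts the commutation factor
-- of `k` and `F`. This is the situation of `isUnit_sum_mul_cartan_mul`.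
set_option maxHeartbeats 1000000 in
theorem isUnit_partialTranspose (hp : 2 ≤ p) (hq : IsPrimitiveRoot q (2 * p)) (hr : r ^ 2 = q)
    {m n : ℕ} (I' : MatRep (UqHalf p q) m) (J' : MatRep (UqHalf p q) n) :
    IsUnit (partialTranspose m n (evalTensor I' J' (RMatrix' p q r))) := by
  have hT : ∀ x y, evalTensor I' J' (x ⊗ₜ y) = I' x ⊗ₖ J' y := fun x y => rfl
  have hq0 := Uq.q_ne_zero hp hq
  have h : partialTranspose m n (evalTensor I' J' (RMatrix' p q r)) =
      ∑ i ∈ Finset.range p, rCoeff q i • (((I' (UqHalf.F p q)).transpose ⊗ₖ 1) ^ i *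
        cartan p r (1 ⊗ₖ J' (UqHalf.k p q)) ((I' (UqHalf.k p q)).transpose ⊗ₖ 1) *
          (1 ⊗ₖ J' (UqHalf.E p q)) ^ i) := by
    rw [RMatrix', RMatrix, cartanPart, Finset.mul_sum]
    simp only [cartan_eq_sum, map_sum, map_smul, hT, Finset.sum_mul, smul_mul_assoc, mul_smul_comm,
      Finset.mul_sum, Finset.smul_sum, Algebra.TensorProduct.tmul_mul_tmul,
      Algebra.TensorProduct.comm_tmul, partialTranspose_kronecker, kronecker_pow, one_pow,
      ← Matrix.mul_kronecker_mul, one_mul, mul_one, map_mul, map_pow, Matrix.transpose_mul,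
      Matrix.transpose_pow]
    rfl
  rw [h]
  have h0 : ∀ A B : Matrix (Fin m) (Fin m) ℂ, ∀ z : ℂ, A * B = z⁻¹ • (B * A) → z ≠ 0 →
      A.transpose * B.transpose = z • (B.transpose * A.transpose) := by
    intro A B z hAB hz
    rw [← Matrix.transpose_mul, ← Matrix.transpose_mul, hAB, Matrix.transpose_smul, smul_smul,
      mul_inv_cancel₀ hz, one_smul]
  refine isUnit_sum_mul_cartan_mul hp hq hr ?_ ?_ ?_ ?_ ?_ ?_ ?_ ?_
  · rw [kronecker_pow, ← Matrix.transpose_pow, ← map_pow, UqHalf.F_pow]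
    simp
  · rw [kronecker_pow, ← Matrix.transpose_pow, ← map_pow, UqHalf.k_pow]
    simp
  · rw [kronecker_pow, ← map_pow, UqHalf.k_pow]
    simp
  · rw [← Matrix.mul_kronecker_mul, ← Matrix.mul_kronecker_mul, ← Matrix.smul_kronecker,
      h0 _ _ _ _ hq0]
    rw [← map_mul, ← map_mul, UqHalf.k_mul_F, map_smul]
  · rw [← Matrix.mul_kronecker_mul, ← Matrix.mul_kronecker_mul, ← Matrix.kronecker_smul,
      ← map_mul, ← map_mul, UqHalf.k_mul_E, map_smul]
  all_goals simp only [Commute, SemiconjBy, ← Matrix.mul_kronecker_mul, mul_one, one_mul]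

/-- For fixed `i` and `l` the entries are a linear system in the products of an entry of `M` by an
entry of `N`, with the partial transpose of `Q` as its matrix. -/
theorem leg1_mul_scalarMat_mul_leg2_apply {A : Type} [Ring A] [Algebra ℂ A] {m n : ℕ}
    (M : Matrix (Fin m) (Fin m) A) (N : Matrix (Fin n) (Fin n) A)
    (Q : Matrix (Fin m × Fin n) (Fin m × Fin n) ℂ) (i k : Fin m) (j l : Fin n) :
    (leg1 (n := n) M * scalarMat A Q * leg2 (m := m) N) (i, j) (k, l) =
      ∑ x : Fin m × Fin n, partialTranspose m n Q (k, j) x • (M i x.1 * N x.2 l) := by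
  have h : ∀ y, (leg1 (n := n) M * scalarMat A Q) (i, j) y = ∑ s, Q (s, j) y • M i s := by
    intro y
    simp [Matrix.mul_apply, Fintype.sum_prod_type, leg1, scalarMat, Matrix.one_apply,
      Algebra.smul_def, Algebra.commutes]
  rw [Matrix.mul_apply]
  simp only [h, Fintype.sum_prod_type, leg2, Matrix.kroneckerMap_apply, Matrix.one_apply]
  rw [Finset.sum_comm]
  simp only [mul_ite, mul_zero, ite_mul, one_mul, zero_mul, Finset.sum_ite_eq',
    Finset.mem_univ, if_true, Finset.sum_mul, smul_mul_assoc]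
  rw [Finset.sum_comm]
  rfl

/-- The image of the dual of the quantum group in the loop algebra. -/
def coeffRange (hp : 2 ≤ p) (hq : IsPrimitiveRoot q (2 * p)) (r : ℂ) :
    Submodule ℂ (L01 hp hq r) :=
  LinearMap.range ((L01.mk hp hq r).toLinearMap.comp (TensorAlgebra.ι ℂ))

/-- The fusion relation places the right-hand sides of that system in `coeffRange`. Inverting the
partial transpose of `R'` isolates the single products. -/
theorem loopM_mul_loopM_mem (hp : 2 ≤ p) (hq : IsPrimitiveRoot q (2 * p)) (hr : r ^ 2 = q)
    {m n : ℕ} (I : MatRep (Uq p q) m) (J : MatRep (Uq p q) n)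
    (I' : MatRep (UqHalf p q) m) (J' : MatRep (UqHalf p q) n)
    (hI : IsSimpleOrPIM I) (hJ : IsSimpleOrPIM J) (hI' : IsLifting I' I) (hJ' : IsLifting J' J)
    (i s : Fin m) (t l : Fin n) :
    loopM hp hq r I i s * loopM hp hq r J t l ∈ coeffRange hp hq r := by
  set Q := evalTensor I' J' (RMatrix' p q r) with hQ
  have hQu : IsUnit Q := isUnit_evalTensor_RMatrix' hp hq hr I' J'
  have hfus : (freeM (tensorRep hp hq I J)).map (L01.mk hp hq r) * scalarMat (L01 hp hq r) Q =
      leg1 (loopM hp hq r I) * scalarMat (L01 hp hq r) Q * leg2 (loopM hp hq r J) := by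
    have h : (freeM (tensorRep hp hq I J)).map (L01.mk hp hq r) =
        (fusionRHS r I J I' J').map (L01.mk hp hq r) := by
      ext x y
      exact RingQuot.mkAlgHom_rel ℂ (LoopRel.fusion I J I' J' hI hJ hI' hJ' x y)
    rw [h, map_fusionRHS, mul_assoc, scalarMat_inv_mul hQu, mul_one]
    rfl
  have hmem : ∀ k j, ∑ x : Fin m × Fin n, partialTranspose m n Q (k, j) x •
      (loopM hp hq r I i x.1 * loopM hp hq r J x.2 l) ∈ coeffRange hp hq r := by
    intro k j
    have h1 := congrFun (congrFun hfus (i, j)) (k, l)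
    rw [leg1_mul_scalarMat_mul_leg2_apply] at h1
    rw [← h1, Matrix.mul_apply]
    refine Submodule.sum_mem _ fun x _ => ?_
    rw [scalarMat, Matrix.map_apply, Matrix.map_apply, ← Algebra.commutes, ← Algebra.smul_def]
    exact Submodule.smul_mem _ _ ⟨_, rfl⟩
  obtain ⟨P, hP⟩ := (isUnit_partialTranspose hp hq hr I' J').exists_left_inv
  rw [← hQ] at hP
  have h3 : loopM hp hq r I i s * loopM hp hq r J t l = ∑ y : Fin m × Fin n, P (s, t) y •
      ∑ x : Fin m × Fin n, partialTranspose m n Q y x •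
        (loopM hp hq r I i x.1 * loopM hp hq r J x.2 l) := by
    have h4 : ∀ x, ∑ y, P (s, t) y * partialTranspose m n Q y x = if (s, t) = x then 1 else 0 :=
      fun x => by rw [← Matrix.mul_apply, hP, Matrix.one_apply]
    simp only [Finset.smul_sum, smul_smul]
    rw [Finset.sum_comm]
    simp only [← Finset.sum_smul, h4]
    simp
  rw [h3]
  exact Submodule.sum_mem _ fun y _ => Submodule.smul_mem _ _ (hmem y.1 y.2)

end

end LoopAlgebra

end

noncomputable section

namespace LoopAlgebra

/-! ### Elements of weight zero -/

section

variable {p : ℕ} {q r : ℂ}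

theorem Uq.algHom_ext {A : Type*} [Ring A] [Algebra ℂ A] {f g : Uq p q →ₐ[ℂ] A}
    (h : ∀ x, f (Uq.gen p q x) = g (Uq.gen p q x)) : f = g := by
  refine AlgHom.ext_of_adjoin_eq_top (Uq.adjoin_eq_top p q) ?_
  rintro x (rfl | rfl | rfl) <;> exact h _

/-- The automorphism multiplying `E` by `q` and `F` by `q⁻¹`. -/
def Uq.halfAd (hp : 2 ≤ p) (hq : IsPrimitiveRoot q (2 * p)) : Uq p q →ₐ[ℂ] Uq p q :=
  Uq.lift (q • Uq.E p q) (q⁻¹ • Uq.F p q) (Uq.K p q)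
    (by rw [smul_pow, Uq.E_pow, smul_zero]) (by rw [smul_pow, Uq.F_pow, smul_zero])
    (Uq.K_pow p q)
    (by rw [mul_smul_comm, Uq.K_mul_E, smul_mul_assoc, smul_comm])
    (by rw [mul_smul_comm, Uq.K_mul_F, smul_mul_assoc, smul_comm])
    (by
      have h0 := Uq.q_ne_zero hp hq
      rw [smul_mul_smul_comm, smul_mul_smul_comm, mul_inv_cancel₀ h0, inv_mul_cancel₀ h0, one_smul,
        one_smul, Uq.E_mul_F])

section

variable (hp : 2 ≤ p) (hq : IsPrimitiveRoot q (2 * p))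

theorem Uq.halfAd_E : Uq.halfAd hp hq (Uq.E p q) = q • Uq.E p q :=
  Uq.lift_gen _ _ _ _ _ _ _ _ _ _

theorem Uq.halfAd_F : Uq.halfAd hp hq (Uq.F p q) = q⁻¹ • Uq.F p q :=
  Uq.lift_gen _ _ _ _ _ _ _ _ _ _

theorem Uq.halfAd_K : Uq.halfAd hp hq (Uq.K p q) = Uq.K p q :=
  Uq.lift_gen _ _ _ _ _ _ _ _ _ _

/-- `Uq.halfAd` plays the role of conjugation by `K^{1/2}`: its square is conjugation by `K`. -/
theorem Uq.halfAd_halfAd_mul_K (x : Uq p q) :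
    Uq.halfAd hp hq (Uq.halfAd hp hq x) * Uq.K p q = Uq.K p q * x := by
  have hx : x ∈ Algebra.adjoin ℂ {Uq.F p q, Uq.E p q, Uq.K p q} := by
    rw [Uq.adjoin_eq_top]; trivial
  induction hx using Algebra.adjoin_induction with
  | mem x hx =>
    rcases hx with rfl | rfl | rfl
    · rw [halfAd_F, map_smul, halfAd_F, smul_smul, ← pow_two, Uq.K_mul_F, smul_mul_assoc]
    · rw [halfAd_E, map_smul, halfAd_E, smul_smul, ← pow_two, Uq.K_mul_E, smul_mul_assoc]
    · rw [halfAd_K, halfAd_K]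
  | algebraMap c => rw [AlgHom.commutes, AlgHom.commutes, Algebra.commutes]
  | add x y _ _ hx hy => rw [map_add, map_add, add_mul, hx, hy, mul_add]
  | mul x y _ _ hx hy => rw [map_mul, map_mul, mul_assoc, hy, ← mul_assoc, hx, mul_assoc]

/-- Conjugation by `K` multiplies `F^i E^j K^l` by `q ^ (2 (j - i))`, a `p`-th root of unity. If it
is not `1`, the sum vanishes. If it is `1`, then `i = j` because `i, j < p`, and such a monomial is
fixed by `Uq.halfAd`. Only a spanning set of monomials is used. -/
theorem Uq.halfAd_sum_conj (x : Uq p q) :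
    Uq.halfAd hp hq (∑ t ∈ Finset.range p, Uq.K p q ^ t * x * Uq.Kinv p q ^ t) =
      ∑ t ∈ Finset.range p, Uq.K p q ^ t * x * Uq.Kinv p q ^ t := by
  have h0 := Uq.q_ne_zero hp hq
  have hx : x ∈ Submodule.span ℂ (Set.range fun i : Fin p × Fin p × Fin (2 * p) =>
      Uq.F p q ^ (i.1 : ℕ) * Uq.E p q ^ (i.2.1 : ℕ) * Uq.K p q ^ (i.2.2 : ℕ)) := by
    rw [Uq.span_monomials hp]; trivial
  induction hx using Submodule.span_induction with
  | mem x hx =>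
    obtain ⟨⟨i, j, l⟩, hm⟩ := hx
    dsimp only at hm
    set w := (q⁻¹ ^ 2) ^ (i : ℕ) * (q ^ 2) ^ (j : ℕ) with hw
    have h1 : Uq.K p q * x = w • (x * Uq.K p q) := by
      rw [← hm, mul_assoc, ← mul_assoc, mul_pow_skew (Uq.K_mul_F p q), smul_mul_assoc, mul_assoc,
        ← mul_assoc (Uq.K p q), mul_pow_skew (Uq.K_mul_E p q), smul_mul_assoc, mul_smul_comm,
        smul_smul, mul_assoc, mul_assoc, mul_assoc, ← pow_succ, ← pow_succ']
    have h2 : ∀ t, Uq.K p q ^ t * x * Uq.Kinv p q ^ t = w ^ t • x := by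
      intro t
      have h3 : Commute (Uq.K p q) (Uq.Kinv p q) := Commute.pow_right (Commute.refl _) _
      rw [pow_mul_skew h1, smul_mul_assoc, mul_assoc, ← h3.mul_pow, Uq.K_mul_Kinv hp, one_pow,
        mul_one]
    simp only [h2, ← Finset.sum_smul]
    by_cases hw1 : w = 1
    · have hij : (i : ℕ) = j := by
        refine (Uq.q_sq_primitive hp hq).pow_inj i.2 j.2 ?_
        rw [hw, inv_pow, inv_pow] at hw1
        exact ((inv_mul_eq_one₀ (pow_ne_zero _ (pow_ne_zero _ h0))).mp hw1)
      rw [map_smul, ← hm, map_mul, map_mul, map_pow, map_pow, map_pow, halfAd_E, halfAd_F, halfAd_K,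
        smul_pow, smul_pow, smul_mul_smul_comm, hij, ← mul_pow, inv_mul_cancel₀ h0, one_pow,
        one_smul]
    · have hwp : w ^ p = 1 := by
        have h4 := (Uq.q_sq_primitive hp hq).pow_eq_one
        rw [hw, mul_pow, ← pow_mul, mul_comm _ p, pow_mul, inv_pow, inv_pow, h4, ← pow_mul,
          mul_comm _ p, pow_mul, h4]
        simp
      rw [geom_sum_primitiveRoot hwp hw1, zero_smul, map_zero]
  | zero => simp
  | add x y _ _ hx hy =>
    simp only [mul_add, add_mul, Finset.sum_add_distrib, map_add] at hx hy ⊢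
    rw [hx, hy]
  | smul c x _ hx =>
    simp only [mul_smul_comm, smul_mul_assoc, ← Finset.smul_sum, map_smul] at hx ⊢
    rw [hx]

/-- An element commuting with `K` is `1 / p` times the sum of its conjugates, so
`Uq.halfAd_sum_conj` applies. -/
theorem Uq.halfAd_eq_self {x : Uq p q} (hx : Commute (Uq.K p q) x) : Uq.halfAd hp hq x = x := by
  have h := Uq.halfAd_sum_conj hp hq x
  have h1 : ∀ t, Uq.K p q ^ t * x * Uq.Kinv p q ^ t = x := by
    intro t
    have h3 : Commute (Uq.K p q) (Uq.Kinv p q) := Commute.pow_right (Commute.refl _) _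
    rw [(hx.pow_left t).eq, mul_assoc, ← h3.mul_pow, Uq.K_mul_Kinv hp, one_pow, mul_one]
  simp only [h1, Finset.sum_const, Finset.card_range, map_nsmul] at h
  have hp0 : (p : ℂ) ≠ 0 := by exact_mod_cast (by omega : p ≠ 0)
  rw [← Nat.cast_smul_eq_nsmul ℂ, ← Nat.cast_smul_eq_nsmul ℂ] at h
  exact smul_right_injective _ hp0 h

end

end

end LoopAlgebra

end

noncomputable section

namespace LoopAlgebra

/-! ### Principal indecomposable modules -/

section

variable {p : ℕ} {q r : ℂ}

theorem IsPIM.congr {A : Type} [Ring A] {V W : Type} [AddCommGroup V] [Module A V]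
    [AddCommGroup W] [Module A W] (e : V ≃ₗ[A] W) (h : IsPIM A V) : IsPIM A W := by
  obtain ⟨h1, h2, h3⟩ := h
  refine ⟨Module.Projective.of_equiv e, e.symm.toEquiv.nontrivial, fun N N' hN => ?_⟩
  have h4 : IsCompl (N.comap e.toLinearMap) (N'.comap e.toLinearMap) :=
    (Submodule.orderIsoMapComap e).symm.isCompl hN
  have h5 : ∀ N : Submodule A W, N.comap e.toLinearMap = ⊥ → N = ⊥ := fun N hN =>
    (Submodule.orderIsoMapComap e).symm.injective (hN.trans (map_bot _).symm)
  exact (h3 _ _ h4).imp (h5 N) (h5 N')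

/-- The matrix representation attached to a basis of a module. -/
def basisRep {A : Type} [Ring A] [Algebra ℂ A] {V : Type} [AddCommGroup V] [Module A V]
    [Module ℂ V] [IsScalarTower ℂ A V] {n : ℕ} (b : Module.Basis (Fin n) ℂ V) : MatRep A n :=
  (LinearMap.toMatrixAlgEquiv b).toAlgHom.comp (Algebra.lsmul ℂ ℂ V)

theorem basisRep_mulVec_repr {A : Type} [Ring A] [Algebra ℂ A] {V : Type} [AddCommGroup V]
    [Module A V] [Module ℂ V] [IsScalarTower ℂ A V] {n : ℕ} (b : Module.Basis (Fin n) ℂ V)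
    (x : A) (v : V) : Matrix.mulVec (basisRep b x) (b.repr v) = b.repr (x • v) :=
  LinearMap.toMatrix_mulVec_repr b b (Algebra.lsmul ℂ ℂ V x) v

/-- The module of the matrix representation attached to a basis of `V` is `V`. -/
def basisRepEquiv {A : Type} [Ring A] [Algebra ℂ A] {V : Type} [AddCommGroup V] [Module A V]
    [Module ℂ V] [IsScalarTower ℂ A V] {n : ℕ} (b : Module.Basis (Fin n) ℂ V) :
    V ≃ₗ[A] RepModule (basisRep (A := A) b) :=
  { b.equivFun.toAddEquiv with
    map_smul' := fun x v => (basisRep_mulVec_repr b x v).symm }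

/-- A module over the extended quantum group restricting to a given module. -/
theorem exists_lifting_basisRep {V : Type} [AddCommGroup V] [Module (Uq p q) V] [Module ℂ V]
    [IsScalarTower ℂ (Uq p q) V] {n : ℕ} (b : Module.Basis (Fin n) ℂ V) (hp : 2 ≤ p)
    (k : Module.End ℂ V) (hk : ∀ v, k (k v) = Uq.K p q • v)
    (hkE : ∀ v, k (Uq.E p q • v) = q • Uq.E p q • k v)
    (hkF : ∀ v, k (Uq.F p q • v) = q⁻¹ • Uq.F p q • k v) :
    ∃ ρ' : MatRep (UqHalf p q) n, IsLifting ρ' (basisRep b) := by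
  set L := Algebra.lsmul ℂ ℂ V (A := Uq p q) with hL
  have hk2 : k ^ 2 = L (Uq.K p q) := by
    ext v; exact hk v
  have h : HalfTriple p q (L (Uq.E p q)) (L (Uq.F p q)) k := by
    refine ⟨?_, ?_, ?_, ?_, ?_, ?_⟩
    · rw [← map_pow, Uq.E_pow, map_zero]
    · rw [← map_pow, Uq.F_pow, map_zero]
    · rw [show 4 * p = 2 * (2 * p) by ring, pow_mul, hk2, ← map_pow, Uq.K_pow, map_one]
    · ext v; exact hkE v
    · ext v; exact hkF v
    · rw [show 4 * p - 2 = 2 * (2 * p - 1) by omega, pow_mul, hk2, ← map_pow, ← map_mul,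
        ← map_mul, ← map_sub, ← map_smul, ← map_add, Uq.E_mul_F]
  refine ⟨(LinearMap.toMatrixAlgEquiv b).toAlgHom.comp h.lift, ?_⟩
  rw [IsLifting, basisRep, AlgHom.comp_assoc]
  congr 1
  refine Uq.algHom_ext fun x => ?_
  rw [AlgHom.comp_apply, toHalf, Uq.lift_gen]
  cases x
  · exact h.lift_gen _
  · exact h.lift_gen _
  · rw [Uq.genMap, map_pow, h.lift_gen]
    exact hk2

end

/-! ### Decomposition of the unit into homogeneous idempotents -/

section

variable {p : ℕ} {q r : ℂ}

/-- The idempotents homogeneous for `K` that generate principal indecomposable modules. -/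
def pimIdempotents (p : ℕ) (q : ℂ) : Set (Uq p q) :=
  {e | e * e = e ∧ (∃ z : ℂ, Uq.K p q * e = z • e ∧ e * Uq.K p q = z • e) ∧
    IsPIM (Uq p q) (Submodule.span (Uq p q) {e})}

theorem mul_idempotent_of_mem_span {A : Type} [Ring A] {e x : A} (he : e * e = e)
    (hx : x ∈ Submodule.span A {e}) : x * e = x := by
  obtain ⟨a, rfl⟩ := Submodule.mem_span_singleton.mp hx
  rw [smul_eq_mul, mul_assoc, he]

theorem projective_span_idempotent {A : Type} [Ring A] {e : A} (he : e * e = e) :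
    Module.Projective A (Submodule.span A {e}) := by
  refine Module.Projective.of_split (M := A) (Submodule.subtype _)
    ((LinearMap.toSpanSingleton A A e).codRestrict _ fun x =>
      Submodule.mem_span_singleton.mpr ⟨x, rfl⟩) ?_
  ext x
  exact mul_idempotent_of_mem_span he x.2

/-- Everything follows from `N ∩ N' = 0`. From `n = n e = n n + n n'` the element `n - n n = n n'`
lies in both submodules, and so does `k n - z n = z n' - k n'`. If the ideal of `n` contained `e`,
each element of `N'` would be a multiple of `n`, hence in `N`, against `N' ≠ ⊥`. -/
theorem idempotent_of_isCompl {A : Type} [Ring A] [Algebra ℂ A] {e : A} (he : e * e = e)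
    {N N' : Submodule A (Submodule.span A {e})} (hN : Disjoint N N') (hN' : N' ≠ ⊥)
    {n n' : Submodule.span A {e}} (hn : n ∈ N) (hn' : n' ∈ N') (h : (n : A) + n' = e) {k : A}
    {z : ℂ} (hk : k * e = z • e) (hk' : e * k = z • e) :
    (n : A) * n = n ∧ (k * (n : A) = z • (n : A)) ∧ (n : A) * k = z • (n : A) ∧
      (Submodule.span A {(n : A)}).restrictScalars ℂ <
        (Submodule.span A {e}).restrictScalars ℂ := by
  have hne := mul_idempotent_of_mem_span he n.2
  have hzero : ∀ {x y : Submodule.span A {e}}, x ∈ N → y ∈ N' → x = y → x = 0 :=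
    fun hx hy hxy => by
      subst hxy
      exact Submodule.disjoint_def.mp hN _ hx hy
  refine ⟨?_, ?_, ?_, ?_⟩
  · have h1 : n - (n : A) • n = (n : A) • n' := by
      ext
      have : (n : A) = n * (n + n') := by rw [h, hne]
      simp only [Submodule.coe_sub, Submodule.coe_smul, smul_eq_mul]
      rw [sub_eq_iff_eq_add, add_comm, ← mul_add, ← this]
    have h2 := hzero (N.sub_mem hn (N.smul_mem _ hn)) (N'.smul_mem _ hn') h1
    have h3 := congrArg Subtype.val (sub_eq_zero.mp h2)
    exact h3.symm
  · have h1 : k • n - (algebraMap ℂ A z) • n = (algebraMap ℂ A z) • n' - k • n' := by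
      ext
      simp only [Submodule.coe_sub, Submodule.coe_smul, smul_eq_mul]
      rw [sub_eq_sub_iff_add_eq_add, ← mul_add, add_comm ((algebraMap ℂ A z) * _), ← mul_add, h,
        hk, Algebra.smul_def]
    have h2 := hzero (N.sub_mem (N.smul_mem _ hn) (N.smul_mem _ hn))
      (N'.sub_mem (N'.smul_mem _ hn') (N'.smul_mem _ hn')) h1
    have h3 := congrArg Subtype.val (sub_eq_zero.mp h2)
    rw [Algebra.smul_def]
    exact h3
  · rw [← hne, mul_assoc, hk', mul_smul_comm]
  · refine lt_of_le_of_ne ?_ fun heq => hN' ?_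
    · exact (Submodule.span_singleton_le_iff_mem _ _).mpr n.2
    · have h1 : e ∈ (Submodule.span A {(n : A)}).restrictScalars ℂ := by
        rw [heq]; exact Submodule.mem_span_singleton_self e
      obtain ⟨a, ha⟩ := Submodule.mem_span_singleton.mp h1
      rw [eq_bot_iff]
      intro x hx
      have h2 : ((x : A) * a) • n = x := by
        ext
        rw [Submodule.coe_smul, smul_eq_mul, mul_assoc]
        change (x : A) * (a • (n : A)) = x
        rw [ha, mul_idempotent_of_mem_span he x.2]
      exact Submodule.disjoint_def.mp hN _ (h2 ▸ N.smul_mem _ hn) hx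

/-- Induction on the dimension of the left ideal of `e`: unless `e` is zero or the ideal is
principal indecomposable, `idempotent_of_isCompl` splits `e` into two homogeneous idempotents with
strictly smaller ideals. -/
theorem mem_closure_pimIdempotents (hp : 2 ≤ p) : ∀ (d : ℕ) {e : Uq p q} {z : ℂ}, e * e = e →
    Uq.K p q * e = z • e → e * Uq.K p q = z • e →
    Module.finrank ℂ ((Submodule.span (Uq p q) {e}).restrictScalars ℂ) < d →
    e ∈ AddSubmonoid.closure (pimIdempotents p q) := by
  have := Uq.finite q hp
  intro d
  induction d with
  | zero => intro e z _ _ _ h; omega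
  | succ d ih =>
    intro e z he hk hk' hd
    rcases eq_or_ne e 0 with rfl | he0
    · exact zero_mem _
    by_cases hP : IsPIM (Uq p q) (Submodule.span (Uq p q) {e})
    · exact AddSubmonoid.subset_closure ⟨he, ⟨z, hk, hk'⟩, hP⟩
    have hnt : Nontrivial (Submodule.span (Uq p q) {e}) :=
      Submodule.nontrivial_iff_ne_bot.mpr (by rwa [Ne, Submodule.span_singleton_eq_bot])
    simp only [IsPIM, projective_span_idempotent he, hnt, true_and, not_forall, not_or] at hP
    obtain ⟨N, N', hN, hN1, hN2⟩ := hP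
    have h1 : (⟨e, Submodule.mem_span_singleton_self e⟩ : Submodule.span (Uq p q) {e}) ∈ N ⊔ N' := by
      rw [hN.sup_eq_top]; trivial
    obtain ⟨n, hn, n', hn', h2⟩ := Submodule.mem_sup.mp h1
    have h3 : (n : Uq p q) + n' = e := congrArg Subtype.val h2
    obtain ⟨a1, a2, a3, a4⟩ := idempotent_of_isCompl he hN.disjoint hN2 hn hn' h3 hk hk'
    obtain ⟨b1, b2, b3, b4⟩ := idempotent_of_isCompl he hN.symm.disjoint hN1 hn' hn
      (by rw [add_comm, h3]) hk hk'
    rw [← h3]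
    exact add_mem (ih a1 a2 a3 (by have := Submodule.finrank_lt_finrank_of_lt a4; omega))
      (ih b1 b2 b3 (by have := Submodule.finrank_lt_finrank_of_lt b4; omega))

theorem one_mem_closure_pimIdempotents (hp : 2 ≤ p) (hr : IsPrimitiveRoot r (4 * p)) :
    (1 : Uq p q) ∈ AddSubmonoid.closure (pimIdempotents p q) := by
  -- Taking `4p` instead of `2p` lets the projections attached to `r` be used for `K`; those with
  -- odd `n` are zero, which does no harm.
  have hK : Uq.K p q ^ (4 * p) = 1 := by
    rw [show 4 * p = 2 * p * 2 by ring, pow_mul, Uq.K_pow, one_pow]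
  rw [← sum_weightProj hp hr (Uq.K p q)]
  refine sum_mem fun n hn => ?_
  have hn' := Finset.mem_range.mp hn
  have h1 := mul_weightProj hp hr hK n
  refine mem_closure_pimIdempotents hp _ ?_ h1 ?_ (Nat.lt_succ_self _)
  · rw [weightProj_mul hp hr hK hn' hn', if_pos rfl]
  · rw [← h1]
    exact (commute_weightProj (Commute.refl _) n).eq.symm

end

end LoopAlgebra

end

noncomputable section

namespace LoopAlgebra

/-! ### The loop algebra is spanned by matrix coefficients -/

section

variable {p : ℕ} {q r : ℂ}

/-- Let `K^{1/2}` act on the ideal of `e` by `v ↦ μ • halfAd v`, where `μ²` is the eigenvalue `z` of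
`K` on `e`. As `e` commutes with `K`, it is fixed by `Uq.halfAd`, so the ideal is preserved. The
square sends `v` to `z • halfAd² v = (halfAd² v) K = K v`. -/
theorem exists_lifting_of_mem_pimIdempotents (hp : 2 ≤ p) (hq : IsPrimitiveRoot q (2 * p))
    {e : Uq p q} (he : e ∈ pimIdempotents p q) {n : ℕ}
    (b : Module.Basis (Fin n) ℂ (Submodule.span (Uq p q) {e})) :
    ∃ ρ' : MatRep (UqHalf p q) n, IsLifting ρ' (basisRep b) := by
  obtain ⟨h1, ⟨z, hz, hz'⟩, -⟩ := he
  obtain ⟨μ, hμ⟩ := IsAlgClosed.exists_pow_nat_eq z (n := 2) two_pos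
  have hσ := Uq.halfAd_eq_self hp hq (x := e) (hz.trans hz'.symm)
  have hσv : ∀ v : Submodule.span (Uq p q) {e}, Uq.halfAd hp hq v * e = Uq.halfAd hp hq v := by
    intro v
    conv_rhs => rw [← mul_idempotent_of_mem_span h1 v.2, map_mul, hσ]
  let k : Module.End ℂ (Submodule.span (Uq p q) {e}) :=
    { toFun := fun v => ⟨μ • Uq.halfAd hp hq v, Submodule.mem_span_singleton.mpr
        ⟨μ • Uq.halfAd hp hq v, by rw [smul_eq_mul, smul_mul_assoc, hσv]⟩⟩
      map_add' := fun v w => by ext; simp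
      map_smul' := fun c v => by ext; simp [smul_comm c μ] }
  have hk : ∀ v, (k v : Uq p q) = μ • Uq.halfAd hp hq v := fun v => rfl
  refine exists_lifting_basisRep b hp k (fun v => ?_) (fun v => ?_) (fun v => ?_)
  · ext
    have h2 : Uq.halfAd hp hq (Uq.halfAd hp hq v) * e = Uq.halfAd hp hq (Uq.halfAd hp hq v) := by
      conv_rhs => rw [← hσv v, map_mul, hσ]
    rw [hk, hk, map_smul, smul_smul, ← pow_two, hμ, Submodule.coe_smul, smul_eq_mul,
      ← Uq.halfAd_halfAd_mul_K hp hq, ← h2, mul_assoc, hz', mul_smul_comm]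
  · ext
    rw [hk, Submodule.coe_smul, smul_eq_mul, map_mul, Uq.halfAd_E, smul_mul_assoc,
      Submodule.coe_smul_of_tower, Submodule.coe_smul, hk, smul_eq_mul, mul_smul_comm, smul_comm]
  · ext
    rw [hk, Submodule.coe_smul, smul_eq_mul, map_mul, Uq.halfAd_F, smul_mul_assoc,
      Submodule.coe_smul_of_tower, Submodule.coe_smul, hk, smul_eq_mul, mul_smul_comm, smul_comm]

/-- The matrix coefficients of the simple and principal indecomposable modules that extend to the
extended quantum group. -/
def liftableCoeffs (p : ℕ) (q : ℂ) : Set (Module.Dual ℂ (Uq p q)) :=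
  {φ | ∃ (n : ℕ) (ρ : MatRep (Uq p q) n) (ρ' : MatRep (UqHalf p q) n) (i j : Fin n),
    IsSimpleOrPIM ρ ∧ IsLifting ρ' ρ ∧
      φ = (Matrix.entryLinearMap ℂ ℂ i j).comp ρ.toLinearMap}

/-- The value `φ (x * e)` is `φ` applied to `x • e` in the left ideal of `e`, and the coordinates of
`x • e` in a basis are combinations of matrix coefficients. -/
theorem comp_mulRight_mem_span (hp : 2 ≤ p) (hq : IsPrimitiveRoot q (2 * p))
    (φ : Module.Dual ℂ (Uq p q)) {e : Uq p q} (he : e ∈ pimIdempotents p q) :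
    φ.comp (LinearMap.mulRight ℂ e) ∈ Submodule.span ℂ (liftableCoeffs p q) := by
  have := Uq.finite q hp
  have : Module.Finite ℂ (Submodule.span (Uq p q) {e}) := Module.Finite.of_injective
    ((Submodule.subtype (Submodule.span (Uq p q) {e})).restrictScalars ℂ) Subtype.val_injective
  let b := Module.finBasis ℂ (Submodule.span (Uq p q) {e})
  obtain ⟨ρ', hρ'⟩ := exists_lifting_of_mem_pimIdempotents hp hq he b
  have hPIM : IsSimpleOrPIM (basisRep (A := Uq p q) b) := Or.inr (he.2.2.congr (basisRepEquiv b))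
  let v : Submodule.span (Uq p q) {e} := ⟨e, Submodule.mem_span_singleton_self e⟩
  have h : φ.comp (LinearMap.mulRight ℂ e) = ∑ i, ∑ j, (b.repr v j * φ (b i)) •
      (Matrix.entryLinearMap ℂ ℂ i j).comp (basisRep (A := Uq p q) b).toLinearMap := by
    ext x
    have h1 : x * e = ((x • v : Submodule.span (Uq p q) {e}) : Uq p q) := rfl
    rw [LinearMap.comp_apply, LinearMap.mulRight_apply, h1, ← b.sum_repr (x • v)]
    simp only [← basisRep_mulVec_repr, Matrix.mulVec, dotProduct, Submodule.coe_sum, map_sum,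
      LinearMap.sum_apply]
    refine Finset.sum_congr rfl fun i _ => ?_
    rw [Submodule.coe_smul_of_tower, map_smul, smul_eq_mul, Finset.sum_mul]
    refine Finset.sum_congr rfl fun j _ => ?_
    rw [LinearMap.smul_apply, smul_eq_mul, LinearMap.comp_apply, Matrix.entryLinearMap_apply,
      AlgHom.toLinearMap_apply]
    ring
  rw [h]
  exact Submodule.sum_mem _ fun i _ => Submodule.sum_mem _ fun j _ => Submodule.smul_mem _ _
    (Submodule.subset_span ⟨_, _, ρ', i, j, hPIM, hρ', rfl⟩)

/-- The set of `e` for which `x ↦ φ (x * e)` is in the span is closed under sums, and `1` is a sum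
of elements of `pimIdempotents`. -/
theorem span_liftableCoeffs (hp : 2 ≤ p) (hq : IsPrimitiveRoot q (2 * p)) (hr : r ^ 2 = q) :
    Submodule.span ℂ (liftableCoeffs p q) = ⊤ := by
  rw [eq_top_iff]
  rintro φ -
  have h : ∀ e ∈ AddSubmonoid.closure (pimIdempotents p q),
      φ.comp (LinearMap.mulRight ℂ e) ∈ Submodule.span ℂ (liftableCoeffs p q) := by
    intro e he
    induction he using AddSubmonoid.closure_induction with
    | mem e he => exact comp_mulRight_mem_span hp hq φ he
    | zero => rw [LinearMap.mulRight_zero_eq_zero, LinearMap.comp_zero]; exact zero_mem _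
    | add x y _ _ hx hy =>
      have h1 : LinearMap.mulRight ℂ (x + y) = LinearMap.mulRight ℂ x + LinearMap.mulRight ℂ y := by
        ext z; simp [mul_add]
      rw [h1, LinearMap.comp_add]
      exact add_mem hx hy
  have h2 := h 1 (one_mem_closure_pimIdempotents hp (isPrimitiveRoot_sqrt hp hq hr))
  rwa [LinearMap.mulRight_one, LinearMap.comp_id] at h2

theorem coeffRange_eq_span (hp : 2 ≤ p) (hq : IsPrimitiveRoot q (2 * p)) (hr : r ^ 2 = q) :
    coeffRange hp hq r = Submodule.span ℂ
      (((L01.mk hp hq r).toLinearMap.comp (TensorAlgebra.ι ℂ)) '' liftableCoeffs p q) := by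
  rw [← Submodule.map_span, span_liftableCoeffs hp hq hr, Submodule.map_top, coeffRange]

theorem mul_mem_coeffRange (hp : 2 ≤ p) (hq : IsPrimitiveRoot q (2 * p)) (hr : r ^ 2 = q)
    {x y : L01 hp hq r} (hx : x ∈ coeffRange hp hq r) (hy : y ∈ coeffRange hp hq r) :
    x * y ∈ coeffRange hp hq r := by
  have h : coeffRange hp hq r * coeffRange hp hq r ≤ coeffRange hp hq r := by
    conv_lhs => rw [coeffRange_eq_span hp hq hr, Submodule.span_mul_span]
    rw [Submodule.span_le]
    rintro _ ⟨_, ⟨_, ⟨m, I, I', i, s, hI, hI', rfl⟩, rfl⟩, _,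
      ⟨_, ⟨n, J, J', t, l, hJ, hJ', rfl⟩, rfl⟩, rfl⟩
    exact loopM_mul_loopM_mem hp hq hr I J I' J' hI hJ hI' hJ' i s t l
  exact h (Submodule.mul_mem_mul hx hy)

/-- The image of the dual contains `1` by the relation for the counit and is closed under products,
so it is a subalgebra; it contains the generators. -/
theorem coeffRange_eq_top (hp : 2 ≤ p) (hq : IsPrimitiveRoot q (2 * p)) (hr : r ^ 2 = q) :
    coeffRange hp hq r = ⊤ := by
  have h1 : (1 : L01 hp hq r) ∈ coeffRange hp hq r := by
    refine ⟨(Uq.counit (p := p) (q := q) hp).toLinearMap, ?_⟩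
    rw [LinearMap.comp_apply, AlgHom.toLinearMap_apply]
    exact (RingQuot.mkAlgHom_rel ℂ (LoopRel.unit (hp := hp) (hq := hq) (r := r))).trans
      (map_one (L01.mk hp hq r))
  let S : Subalgebra ℂ (L01 hp hq r) := (coeffRange hp hq r).toSubalgebra h1
    fun x y hx hy => mul_mem_coeffRange hp hq hr hx hy
  have hS : S = ⊤ := by
    have h2 : Function.Surjective (L01.mk hp hq r) := RingQuot.mkAlgHom_surjective ℂ _
    rw [eq_top_iff, ← (AlgHom.range_eq_top (L01.mk hp hq r)).mpr h2, ← Algebra.map_top,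
      ← TensorAlgebra.adjoin_range_ι, AlgHom.map_adjoin, Algebra.adjoin_le_iff]
    rintro _ ⟨_, ⟨φ, rfl⟩, rfl⟩
    exact ⟨φ, rfl⟩
  rw [eq_top_iff]
  intro x _
  have : x ∈ S := by rw [hS]; trivial
  exact this

theorem L01.finite (hp : 2 ≤ p) (hq : IsPrimitiveRoot q (2 * p)) (hr : r ^ 2 = q) :
    Module.Finite ℂ (L01 hp hq r) := by
  have := Uq.finite q hp
  exact Module.Finite.of_surjective _ (LinearMap.range_eq_top.mp (coeffRange_eq_top hp hq hr))

theorem L01.finrank_le (hp : 2 ≤ p) (hq : IsPrimitiveRoot q (2 * p)) (hr : r ^ 2 = q) :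
    Module.finrank ℂ (L01 hp hq r) ≤ Fintype.card (Fin p × Fin p × Fin (2 * p)) := by
  have := Uq.finite q hp
  rw [← finrank_top ℂ (L01 hp hq r), ← coeffRange_eq_top hp hq hr, coeffRange]
  exact (LinearMap.finrank_range_le _).trans
    ((Subspace.dual_finrank_eq (K := ℂ) (V := Uq p q)).le.trans (Uq.finrank_le q hp))

end

end LoopAlgebra

end

noncomputable section

namespace LoopAlgebra

/-! ### The monomial basis and the presentation -/

section

variable {p : ℕ} {q r : ℂ}

theorem injective_of_linearIndependent_comp {ι V W : Type*} [Fintype ι] [AddCommGroup V]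
    [Module ℂ V] [AddCommGroup W] [Module ℂ W] (f : V →ₗ[ℂ] W) {v : ι → V}
    (hv : Submodule.span ℂ (Set.range v) = ⊤) (h : LinearIndependent ℂ fun i => f (v i)) :
    Function.Injective f := by
  refine (injective_iff_map_eq_zero f).mpr fun x hx => ?_
  have hx' : x ∈ Submodule.span ℂ (Set.range v) := by rw [hv]; trivial
  obtain ⟨c, rfl⟩ := (Submodule.mem_span_range_iff_exists_fun ℂ).mp hx'
  simp only [map_sum, map_smul] at hx
  have hc := Fintype.linearIndependent_iff.mp h c hx
  exact Finset.sum_eq_zero fun i _ => by rw [hc i, zero_smul]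

theorem LoopRelations.of_injective {A B : Type} [Ring A] [Algebra ℂ A] [Ring B] [Algebra ℂ B]
    (φ : A →ₐ[ℂ] B) (hφ : Function.Injective φ) {a b c d : A}
    (h : LoopRelations p q (φ a) (φ b) (φ c) (φ d)) : LoopRelations p q a b c d := by
  refine ⟨⟨?_, ?_, ?_, ?_, ?_, ?_⟩, ?_, ?_, ?_, ?_⟩ <;> apply hφ <;>
    simp only [map_mul, map_smul, map_add, map_sub, map_pow, map_one, map_zero]
  exacts [h.exchange.d_a, h.exchange.d_b, h.exchange.d_c, h.exchange.b_a, h.exchange.c_b,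
    h.exchange.c_a, h.det, h.b_pow, h.c_pow, h.d_pow]

/-- The matrix of the fundamental representation, with coefficients in the loop algebra. -/
def fundamentalM (hp : 2 ≤ p) (hq : IsPrimitiveRoot q (2 * p)) (r : ℂ) :
    Matrix (Fin 2) (Fin 2) (L01 hp hq r) :=
  loopM hp hq r (X2 hp hq)

/-- The ordered monomials in the coefficients of the fundamental matrix. -/
def loopMonomial (hp : 2 ≤ p) (hq : IsPrimitiveRoot q (2 * p)) (r : ℂ)
    (x : Fin p × Fin p × Fin (2 * p)) : L01 hp hq r :=
  fundamentalM hp hq r 0 1 ^ (x.1 : ℕ) * fundamentalM hp hq r 1 0 ^ (x.2.1 : ℕ) *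
    fundamentalM hp hq r 1 1 ^ (x.2.2 : ℕ)

theorem toUqHalf_fundamentalM (hp : 2 ≤ p) (hq : IsPrimitiveRoot q (2 * p)) (hr : r ^ 2 = q)
    (i j : Fin 2) :
    toUqHalf hp hq hr (fundamentalM hp hq r i j) =
      !![UqHalf.k p q ^ 2 + (q⁻¹ * (q - q⁻¹) ^ 2) • (UqHalf.F p q * UqHalf.E p q),
        (q⁻¹ * (q - q⁻¹)) • UqHalf.F p q;
        (q - q⁻¹) • (UqHalf.k p q ^ (4 * p - 2) * UqHalf.E p q),
          UqHalf.k p q ^ (4 * p - 2)] i j := by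
  rw [← evalLeft_X2 hp hq hr, ← map_toUqHalf_loopM]
  rfl

theorem linearIndependent_toUqHalf_loopMonomial (hp : 2 ≤ p) (hq : IsPrimitiveRoot q (2 * p))
    (hr : r ^ 2 = q) :
    LinearIndependent ℂ fun x => toUqHalf hp hq hr (loopMonomial hp hq r x) := by
  simpa [loopMonomial, toUqHalf_fundamentalM] using linearIndependent_monomials hp hq hr

theorem linearIndependent_loopMonomial (hp : 2 ≤ p) (hq : IsPrimitiveRoot q (2 * p))
    (hr : r ^ 2 = q) : LinearIndependent ℂ (loopMonomial hp hq r) :=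
  LinearIndependent.of_comp (toUqHalf hp hq hr).toLinearMap
    (linearIndependent_toUqHalf_loopMonomial hp hq hr)

/-- The two bounds meet: `2p³` independent elements in an algebra of dimension at most `2p³`. -/
theorem span_loopMonomial (hp : 2 ≤ p) (hq : IsPrimitiveRoot q (2 * p))
    (hr : r ^ 2 = q) : Submodule.span ℂ (Set.range (loopMonomial hp hq r)) = ⊤ := by
  have := L01.finite hp hq hr
  have h := linearIndependent_loopMonomial hp hq hr
  exact h.span_eq_top_of_card_eq_finrank'
    (le_antisymm h.fintype_card_le_finrank (L01.finrank_le hp hq hr))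

theorem toUqHalf_injective (hp : 2 ≤ p) (hq : IsPrimitiveRoot q (2 * p))
    (hr : r ^ 2 = q) : Function.Injective (toUqHalf hp hq hr) :=
  injective_of_linearIndependent_comp (toUqHalf hp hq hr).toLinearMap
    (span_loopMonomial hp hq hr) (linearIndependent_toUqHalf_loopMonomial hp hq hr)

/-- The relations hold for the images in the extended quantum group, and injectivity of `toUqHalf`
brings them back. The fusion relation for `X⁺(2)` itself is not invoked. -/
theorem loopRelations_fundamentalM (hp : 2 ≤ p) (hq : IsPrimitiveRoot q (2 * p))
    (hr : r ^ 2 = q) : LoopRelations p q (fundamentalM hp hq r 0 0)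
    (fundamentalM hp hq r 0 1) (fundamentalM hp hq r 1 0) (fundamentalM hp hq r 1 1) := by
  refine LoopRelations.of_injective (toUqHalf hp hq hr) (toUqHalf_injective hp hq hr) ?_
  simpa [toUqHalf_fundamentalM] using loopRelations_uqHalf hp hq

theorem adjoin_fundamentalM (hp : 2 ≤ p) (hq : IsPrimitiveRoot q (2 * p))
    (hr : r ^ 2 = q) : Algebra.adjoin ℂ {fundamentalM hp hq r 0 0,
    fundamentalM hp hq r 0 1, fundamentalM hp hq r 1 0, fundamentalM hp hq r 1 1} = ⊤ := by
  rw [← Algebra.toSubmodule_eq_top, eq_top_iff, ← span_loopMonomial hp hq hr, Submodule.span_le]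
  rintro _ ⟨x, rfl⟩
  exact Subalgebra.mul_mem _ (Subalgebra.mul_mem _
    (Subalgebra.pow_mem _ (Algebra.subset_adjoin (by simp)) _)
    (Subalgebra.pow_mem _ (Algebra.subset_adjoin (by simp)) _))
    (Subalgebra.pow_mem _ (Algebra.subset_adjoin (by simp)) _)

/-- The ordered monomials span the presented algebra and are mapped to a basis of the loop algebra.
-/
theorem lift_bijective (hp : 2 ≤ p) (hq : IsPrimitiveRoot q (2 * p))
    (hr : r ^ 2 = q) : Function.Bijective (loopRelations_fundamentalM hp hq hr).lift := by
  set h := loopRelations_fundamentalM hp hq hr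
  have h1 : ∀ x : Fin p × Fin p × Fin (2 * p), h.lift (PresAlg.gen p q PresGen.b ^ (x.1 : ℕ) *
      PresAlg.gen p q PresGen.c ^ (x.2.1 : ℕ) * PresAlg.gen p q PresGen.d ^ (x.2.2 : ℕ)) =
        loopMonomial hp hq r x := by
    intro x
    rw [map_mul, map_mul, map_pow, map_pow, map_pow, h.lift_gen, h.lift_gen, h.lift_gen]
    rfl
  constructor
  · refine injective_of_linearIndependent_comp h.lift.toLinearMap
      (PresAlg.span_monomials hp (Uq.q_ne_zero hp hq)) ?_
    simp only [AlgHom.toLinearMap_apply, h1]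
    exact linearIndependent_loopMonomial hp hq hr
  · refine (LinearMap.range_eq_top (f := h.lift.toLinearMap)).mp ?_
    rw [eq_top_iff, ← span_loopMonomial hp hq hr, Submodule.span_le]
    rintro _ ⟨x, rfl⟩
    exact ⟨_, h1 x⟩

end

end LoopAlgebra

end

theorem mainTheorem10 (p : ℕ) (hp : 2 ≤ p) (q : ℂ) (hq : IsPrimitiveRoot q (2 * p))
    (r : ℂ) (hr : r ^ 2 = q) :
    let M : Matrix (Fin 2) (Fin 2) (LoopAlgebra.L01 hp hq r) :=
      LoopAlgebra.loopM hp hq r (LoopAlgebra.X2 hp hq)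
    let a := M 0 0
    let b := M 0 1
    let c := M 1 0
    let d := M 1 1
    -- the coefficients of `M` generate the loop algebra
    Algebra.adjoin ℂ ({a, b, c, d} : Set (LoopAlgebra.L01 hp hq r)) = ⊤ ∧
    -- `M` satisfies the reflection equation, which amounts to the exchange relations
    LoopAlgebra.ReflectionEquation hp hq r hr M ∧
    (∀ (A : Type) [Ring A] [Algebra ℂ A] (N : Matrix (Fin 2) (Fin 2) A),
      LoopAlgebra.ReflectionEquation hp hq r hr N ↔
        LoopAlgebra.ExchangeRelations q (N 0 0) (N 0 1) (N 1 0) (N 1 1)) ∧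
    -- the presentation
    (∃ φ : LoopAlgebra.PresAlg p q ≃ₐ[ℂ] LoopAlgebra.L01 hp hq r,
      φ (LoopAlgebra.PresAlg.gen p q LoopAlgebra.PresGen.a) = a ∧
      φ (LoopAlgebra.PresAlg.gen p q LoopAlgebra.PresGen.b) = b ∧
      φ (LoopAlgebra.PresAlg.gen p q LoopAlgebra.PresGen.c) = c ∧
      φ (LoopAlgebra.PresAlg.gen p q LoopAlgebra.PresGen.d) = d) ∧
    -- the monomial basis
    (∃ B : Module.Basis (Fin p × Fin p × Fin (2 * p)) ℂ (LoopAlgebra.L01 hp hq r),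
      ∀ (i j : Fin p) (k : Fin (2 * p)),
        B (i, j, k) = b ^ (i : ℕ) * c ^ (j : ℕ) * d ^ (k : ℕ)) := by
  intro M a b c d
  have h := LoopAlgebra.loopRelations_fundamentalM hp hq hr
  refine ⟨LoopAlgebra.adjoin_fundamentalM hp hq hr,
    (LoopAlgebra.reflectionEquation_iff hp hq hr M).mpr h.exchange,
    fun A _ _ N => LoopAlgebra.reflectionEquation_iff hp hq hr N,
    ⟨AlgEquiv.ofBijective h.lift (LoopAlgebra.lift_bijective hp hq hr),
      h.lift_gen _, h.lift_gen _, h.lift_gen _, h.lift_gen _⟩,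
    ⟨Module.Basis.mk (LoopAlgebra.linearIndependent_loopMonomial hp hq hr)
      (LoopAlgebra.span_loopMonomial hp hq hr).ge, fun i j k => Module.Basis.mk_apply _ _ _⟩⟩
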